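/- Let $m>0$ and $0<\alpha<1$. For $\beta\in\mathbb{R}$ and $\varphi\in H^{1/2}(\mathbb{R}^3)$ (complex-valued) let $$\mathcal{E}_\beta(\varphi)=\frac12\langle\varphi,\sqrt{-\Delta+m^2}\,\varphi\rangle+\frac14\int_{\mathbb{R}^3}\int_{\mathbb{R}^3}\Big(\frac{\beta}{|x-y|^\alpha}-\frac{1}{|x-y|}\Big)|\varphi(x)|^2|\varphi(y)|^2\,dx\,dy,$$ where $\langle\varphi,\sqrt{-\Delta+m^2}\,\varphi\rangle$ is the quadratic form defined through the Fourier transform, and for $N>0$ let $$E(\beta,N)=\inf\Big\{\mathcal{E}_\beta(\varphi):\varphi\in H^{1/2}(\mathbb{R}^3),\ \int_{\mathbb{R}^3}|\varphi|^2\,dx=N\Big\}\in[-\infty,\infty).$$ A minimizer for $E(\beta,N)$ is a function $\varphi\in H^{1/2}(\mathbb{R}^3)$ with $\int|\varphi|^2\,dx=N$ and $\mathcal{E}_\beta(\varphi)=E(\beta,N)$. Let the critical mass $N_c$ be defined by $$\frac{N_c}{2}=\inf_{\psi\in H^{1/2}(\mathbb{R}^3),\ \psi\neq0}\frac{\langle\psi,\sqrt{-\Delta}\,\psi\rangle\,\langle\psi,\psi\rangle}{\int_{\mathbb{R}^3}\big(\frac{1}{|x|}*|\psi|^2\big)|\psi|^2\,dx}.$$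 Then: (i) For every $\beta\le0$ there is no minimizer for $E(\beta,N_c)$; moreover $E(0,N_c)=0$, and $E(\beta,N_c)=-\infty$ for every $\beta<0$. (ii) There is $\beta_0>0$, depending only on $m$ and $\alpha$, such that for every $0<\beta<\beta_0$ there exists at least one minimizer for $E(\beta,N_c)$. (These minimizers are called maximal ground states.) -/

import Mathlib

open MeasureTheory FourierTransform TemperedDistribution
open scoped SchwartzMap

noncomputable section

namespace BosonStar

/-- Three-dimensional Euclidean space. -/
abbrev R3 : Type := EuclideanSpace ℝ (Fin 3)

/-- Complex-valued `L²` functions on `ℝ³`. -/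
abbrev L2 : Type := Lp (α := R3) ℂ 2

/-- The Sobolev space `H^{1/2}(ℝ³)`, as a set of `L²` functions. -/
def HHalf : Set L2 :=
  {φ | MemSobolev (1 / 2) 2 (φ : 𝓢'(R3, ℂ))}

/-- The mass `∫ |φ|²`. -/
def mass (φ : L2) : ℝ := ∫ x : R3, ‖φ x‖ ^ 2

/-- The quadratic form `⟨φ, √(-Δ + m²) φ⟩`. With the Fourier transform
`𝓕 φ ξ = ∫ e^{-2πi x·ξ} φ x dx`, the operator `-Δ` is multiplication by `(2π|ξ|)²`. -/
def kinetic (m : ℝ) (φ : L2) : ℝ :=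
  ∫ ξ : R3, Real.sqrt ((2 * Real.pi * ‖ξ‖) ^ 2 + m ^ 2) * ‖(𝓕 φ : L2) ξ‖ ^ 2

/-- The Newtonian self-interaction `∫ (|x|⁻¹ ∗ |φ|²) |φ|²`. -/
def newton (φ : L2) : ℝ :=
  ∫ x : R3, (∫ y : R3, 1 / ‖x - y‖ * ‖φ y‖ ^ 2) * ‖φ x‖ ^ 2

/-- The interaction energy
`I(φ) = 1/4 ∬ (β / |x - y|^α - 1 / |x - y|) |φ x|² |φ y|² dx dy`. -/
def interaction (α β : ℝ) (φ : L2) : ℝ :=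
  1 / 4 * ∫ x : R3, ∫ y : R3,
    (β / ‖x - y‖ ^ α - 1 / ‖x - y‖) * ‖φ x‖ ^ 2 * ‖φ y‖ ^ 2

/-- The energy functional `1/2 ⟨φ, √(-Δ + m²) φ⟩ + I(φ)`. -/
def energy (m α β : ℝ) (φ : L2) : ℝ :=
  1 / 2 * kinetic m φ + interaction α β φ

/-- The admissible functions of mass `N`. -/
def admissible (N : ℝ) : Set L2 := {φ | φ ∈ HHalf ∧ mass φ = N}

/-- The ground state energy `E(β, N)`, an extended real number. -/
def groundEnergy (m α β N : ℝ) : EReal :=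
  ⨅ φ ∈ admissible N, (energy m α β φ : EReal)

/-- `φ` is a minimizer (ground state) for `E(β, N)`. -/
def IsMinimizer (m α β N : ℝ) (φ : L2) : Prop :=
  φ ∈ admissible N ∧ (energy m α β φ : EReal) = groundEnergy m α β N

/-- The critical (Chandrasekhar) mass `N_c`: `N_c / 2` is the infimum over nonzero
`ψ ∈ H^{1/2}` of `⟨ψ, √(-Δ) ψ⟩ ⟨ψ, ψ⟩ / ∫ (|x|⁻¹ ∗ |ψ|²) |ψ|²`. -/
def criticalMass : ℝ :=
  2 * sInf ((fun ψ : L2 => kinetic 0 ψ * mass ψ / newton ψ) '' {ψ | ψ ∈ HHalf ∧ ψ ≠ 0})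

end BosonStar

end

noncomputable section

namespace BosonStar

open Metric Set Filter Topology
open scoped ENNReal

/-! ### The Fourier transform on `L¹ ∩ L²` and the description of `H^{1/2}` on the Fourier side -/

/-! Write `T` for `kinetic 0`, `K` for `kinetic m`, `D` for `newton` and `W` for `inter (riesz α)`,
so that the energy is `K/2 + (β W - D)/4`. Under the mass-preserving dilation by `l`, both `T` and
`D` scale like `l`, while `W` scales like `l ^ α`. The definition of the critical mass `N` gives `D
≤ 2 T` at mass `N`, and `exists_optimizer` yields some `Q` with equality. It rests on the fact that
`T - D/2` is positive on nonzero functions of mass below `N` and splits over a profile and a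
remainder.

Nonexistence: for `β ≥ 0` the energy is strictly positive because `K > T`. Dilating `Q` drives `K -
T` to zero, so the infimum at `β = 0` is zero and is not attained. For `β < 0` the linear terms in
`l` cancel exactly on dilations of `Q`, the rest of the kinetic energy is at most `m N / 2`, and `β
l ^ α W(Q) / 4` tends to `-∞`.

Existence: for small `β > 0` a fixed trial function puts the infimum `e` below `m N / 2`, the energy
of a mass spread out to infinity. If `T` were large at bounded energy, then `D ≥ T`, so a fixed
amount of mass would sit in a ball of radius of order `1 / T`, forcing `W` to be of order `T ^ α`.
But `W` is bounded by the energy (`exists_kinetic_bound`). Hence minimizing sequences are bounded,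
and `e < m N / 2` keeps `D` away from zero. By `exists_profile` they split, up to translation, into
a nonzero profile of mass `t N` and a remainder. The inequality `le_energy_of_mass_le` applied to
both parts gives `t (1 - t) (m N / 2 - e) ≤ 0`, so `t = 1` and the profile is a minimizer.

The analytic tool is a layer-cake formula for `1 / |z|` in balls of radius `R`, combined with a
splitting of frequencies at `κ / R`. It gives the bound `D ≤ C T * mass` and the quantitative
nonvanishing estimate `newton_le_of_locMass_le`. -/

/-- Locally integrable functions with the same integrals against Schwartz functions agree a.e. -/
theorem ae_eq_of_integral_schwartz {f g : R3 → ℂ} (hf : LocallyIntegrable f)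
    (hg : LocallyIntegrable g)
    (h : ∀ u : 𝓢(R3, ℂ), ∫ x, u x * f x = ∫ x, u x * g x) : f =ᵐ[volume] g := by
  apply ae_eq_of_integral_contDiff_smul_eq hf hg
  intro u hu hc
  have h₁ : HasCompactSupport (Complex.ofRealCLM ∘ u) := hc.comp_left rfl
  have h₂ : ContDiff ℝ ((⊤ : ℕ∞) : WithTop ℕ∞) (Complex.ofRealCLM ∘ u) := by fun_prop
  simpa using h (h₁.toSchwartzMap h₂)

theorem locallyIntegrable_L2 (φ : L2) : LocallyIntegrable (φ : R3 → ℂ) :=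
  (Lp.memLp φ).locallyIntegrable (by norm_num)

theorem integral_mul_fourier (φ : L2) (u : 𝓢(R3, ℂ)) :
    ∫ x, u x * (𝓕 φ : L2) x = ∫ x, (𝓕 u) x * φ x := by
  have := congrArg (fun T : 𝓢'(R3, ℂ) => T u) (Lp.fourier_toTemperedDistribution_eq φ)
  simpa [TemperedDistribution.fourier_apply] using this.symm

theorem integral_mul_fourierInv (φ : L2) (u : 𝓢(R3, ℂ)) :
    ∫ x, u x * (𝓕⁻ φ : L2) x = ∫ x, (𝓕⁻ u) x * φ x := by
  have := congrArg (fun T : 𝓢'(R3, ℂ) => T u) (Lp.fourierInv_toTemperedDistribution_eq φ)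
  simpa [TemperedDistribution.fourierInv_apply] using this.symm

theorem continuous_fourier_of_integrable {f : R3 → ℂ} (hf : Integrable f) :
    Continuous (𝓕 f) :=
  VectorFourier.fourierIntegral_continuous Real.continuous_fourierChar
    (by exact continuous_inner) hf

theorem continuous_fourierInv_of_integrable {f : R3 → ℂ} (hf : Integrable f) :
    Continuous (𝓕⁻ f) := by
  rw [Real.fourierInv_eq_fourier_comp_neg]
  exact continuous_fourier_of_integrable hf.comp_neg

theorem integral_mul_fourier_of_integrable {f g : R3 → ℂ} (hf : Integrable f)
    (hg : Integrable g) : ∫ x, (𝓕 f) x * g x = ∫ x, f x * (𝓕 g) x := by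
  have := VectorFourier.integral_fourierIntegral_smul_eq_flip (μ := volume) (ν := volume)
    (L := innerₗ R3) Real.continuous_fourierChar continuous_inner hf hg
  rw [flip_innerₗ] at this
  exact this

theorem integral_mul_fourierInv_of_integrable {f g : R3 → ℂ} (hf : Integrable f)
    (hg : Integrable g) : ∫ x, (𝓕⁻ f) x * g x = ∫ x, f x * (𝓕⁻ g) x := by
  have h := integral_mul_fourier_of_integrable hf.comp_neg hg
  rw [Real.fourierInv_eq_fourier_comp_neg f, h, ← integral_neg_eq_self]
  simp [Real.fourierInv_eq_fourier_neg]

/-- On `L¹ ∩ L²` the `L²` Fourier transform is given by the Fourier integral. -/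
theorem fourier_L2_ae_eq (g : L2) (hg : Integrable g) :
    (𝓕 g : L2) =ᵐ[volume] 𝓕 (g : R3 → ℂ) := by
  refine ae_eq_of_integral_schwartz (locallyIntegrable_L2 _)
    (continuous_fourier_of_integrable hg).locallyIntegrable fun u => ?_
  rw [integral_mul_fourier, SchwartzMap.fourier_coe,
    integral_mul_fourier_of_integrable u.integrable hg]

/-- On `L¹ ∩ L²` the inverse `L²` Fourier transform is given by the Fourier integral. -/
theorem fourierInv_L2_ae_eq (g : L2) (hg : Integrable g) :
    (𝓕⁻ g : L2) =ᵐ[volume] 𝓕⁻ (g : R3 → ℂ) := by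
  refine ae_eq_of_integral_schwartz (locallyIntegrable_L2 _)
    (continuous_fourierInv_of_integrable hg).locallyIntegrable fun u => ?_
  rw [integral_mul_fourierInv, SchwartzMap.fourierInv_coe,
    integral_mul_fourierInv_of_integrable u.integrable hg]

/-- Translates the distributional multiplier in Mathlib's Sobolev condition into an a.e. identity of
functions, by testing against Schwartz functions. -/
theorem smulLeftCLM_L2_eq_iff {g : R3 → ℂ} (hg : g.HasTemperateGrowth) (u v : L2) :
    smulLeftCLM ℂ g (u : 𝓢'(R3, ℂ)) = v ↔ (fun x => g x * u x) =ᵐ[volume] v := by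
  have key : ∀ w : 𝓢(R3, ℂ), smulLeftCLM ℂ g (u : 𝓢'(R3, ℂ)) w = ∫ x, w x * (g x * u x) := by
    intro w
    rw [smulLeftCLM_apply_apply, Lp.toTemperedDistribution_apply]
    refine integral_congr_ae (Filter.Eventually.of_forall fun x => ?_)
    simp only [SchwartzMap.smulLeftCLM_apply_apply hg, smul_eq_mul]
    ring
  constructor
  · intro h
    refine ae_eq_of_integral_schwartz ?_ (locallyIntegrable_L2 v) fun w => ?_
    · exact (locallyIntegrable_L2 u).continuous_mul hg.1.continuous
    · rw [← key, h, Lp.toTemperedDistribution_apply]; rfl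
  · intro h
    ext w
    rw [key, Lp.toTemperedDistribution_apply]
    refine integral_congr_ae ?_
    filter_upwards [h] with x hx
    rw [hx, smul_eq_mul]

theorem memLp_two_iff_integrable_norm_sq {f : R3 → ℂ} (hf : AEStronglyMeasurable f) :
    MemLp f 2 ↔ Integrable fun x => ‖f x‖ ^ 2 := by
  rw [memLp_two_iff_integrable_sq_norm hf]

theorem integrable_norm_sq (φ : L2) : Integrable fun x => ‖φ x‖ ^ 2 :=
  (memLp_two_iff_integrable_norm_sq (Lp.aestronglyMeasurable φ)).1 (Lp.memLp φ)

theorem mass_eq_norm_sq (φ : L2) : mass φ = ‖φ‖ ^ 2 := by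
  have h := @inner_self_eq_norm_sq_to_K ℂ L2 _ _ _ φ
  rw [L2.inner_def] at h
  have h2 : ∫ x, (inner ℂ (φ x) (φ x) : ℂ) = ((∫ x, ‖φ x‖ ^ 2 : ℝ) : ℂ) := by
    rw [← integral_complex_ofReal]
    refine integral_congr_ae (Filter.Eventually.of_forall fun x => ?_)
    simp [inner_self_eq_norm_sq_to_K]
  rw [h2] at h
  apply Complex.ofReal_injective
  rw [mass, h]
  simp

theorem mass_nonneg (φ : L2) : 0 ≤ mass φ := by rw [mass_eq_norm_sq]; positivity

theorem mass_fourier (φ : L2) : ∫ ξ, ‖(𝓕 φ : L2) ξ‖ ^ 2 = mass φ := by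
  rw [mass_eq_norm_sq, ← Lp.norm_fourier_eq φ, ← mass_eq_norm_sq]; rfl

theorem one_add_norm_sq_rpow_sq (x : R3) :
    ((1 + ‖x‖ ^ 2) ^ ((1 / 2 : ℝ) / 2)) ^ 2 = Real.sqrt (1 + ‖x‖ ^ 2) := by
  rw [Real.sqrt_eq_rpow, ← Real.rpow_natCast, ← Real.rpow_mul (by positivity)]
  norm_num

/-- `H^{1/2}` consists of the `φ` for which `|ξ| |φ̂(ξ)|²` is integrable. -/
theorem mem_HHalf_iff (φ : L2) :
    φ ∈ HHalf ↔ Integrable fun ξ : R3 => ‖ξ‖ * ‖(𝓕 φ : L2) ξ‖ ^ 2 := by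
  have hgr : (fun x : R3 => (((1 + ‖x‖ ^ 2) ^ ((1 / 2 : ℝ) / 2) : ℝ) : ℂ)).HasTemperateGrowth := by
    fun_prop
  have hmeas : AEStronglyMeasurable
      (fun x : R3 => (((1 + ‖x‖ ^ 2) ^ ((1 / 2 : ℝ) / 2) : ℝ) : ℂ) * (𝓕 φ : L2) x) :=
    hgr.1.continuous.aestronglyMeasurable.mul (Lp.aestronglyMeasurable _)
  have hnorm : ∀ x : R3, ‖(((1 + ‖x‖ ^ 2) ^ ((1 / 2 : ℝ) / 2) : ℝ) : ℂ) * (𝓕 φ : L2) x‖ ^ 2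
      = Real.sqrt (1 + ‖x‖ ^ 2) * ‖(𝓕 φ : L2) x‖ ^ 2 := by
    intro x
    rw [norm_mul, mul_pow, Complex.norm_real, Real.norm_of_nonneg (by positivity),
      one_add_norm_sq_rpow_sq]
  have h1 : φ ∈ HHalf ↔ MemLp
      (fun x : R3 => (((1 + ‖x‖ ^ 2) ^ ((1 / 2 : ℝ) / 2) : ℝ) : ℂ) * (𝓕 φ : L2) x) 2 := by
    unfold HHalf
    rw [Set.mem_ofPred_eq, memSobolev_iff_exists_smulLeftCLM_fourier,
      Lp.fourier_toTemperedDistribution_eq]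
    simp_rw [smulLeftCLM_L2_eq_iff hgr]
    constructor
    · rintro ⟨f', hf'⟩
      exact (memLp_congr_ae hf').2 (Lp.memLp f')
    · intro h
      exact ⟨h.toLp, h.coeFn_toLp.symm⟩
  rw [h1, memLp_two_iff_integrable_norm_sq hmeas]
  simp_rw [hnorm]
  have hm : AEStronglyMeasurable (fun x => ‖(𝓕 φ : L2) x‖ ^ 2) :=
    (integrable_norm_sq (𝓕 φ)).aestronglyMeasurable
  constructor
  -- The squared Sobolev weight `√(1 + |ξ|²)` lies between `|ξ|` and `1 + |ξ|`, and `|φ̂|²` is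
  -- integrable anyway, so only `|ξ|` matters.
  · intro h
    refine h.mono (continuous_norm.aestronglyMeasurable.mul hm)
      (Filter.Eventually.of_forall fun x => ?_)
    rw [Real.norm_of_nonneg (by positivity), Real.norm_of_nonneg (by positivity)]
    gcongr
    exact Real.le_sqrt_of_sq_le (by linarith)
  · intro h
    refine (h.add (integrable_norm_sq (𝓕 φ))).mono
      ((by fun_prop : Continuous fun x : R3 => Real.sqrt (1 + ‖x‖ ^ 2)).aestronglyMeasurable.mul hm)
      (Filter.Eventually.of_forall fun x => ?_)
    simp only [Pi.add_apply]
    rw [Real.norm_of_nonneg (by positivity), Real.norm_of_nonneg (by positivity), ← add_one_mul]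
    gcongr
    exact Real.sqrt_le_iff.2 ⟨by positivity, by nlinarith [norm_nonneg x]⟩

/-! ### Splitting into low and high frequencies -/

/-- `∫_{|ξ| < Λ} |φ̂|`. -/
def lowAmp (φ : L2) (Λ : ℝ) : ℝ≥0∞ := ∫⁻ ξ in ball (0 : R3) Λ, ‖(𝓕 φ : L2) ξ‖ₑ

/-- `∫_{|ξ| ≥ Λ} |φ̂|²`. -/
def highMass (φ : L2) (Λ : ℝ) : ℝ≥0∞ := ∫⁻ ξ in (ball (0 : R3) Λ)ᶜ, ‖(𝓕 φ : L2) ξ‖ₑ ^ 2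

/-- `∫ |ξ| |φ̂|²`. -/
def kin (φ : L2) : ℝ≥0∞ := ∫⁻ ξ : R3, ‖ξ‖ₑ * ‖(𝓕 φ : L2) ξ‖ₑ ^ 2

/-- `∫ |φ|²` as an extended nonnegative number. -/
def massE (φ : L2) : ℝ≥0∞ := ∫⁻ x : R3, ‖φ x‖ₑ ^ 2

/-- The mass of `φ` in the ball of radius `R` around `x`. -/
def locMass (φ : L2) (x : R3) (R : ℝ) : ℝ≥0∞ := ∫⁻ y in ball x R, ‖φ y‖ₑ ^ 2

/-- The part of `φ` with frequencies in the ball of radius `Λ`. -/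
def lowPart (φ : L2) (Λ : ℝ) : R3 → ℂ :=
  𝓕⁻ ((ball (0 : R3) Λ).indicator ((𝓕 φ : L2) : R3 → ℂ))

theorem memLp_indicator_fourier (φ : L2) {s : Set R3} (hs : MeasurableSet s) :
    MemLp (s.indicator ((𝓕 φ : L2) : R3 → ℂ)) 2 := (Lp.memLp _).indicator hs

/-- The part of `φ` with frequencies outside the ball of radius `Λ`. -/
def highPart (φ : L2) (Λ : ℝ) : L2 :=
  𝓕⁻ (memLp_indicator_fourier φ (measurableSet_ball (x := (0 : R3)) (ε := Λ)).compl).toLp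

theorem lintegral_enorm_sq (f : L2) : ∫⁻ x, ‖f x‖ₑ ^ 2 = ENNReal.ofReal (‖f‖ ^ 2) := by
  rw [← mass_eq_norm_sq, mass, ofReal_integral_eq_lintegral_ofReal (integrable_norm_sq f)
    (Eventually.of_forall fun x => by positivity)]
  refine lintegral_congr fun x => ?_
  rw [ENNReal.ofReal_pow (norm_nonneg _), ofReal_norm]

theorem massE_eq (f : L2) : massE f = ENNReal.ofReal (mass f) := by
  rw [massE, lintegral_enorm_sq, mass_eq_norm_sq]

theorem integrable_indicator_fourier (φ : L2) (Λ : ℝ) :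
    Integrable ((ball (0 : R3) Λ).indicator ((𝓕 φ : L2) : R3 → ℂ)) := by
  rw [integrable_indicator_iff measurableSet_ball]
  have : IsFiniteMeasure ((volume : Measure R3).restrict (ball 0 Λ)) :=
    ⟨by rw [Measure.restrict_apply_univ]; exact measure_ball_lt_top⟩
  exact ((Lp.memLp (𝓕 φ)).restrict _).integrable (by norm_num)

theorem enorm_lowPart_le (φ : L2) (Λ : ℝ) (x : R3) : ‖lowPart φ Λ x‖ₑ ≤ lowAmp φ Λ := by
  rw [lowPart, Real.fourierInv_eq]
  refine (enorm_integral_le_lintegral_enorm _).trans_eq ?_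
  rw [lowAmp, ← lintegral_indicator measurableSet_ball]
  refine lintegral_congr fun ξ => ?_
  have h1 : ∀ z : Circle, ‖(z : ℂ)‖ₑ = 1 := fun z => by
    rw [← ofReal_norm, Circle.norm_coe, ENNReal.ofReal_one]
  rw [Circle.smul_def, enorm_smul, enorm_indicator_eq_indicator_enorm, h1, one_mul]

/-- The low frequencies of `φ̂` are in `L¹ ∩ L²`, so there the abstract inverse transform is the
Fourier integral, which can be bounded pointwise. -/
theorem ae_eq_lowPart_add_highPart (φ : L2) (Λ : ℝ) :
    (φ : R3 → ℂ) =ᵐ[volume] fun x => lowPart φ Λ x + highPart φ Λ x := by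
  have hB : MeasurableSet (ball (0 : R3) Λ) := measurableSet_ball
  set l : L2 := (memLp_indicator_fourier φ hB).toLp with hl
  set h : L2 := (memLp_indicator_fourier φ hB.compl).toLp with hh
  have hl' : (l : R3 → ℂ) =ᵐ[volume] (ball (0 : R3) Λ).indicator ((𝓕 φ : L2) : R3 → ℂ) :=
    MemLp.coeFn_toLp _
  have hh' : (h : R3 → ℂ) =ᵐ[volume] (ball (0 : R3) Λ)ᶜ.indicator ((𝓕 φ : L2) : R3 → ℂ) :=
    MemLp.coeFn_toLp _
  have hsum : l + h = 𝓕 φ := by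
    apply Lp.ext
    filter_upwards [hl', hh', Lp.coeFn_add l h] with x h1 h2 h3
    rw [h3, Pi.add_apply, h1, h2, indicator_self_add_compl_apply]
  have hφ : φ = 𝓕⁻ l + 𝓕⁻ h := by
    rw [← FourierTransform.fourierInv_add, hsum, fourierInv_fourier_eq]
  have h_int : Integrable (l : R3 → ℂ) := (integrable_indicator_fourier φ Λ).congr hl'.symm
  have e1 : (𝓕⁻ l : L2) =ᵐ[volume] lowPart φ Λ := by
    filter_upwards [fourierInv_L2_ae_eq l h_int] with x hx
    rw [hx, lowPart]
    exact Real.fourierInv_congr_ae hl' x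
  have e2 : highPart φ Λ = 𝓕⁻ h := rfl
  filter_upwards [e1, Lp.coeFn_add (𝓕⁻ l : L2) (𝓕⁻ h)] with x h1 h2
  conv_lhs => rw [hφ]
  rw [h2, Pi.add_apply, h1, e2]

theorem lintegral_highPart (φ : L2) (Λ : ℝ) :
    ∫⁻ x, ‖highPart φ Λ x‖ₑ ^ 2 = highMass φ Λ := by
  have hB : MeasurableSet (ball (0 : R3) Λ) := measurableSet_ball
  have e : ‖highPart φ Λ‖ = ‖(memLp_indicator_fourier φ hB.compl).toLp‖ := by
    rw [← Lp.norm_fourier_eq (highPart φ Λ), highPart, fourier_fourierInv_eq]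
  rw [lintegral_enorm_sq, e, ← lintegral_enorm_sq, highMass, ← lintegral_indicator hB.compl]
  refine lintegral_congr_ae ?_
  filter_upwards [(memLp_indicator_fourier φ hB.compl).coeFn_toLp] with x hx
  rw [hx]
  by_cases hx : x ∈ (ball (0 : R3) Λ)ᶜ <;> simp [hx, indicator]

theorem enorm_add_sq_le (a b : ℂ) : ‖a + b‖ₑ ^ 2 ≤ 2 * ‖a‖ₑ ^ 2 + 2 * ‖b‖ₑ ^ 2 := by
  calc ‖a + b‖ₑ ^ 2 ≤ (‖a‖ₑ + ‖b‖ₑ) ^ 2 := by gcongr; exact enorm_add_le a b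
    _ ≤ 2 * ‖a‖ₑ ^ 2 + 2 * ‖b‖ₑ ^ 2 := by
      rw [← mul_add]
      have h := ENNReal.rpow_add_le_mul_rpow_add_rpow ‖a‖ₑ ‖b‖ₑ (p := 2) (by norm_num)
      norm_num at h
      exact h

theorem ae_enorm_sq_le (φ : L2) (Λ : ℝ) : ∀ᵐ x : R3,
    ‖φ x‖ₑ ^ 2 ≤ 2 * lowAmp φ Λ ^ 2 + 2 * ‖highPart φ Λ x‖ₑ ^ 2 := by
  filter_upwards [ae_eq_lowPart_add_highPart φ Λ] with x hx
  rw [hx]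
  refine (enorm_add_sq_le _ _).trans ?_
  gcongr
  exact enorm_lowPart_le φ Λ x

/-! ### Radial integrals -/

theorem lintegral_Ioi_inv_sq {c : ℝ} (hc : 0 < c) :
    ∫⁻ R in Ioi c, ENNReal.ofReal ((R ^ 2)⁻¹) = ENNReal.ofReal (1 / c) := by
  have h1 : ∀ R ∈ Ioi c, (R ^ 2)⁻¹ = R ^ (-2 : ℝ) := by
    intro R hR
    rw [Real.rpow_neg (hc.trans hR).le]; norm_num
  have hi : IntegrableOn (fun R : ℝ => R ^ (-2 : ℝ)) (Ioi c) :=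
    integrableOn_Ioi_rpow_of_lt (by norm_num) hc
  rw [setLIntegral_congr_fun measurableSet_Ioi (fun R hR => by rw [h1 R hR]),
    ← ofReal_integral_eq_lintegral_ofReal hi, integral_Ioi_rpow_of_lt (by norm_num) hc]
  · congr 1
    norm_num
    rw [Real.rpow_neg_one]
  · filter_upwards [ae_restrict_mem measurableSet_Ioi] with R hR
    exact Real.rpow_nonneg (hc.trans hR).le _

/-- Layer cake bound for the Newtonian kernel. -/
theorem ofReal_inv_norm_le (z : R3) :
    ENNReal.ofReal (1 / ‖z‖) ≤
      ∫⁻ R in Ioi (0 : ℝ), ENNReal.ofReal ((R ^ 2)⁻¹) * (Iio R).indicator 1 ‖z‖ := by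
  -- At the origin `1 / 0 = 0`, so the bound is trivial.
  rcases eq_or_ne z 0 with rfl | hz
  · simp
  have hz : 0 < ‖z‖ := norm_pos_iff.2 hz
  rw [← lintegral_Ioi_inv_sq hz, ← lintegral_indicator measurableSet_Ioi,
    ← lintegral_indicator measurableSet_Ioi]
  refine lintegral_mono fun R => ?_
  by_cases hR : ‖z‖ < R
  · have : 0 < R := hz.trans hR
    simp [indicator, hR, this]
  · simp [indicator, hR]

/-- In polar coordinates the weight `r⁻²` cancels the three-dimensional Jacobian `r²`, so the
integral is linear in the radius. -/
theorem lintegral_ball_inv_norm_sq_le :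
    ∃ c : ℝ≥0∞, c ≠ ⊤ ∧ ∀ Λ : ℝ, 0 < Λ →
      ∫⁻ ξ in ball (0 : R3) Λ, (‖ξ‖ₑ⁻¹) ^ 2 ≤ c * ENNReal.ofReal Λ := by
  refine ⟨ENNReal.ofReal (3 * (volume : Measure R3).real (ball 0 1)), ENNReal.ofReal_ne_top,
    fun Λ hΛ => ?_⟩
  have hdim : Module.finrank ℝ R3 = 3 := by simp
  have hII : IntegrableOn (fun y : ℝ => y ^ (Module.finrank ℝ R3 - 1) • (y ^ 2)⁻¹) (Ioo 0 Λ) := by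
    rw [hdim]
    refine (integrableOn_const (C := (1 : ℝ)) (by simp)).congr_fun (fun y hy => ?_)
      measurableSet_Ioo
    have := hy.1.ne'
    simp; field_simp
  have h_int : IntegrableOn (fun ξ : R3 => (‖ξ‖ ^ 2)⁻¹) (ball 0 Λ) :=
    (integrableOn_fun_norm_addHaar volume (f := fun y : ℝ => (y ^ 2)⁻¹)).2 hII
  have hval : ∫ ξ in ball (0 : R3) Λ, (‖ξ‖ ^ 2)⁻¹
      = 3 * (volume : Measure R3).real (ball 0 1) * Λ := by
    have h := integral_fun_norm_addHaar (volume : Measure R3)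
      (fun y : ℝ => (Iio Λ).indicator (fun y => (y ^ 2)⁻¹) y)
    rw [← integral_indicator measurableSet_ball]
    have e1 : ∀ x : R3, (ball (0 : R3) Λ).indicator (fun ξ => (‖ξ‖ ^ 2)⁻¹) x
        = (Iio Λ).indicator (fun y => (y ^ 2)⁻¹) ‖x‖ := by
      intro x; simp [indicator]
    simp_rw [e1]
    rw [h, hdim]
    have e2 : ∫ y in Ioi (0 : ℝ), y ^ (3 - 1) • (Iio Λ).indicator (fun y => (y ^ 2)⁻¹) y = Λ := by
      have : ∀ y ∈ Ioi (0 : ℝ), y ^ (3 - 1) • (Iio Λ).indicator (fun y => (y ^ 2)⁻¹) y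
          = (Iio Λ).indicator (fun _ => (1 : ℝ)) y := by
        intro y hy
        have := (mem_Ioi.1 hy).ne'
        by_cases h : y < Λ <;> simp [indicator, h]
        field_simp
      rw [setIntegral_congr_fun measurableSet_Ioi this, setIntegral_indicator measurableSet_Iio,
        Ioi_inter_Iio]
      simp [hΛ.le]
    rw [e2]; simp; ring
  rw [← ENNReal.ofReal_mul (by positivity), ← hval,
    ofReal_integral_eq_lintegral_ofReal h_int (Eventually.of_forall fun ξ => by positivity)]
  refine lintegral_mono_ae ?_
  have : ∀ᵐ ξ : R3, ξ ≠ 0 := by simp [ae_iff]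
  filter_upwards [ae_restrict_of_ae this] with ξ hξ
  have : 0 < ‖ξ‖ := norm_pos_iff.2 hξ
  rw [← ofReal_norm, ← ENNReal.ofReal_inv_of_pos this, ← ENNReal.ofReal_pow (by positivity), inv_pow]

/-! ### Kato-type bounds -/

theorem aemeasurable_enorm_sq (f : L2) : AEMeasurable fun x => ‖f x‖ₑ ^ 2 :=
  ((Lp.aestronglyMeasurable f).enorm).pow_const 2

/-- Tonelli's theorem in the form used throughout: `S` is the relation tying a radius to a frequency
or a point. -/
theorem lintegral_mul_lintegral_indicator_swap {X Y : Type*} [MeasurableSpace X]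
    [MeasurableSpace Y] {μ : Measure X} {ν : Measure Y} [SFinite μ] [SFinite ν] {w : X → ℝ≥0∞}
    (hw : Measurable w) {a : Y → ℝ≥0∞} (ha : AEMeasurable a ν) {S : Set (X × Y)}
    (hS : MeasurableSet S) :
    ∫⁻ x, w x * ∫⁻ y, S.indicator 1 (x, y) * a y ∂ν ∂μ
      = ∫⁻ y, a y * ∫⁻ x, w x * S.indicator 1 (x, y) ∂μ ∂ν := by
  have hSm : Measurable (S.indicator (1 : X × Y → ℝ≥0∞)) := measurable_one.indicator hS
  have h1 : ∀ x, w x * ∫⁻ y, S.indicator 1 (x, y) * a y ∂ν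
      = ∫⁻ y, w x * (S.indicator 1 (x, y) * a y) ∂ν := fun x => by
    rw [lintegral_const_mul'']
    exact (hSm.comp measurable_prodMk_left).aemeasurable.mul ha
  have h2 : ∀ y, a y * ∫⁻ x, w x * S.indicator 1 (x, y) ∂μ
      = ∫⁻ x, w x * (S.indicator 1 (x, y) * a y) ∂μ := fun y => by
    rw [← lintegral_const_mul]
    · refine lintegral_congr fun x => ?_
      ring
    · exact hw.mul (hSm.comp measurable_prodMk_right)
  simp_rw [h1, h2]
  refine lintegral_lintegral_swap ?_
  exact (hw.comp measurable_fst).aemeasurable.mul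
    (hSm.aemeasurable.mul (ha.comp_quasiMeasurePreserving Measure.quasiMeasurePreserving_snd))

/-- After Tonelli, a frequency `ξ` counts for radii `R ≥ κ / |ξ|`, and `∫ R⁻² dR` over that range
equals `|ξ| / κ`. -/
theorem lintegral_highMass_le (φ : L2) {κ : ℝ} (hκ : 0 < κ) :
    ∫⁻ R in Ioi (0 : ℝ), ENNReal.ofReal ((R ^ 2)⁻¹) * highMass φ (κ / R)
      ≤ ENNReal.ofReal (1 / κ) * kin φ := by
  set S : Set (ℝ × R3) := {p | κ ≤ p.1 * ‖p.2‖} with hSdef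
  have hS : MeasurableSet S := measurableSet_le measurable_const
    (measurable_fst.mul measurable_snd.norm)
  have h1 : ∀ R ∈ Ioi (0 : ℝ), ENNReal.ofReal ((R ^ 2)⁻¹) * highMass φ (κ / R)
      = ENNReal.ofReal ((R ^ 2)⁻¹) * ∫⁻ ξ, S.indicator 1 (R, ξ) * ‖(𝓕 φ : L2) ξ‖ₑ ^ 2 := by
    intro R hR
    rw [highMass, ← lintegral_indicator measurableSet_ball.compl]
    congr 1
    refine lintegral_congr fun ξ => ?_
    have : ξ ∈ (ball (0 : R3) (κ / R))ᶜ ↔ (R, ξ) ∈ S := by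
      simp only [mem_compl_iff, mem_ball_zero_iff, not_lt, hSdef, mem_ofPred_eq]
      rw [div_le_iff₀ hR, mul_comm]
    by_cases h : (R, ξ) ∈ S
    · simp [indicator_of_mem h, indicator_of_mem (this.2 h)]
    · simp [indicator_of_notMem h, indicator_of_notMem (fun h' => h (this.1 h'))]
  rw [setLIntegral_congr_fun measurableSet_Ioi h1, lintegral_mul_lintegral_indicator_swap
    (by fun_prop) (aemeasurable_enorm_sq _) hS, kin, ← lintegral_const_mul']
  swap
  · exact ENNReal.ofReal_ne_top
  refine lintegral_mono fun ξ => ?_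
  have h2 : ∫⁻ R in Ioi (0 : ℝ), ENNReal.ofReal ((R ^ 2)⁻¹) * S.indicator 1 (R, ξ)
      ≤ ENNReal.ofReal (1 / κ) * ‖ξ‖ₑ := by
    rcases eq_or_ne ξ 0 with rfl | hξ
    · have : ∀ R : ℝ, S.indicator (1 : ℝ × R3 → ℝ≥0∞) (R, (0 : R3)) = 0 := fun R =>
        indicator_of_notMem (by simp [hSdef, hκ]) _
      simp [this]
    · have hξ : 0 < ‖ξ‖ := norm_pos_iff.2 hξ
      have : ENNReal.ofReal (1 / κ) * ‖ξ‖ₑ = ENNReal.ofReal (1 / (κ / ‖ξ‖)) := by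
        rw [← ofReal_norm, ← ENNReal.ofReal_mul (by positivity)]
        congr 1; field_simp
      rw [this, ← lintegral_Ioi_inv_sq (by positivity), setLIntegral_congr (Ioi_ae_eq_Ici (a := κ / ‖ξ‖)),
        ← lintegral_indicator measurableSet_Ioi, ← lintegral_indicator measurableSet_Ici]
      refine lintegral_mono fun R => ?_
      by_cases h : (R, ξ) ∈ S
      · have : R ∈ Ici (κ / ‖ξ‖) := by
          rw [mem_Ici, div_le_iff₀ hξ]; exact h
        rw [indicator_of_mem this]
        by_cases hR : R ∈ Ioi (0 : ℝ)
        · simp [indicator_of_mem hR, indicator_of_mem h]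
        · simp [indicator_of_notMem hR]
      · by_cases hR : R ∈ Ioi (0 : ℝ)
        · simp [indicator_of_mem hR, indicator_of_notMem h]
        · simp [indicator_of_notMem hR]
  calc _ ≤ ‖(𝓕 φ : L2) ξ‖ₑ ^ 2 * (ENNReal.ofReal (1 / κ) * ‖ξ‖ₑ) := by gcongr
    _ = _ := by ring

/-- Cauchy–Schwarz for `|ξ|⁻¹ · |ξ| |φ̂|`. The weight is chosen so that the frequency integral in
the next bound still converges after integration over the radius. -/
theorem lowAmp_sq_le : ∃ c : ℝ≥0∞, c ≠ ⊤ ∧ ∀ (φ : L2) (Λ : ℝ), 0 < Λ →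
    lowAmp φ Λ ^ 2 ≤ c * ENNReal.ofReal Λ *
      ∫⁻ ξ in ball (0 : R3) Λ, ‖ξ‖ₑ ^ 2 * ‖(𝓕 φ : L2) ξ‖ₑ ^ 2 := by
  obtain ⟨c, hc, h⟩ := lintegral_ball_inv_norm_sq_le
  refine ⟨c, hc, fun φ Λ hΛ => ?_⟩
  have h0 : ∀ᵐ ξ : R3 ∂volume.restrict (ball 0 Λ), ξ ≠ 0 :=
    ae_restrict_of_ae (by simp [ae_iff])
  have h1 : lowAmp φ Λ = ∫⁻ ξ in ball (0 : R3) Λ,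
      ((fun ξ : R3 => ‖ξ‖ₑ⁻¹) * (fun ξ : R3 => ‖ξ‖ₑ * ‖(𝓕 φ : L2) ξ‖ₑ)) ξ := by
    refine lintegral_congr_ae ?_
    filter_upwards [h0] with ξ hξ
    simp only [Pi.mul_apply]
    rw [← mul_assoc, ENNReal.inv_mul_cancel (by simpa using hξ) enorm_ne_top, one_mul]
  have h2 := ENNReal.lintegral_mul_le_Lp_mul_Lq (volume.restrict (ball (0 : R3) Λ))
    Real.HolderConjugate.two_two (f := fun ξ : R3 => ‖ξ‖ₑ⁻¹)
    (g := fun ξ : R3 => ‖ξ‖ₑ * ‖(𝓕 φ : L2) ξ‖ₑ) (by fun_prop)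
    (measurable_enorm.aemeasurable.mul (Lp.aestronglyMeasurable _).enorm.restrict)
  rw [← h1] at h2
  calc lowAmp φ Λ ^ 2 ≤ _ := pow_le_pow_left' h2 2
    _ = (∫⁻ ξ in ball (0 : R3) Λ, (‖ξ‖ₑ⁻¹) ^ 2) *
        ∫⁻ ξ in ball (0 : R3) Λ, ‖ξ‖ₑ ^ 2 * ‖(𝓕 φ : L2) ξ‖ₑ ^ 2 := by
      rw [mul_pow, ← ENNReal.rpow_natCast, ← ENNReal.rpow_natCast, ← ENNReal.rpow_mul,
        ← ENNReal.rpow_mul]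
      norm_num [mul_pow]
    _ ≤ _ := by gcongr; exact h Λ hΛ

/-- The powers `R⁻² · R³ · (κ / R)` collapse to the constant `κ`. A frequency `ξ` counts for `R < κ
/ |ξ|`, which leaves `κ · (κ / |ξ|) · |ξ|² = κ² |ξ|`. -/
theorem lintegral_lowAmp_le : ∃ C : ℝ≥0∞, C ≠ ⊤ ∧ ∀ (φ : L2) (κ : ℝ), 0 < κ →
    ∫⁻ R in Ioi (0 : ℝ), ENNReal.ofReal ((R ^ 2)⁻¹) *
      (volume (ball (0 : R3) R) * lowAmp φ (κ / R) ^ 2) ≤ C * ENNReal.ofReal (κ ^ 2) * kin φ := by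
  obtain ⟨c, hc, h⟩ := lowAmp_sq_le
  set v := volume (ball (0 : R3) 1) with hv
  have hvt : v ≠ ⊤ := measure_ball_lt_top.ne
  refine ⟨v * c, ENNReal.mul_ne_top hvt hc, fun φ κ hκ => ?_⟩
  set S : Set (ℝ × R3) := {p | p.1 * ‖p.2‖ < κ} with hSdef
  have hS : MeasurableSet S := measurableSet_lt
    (measurable_fst.mul measurable_snd.norm) measurable_const
  have h1 : ∀ R ∈ Ioi (0 : ℝ), ENNReal.ofReal ((R ^ 2)⁻¹) *
      (volume (ball (0 : R3) R) * lowAmp φ (κ / R) ^ 2) ≤ v * c * ENNReal.ofReal κ *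
        ∫⁻ ξ, S.indicator 1 (R, ξ) * (‖ξ‖ₑ ^ 2 * ‖(𝓕 φ : L2) ξ‖ₑ ^ 2) := by
    intro R hR
    have hR' : (0 : ℝ) < R := hR
    have hb : volume (ball (0 : R3) R) = ENNReal.ofReal (R ^ 3) * v := by
      rw [Measure.addHaar_ball _ _ hR'.le]; simp [hv]
    have he : ∫⁻ ξ in ball (0 : R3) (κ / R), ‖ξ‖ₑ ^ 2 * ‖(𝓕 φ : L2) ξ‖ₑ ^ 2
        = ∫⁻ ξ, S.indicator 1 (R, ξ) * (‖ξ‖ₑ ^ 2 * ‖(𝓕 φ : L2) ξ‖ₑ ^ 2) := by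
      rw [← lintegral_indicator measurableSet_ball]
      refine lintegral_congr fun ξ => ?_
      have : ξ ∈ ball (0 : R3) (κ / R) ↔ (R, ξ) ∈ S := by
        simp only [mem_ball_zero_iff, hSdef, mem_ofPred_eq]
        rw [lt_div_iff₀ hR', mul_comm]
      by_cases h : (R, ξ) ∈ S
      · simp [indicator_of_mem h, indicator_of_mem (this.2 h)]
      · simp [indicator_of_notMem h, indicator_of_notMem (fun h' => h (this.1 h'))]
    rw [← he, hb]
    calc _ ≤ ENNReal.ofReal ((R ^ 2)⁻¹) * (ENNReal.ofReal (R ^ 3) * v *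
          (c * ENNReal.ofReal (κ / R) *
            ∫⁻ ξ in ball (0 : R3) (κ / R), ‖ξ‖ₑ ^ 2 * ‖(𝓕 φ : L2) ξ‖ₑ ^ 2)) := by
          gcongr; exact h φ _ (by positivity)
      _ = v * c * (ENNReal.ofReal ((R ^ 2)⁻¹) * ENNReal.ofReal (R ^ 3) * ENNReal.ofReal (κ / R)) *
            ∫⁻ ξ in ball (0 : R3) (κ / R), ‖ξ‖ₑ ^ 2 * ‖(𝓕 φ : L2) ξ‖ₑ ^ 2 := by ring
      _ = _ := by
        rw [← ENNReal.ofReal_mul (by positivity), ← ENNReal.ofReal_mul (by positivity)]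
        congr 3
        field_simp
  refine (setLIntegral_mono' measurableSet_Ioi h1).trans ?_
  have hm : AEMeasurable (fun ξ : R3 => ‖ξ‖ₑ ^ 2 * ‖(𝓕 φ : L2) ξ‖ₑ ^ 2) :=
    (measurable_enorm.pow_const 2).aemeasurable.mul (aemeasurable_enorm_sq _)
  rw [lintegral_mul_lintegral_indicator_swap measurable_const hm hS, kin, ← lintegral_const_mul']
  swap
  · exact ENNReal.mul_ne_top (ENNReal.mul_ne_top hvt hc) ENNReal.ofReal_ne_top
  have h0 : ∀ᵐ ξ : R3, ξ ≠ 0 := by simp [ae_iff]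
  refine lintegral_mono_ae ?_
  filter_upwards [h0] with ξ hξ
  have hξ : 0 < ‖ξ‖ := norm_pos_iff.2 hξ
  have h2 : ∫⁻ R in Ioi (0 : ℝ), v * c * ENNReal.ofReal κ * S.indicator 1 (R, ξ)
      ≤ v * c * ENNReal.ofReal κ * ENNReal.ofReal (κ / ‖ξ‖) := by
    rw [lintegral_const_mul' _ _
      (ENNReal.mul_ne_top (ENNReal.mul_ne_top hvt hc) ENNReal.ofReal_ne_top)]
    gcongr
    have : ENNReal.ofReal (κ / ‖ξ‖) = ∫⁻ _ in Ioo 0 (κ / ‖ξ‖), (1 : ℝ≥0∞) := by simp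
    rw [this, ← lintegral_indicator measurableSet_Ioi, ← lintegral_indicator measurableSet_Ioo]
    refine lintegral_mono fun R => ?_
    by_cases hR : R ∈ Ioi (0 : ℝ)
    · rw [indicator_of_mem hR]
      by_cases h : (R, ξ) ∈ S
      · have : R ∈ Ioo 0 (κ / ‖ξ‖) := ⟨hR, by rw [lt_div_iff₀ hξ]; exact h⟩
        simp [indicator_of_mem h, indicator_of_mem this]
      · simp [indicator_of_notMem h]
    · simp [indicator_of_notMem hR]
  calc _ ≤ ‖ξ‖ₑ ^ 2 * ‖(𝓕 φ : L2) ξ‖ₑ ^ 2 *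
        (v * c * ENNReal.ofReal κ * ENNReal.ofReal (κ / ‖ξ‖)) := by gcongr
    _ = v * c * (ENNReal.ofReal (‖ξ‖ ^ 2) * ENNReal.ofReal κ * ENNReal.ofReal (κ / ‖ξ‖)) *
        ‖(𝓕 φ : L2) ξ‖ₑ ^ 2 := by
      rw [ENNReal.ofReal_pow (norm_nonneg _), ofReal_norm]; ring
    _ = v * c * (ENNReal.ofReal (κ ^ 2) * ENNReal.ofReal ‖ξ‖) * ‖(𝓕 φ : L2) ξ‖ₑ ^ 2 := by
      rw [← ENNReal.ofReal_mul (by positivity), ← ENNReal.ofReal_mul (by positivity),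
        ← ENNReal.ofReal_mul (by positivity)]
      congr 3; field_simp
    _ = _ := by rw [ofReal_norm]; ring

/-- A bound for the mass of `φ` in any ball of radius `R`. -/
def katoBound (φ : L2) (R : ℝ) : ℝ≥0∞ :=
  2 * (volume (ball (0 : R3) R) * lowAmp φ (1 / R) ^ 2) + 2 * highMass φ (1 / R)

theorem measurable_enorm_sq (f : L2) : Measurable fun x => ‖f x‖ₑ ^ 2 :=
  (Lp.stronglyMeasurable f).measurable.enorm.pow_const 2

theorem locMass_le_massE (φ : L2) (x : R3) (R : ℝ) : locMass φ x R ≤ massE φ :=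
  setLIntegral_le_lintegral _ _

theorem locMass_mono (φ : L2) (x : R3) {R R' : ℝ} (h : R ≤ R') : locMass φ x R ≤ locMass φ x R' :=
  lintegral_mono_set (ball_subset_ball h)

/-- Frequencies below `1 / R` are bounded in sup norm on the ball, those above in `L²`. The bound
does not depend on the centre, so it can also serve as a dominating function in `R`. -/
theorem locMass_le_katoBound (φ : L2) (x : R3) (R : ℝ) : locMass φ x R ≤ katoBound φ R := by
  calc locMass φ x R
      ≤ ∫⁻ y in ball x R, (2 * lowAmp φ (1 / R) ^ 2 + 2 * ‖highPart φ (1 / R) y‖ₑ ^ 2) :=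
        lintegral_mono_ae (ae_restrict_of_ae (ae_enorm_sq_le φ (1 / R)))
    _ = 2 * lowAmp φ (1 / R) ^ 2 * volume (ball x R)
        + 2 * ∫⁻ y in ball x R, ‖highPart φ (1 / R) y‖ₑ ^ 2 := by
        rw [lintegral_add_left measurable_const, lintegral_const,
          lintegral_const_mul _ (measurable_enorm_sq _), Measure.restrict_apply_univ]
    _ ≤ 2 * lowAmp φ (1 / R) ^ 2 * volume (ball x R) + 2 * highMass φ (1 / R) := by
        gcongr
        rw [← lintegral_highPart]
        exact setLIntegral_le_lintegral _ _
    _ = katoBound φ R := by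
        rw [katoBound, Measure.addHaar_ball_center]; ring

theorem measurable_lowAmp (φ : L2) (κ : ℝ) : Measurable fun R : ℝ => lowAmp φ (κ / R) := by
  have h1 : Measurable fun Λ : ℝ => lowAmp φ Λ := Monotone.measurable fun a b hab =>
    lintegral_mono_set (ball_subset_ball hab)
  exact h1.comp (by fun_prop)

theorem measurable_highMass (φ : L2) (κ : ℝ) : Measurable fun R : ℝ => highMass φ (κ / R) := by
  have h1 : Measurable fun Λ : ℝ => highMass φ Λ := Antitone.measurable fun a b hab =>
    lintegral_mono_set (compl_subset_compl.2 (ball_subset_ball hab))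
  exact h1.comp (by fun_prop)

theorem measurable_volume_ball : Measurable fun R : ℝ => volume (ball (0 : R3) R) :=
  Monotone.measurable fun _ _ hab => measure_mono (ball_subset_ball hab)

theorem measurable_katoBound (φ : L2) : Measurable (katoBound φ) := by
  unfold katoBound
  have h1 := measurable_lowAmp φ 1
  have h2 := measurable_highMass φ 1
  have h3 := measurable_volume_ball
  fun_prop

theorem lintegral_katoBound_le : ∃ C : ℝ≥0∞, C ≠ ⊤ ∧ ∀ φ : L2,
    ∫⁻ R in Ioi (0 : ℝ), ENNReal.ofReal ((R ^ 2)⁻¹) * katoBound φ R ≤ C * kin φ := by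
  obtain ⟨C, hC, h⟩ := lintegral_lowAmp_le
  refine ⟨2 * C + 2, by finiteness, fun φ => ?_⟩
  have h1 := measurable_lowAmp φ 1
  have h2 := measurable_highMass φ 1
  have h3 := measurable_volume_ball
  calc ∫⁻ R in Ioi (0 : ℝ), ENNReal.ofReal ((R ^ 2)⁻¹) * katoBound φ R
      = ∫⁻ R in Ioi (0 : ℝ), (2 * (ENNReal.ofReal ((R ^ 2)⁻¹) *
          (volume (ball (0 : R3) R) * lowAmp φ (1 / R) ^ 2)) +
          2 * (ENNReal.ofReal ((R ^ 2)⁻¹) * highMass φ (1 / R))) := by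
        refine lintegral_congr fun R => ?_
        rw [katoBound]; ring
    _ = 2 * (∫⁻ R in Ioi (0 : ℝ), (ENNReal.ofReal ((R ^ 2)⁻¹) *
          (volume (ball (0 : R3) R) * lowAmp φ (1 / R) ^ 2))) +
          2 * ∫⁻ R in Ioi (0 : ℝ), (ENNReal.ofReal ((R ^ 2)⁻¹) * highMass φ (1 / R)) := by
        rw [lintegral_add_left (by fun_prop), lintegral_const_mul _ (by fun_prop),
          lintegral_const_mul _ (by fun_prop)]
    _ ≤ 2 * (C * ENNReal.ofReal (1 ^ 2) * kin φ) + 2 * (ENNReal.ofReal (1 / 1) * kin φ) := by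
        gcongr
        · exact h φ 1 one_pos
        · exact lintegral_highMass_le φ one_pos
    _ = (2 * C + 2) * kin φ := by simp; ring

theorem measurable_locMass (φ : L2) : Measurable fun p : R3 × ℝ => locMass φ p.1 p.2 := by
  have hS : MeasurableSet {q : (R3 × ℝ) × R3 | dist q.2 q.1.1 < q.1.2} :=
    measurableSet_lt (measurable_snd.dist measurable_fst.fst) measurable_fst.snd
  have h : Measurable fun p : R3 × ℝ => ∫⁻ y,
      {q : (R3 × ℝ) × R3 | dist q.2 q.1.1 < q.1.2}.indicator 1 (p, y) * ‖φ y‖ₑ ^ 2 := by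
    refine Measurable.lintegral_prod_right' (f := fun q : (R3 × ℝ) × R3 =>
      {q : (R3 × ℝ) × R3 | dist q.2 q.1.1 < q.1.2}.indicator 1 q * ‖φ q.2‖ₑ ^ 2) ?_
    exact (measurable_one.indicator hS).mul ((measurable_enorm_sq φ).comp measurable_snd)
  convert h using 2 with p
  rw [locMass, ← lintegral_indicator measurableSet_ball]
  refine lintegral_congr fun y => ?_
  by_cases hy : dist y p.1 < p.2 <;> simp [indicator, hy]

theorem measurable_locMass_center (φ : L2) (R : ℝ) : Measurable fun x => locMass φ x R := by
  have h : Measurable fun x : R3 => (x, R) := measurable_id.prodMk measurable_const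
  have h' := (measurable_locMass φ).comp h
  simpa only [Function.comp_def] using h'

theorem measurable_locMass_radius (φ : L2) (x : R3) : Measurable fun R => locMass φ x R :=
  Monotone.measurable fun _ _ h => locMass_mono φ x h

theorem lintegral_inv_norm_mul_le (φ : L2) (x : R3) :
    ∫⁻ y, ENNReal.ofReal (1 / ‖x - y‖) * ‖φ y‖ₑ ^ 2 ≤
      ∫⁻ R in Ioi (0 : ℝ), ENNReal.ofReal ((R ^ 2)⁻¹) * locMass φ x R := by
  set S : Set (ℝ × R3) := {p | ‖x - p.2‖ < p.1} with hSdef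
  have hS : MeasurableSet S := measurableSet_lt (by fun_prop) measurable_fst
  calc ∫⁻ y, ENNReal.ofReal (1 / ‖x - y‖) * ‖φ y‖ₑ ^ 2
      ≤ ∫⁻ y, ‖φ y‖ₑ ^ 2 *
        ∫⁻ R in Ioi (0 : ℝ), ENNReal.ofReal ((R ^ 2)⁻¹) * S.indicator 1 (R, y) := by
        refine lintegral_mono fun y => ?_
        rw [mul_comm]
        gcongr
        refine (ofReal_inv_norm_le (x - y)).trans_eq (lintegral_congr fun R => ?_)
        simp [indicator, hSdef]
    _ = ∫⁻ R in Ioi (0 : ℝ), ENNReal.ofReal ((R ^ 2)⁻¹) *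
          ∫⁻ y, S.indicator 1 (R, y) * ‖φ y‖ₑ ^ 2 :=
        (lintegral_mul_lintegral_indicator_swap (by fun_prop) (aemeasurable_enorm_sq φ) hS).symm
    _ = _ := by
        refine lintegral_congr fun R => ?_
        rw [locMass, ← lintegral_indicator measurableSet_ball]
        congr 1
        refine lintegral_congr fun y => ?_
        by_cases hy : ‖x - y‖ < R
        · have : dist y x < R := by rwa [dist_comm, dist_eq_norm]
          simp [indicator, hSdef, hy, this]
        · have : ¬ dist y x < R := by rwa [dist_comm, dist_eq_norm]
          simp [indicator, hSdef, hy, this]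

/-- `∫ |φ(x)|² ∫_{B(x,R)} |ψ|² dx`. -/
def pairMass (φ ψ : L2) (R : ℝ) : ℝ≥0∞ := ∫⁻ x, ‖φ x‖ₑ ^ 2 * locMass ψ x R

/-- `∬ |φ(x)|² |ψ(y)|² / |x - y|` as an extended nonnegative number. -/
def newtonE (φ ψ : L2) : ℝ≥0∞ :=
  ∫⁻ x, ‖φ x‖ₑ ^ 2 * ∫⁻ y, ENNReal.ofReal (1 / ‖x - y‖) * ‖ψ y‖ₑ ^ 2

theorem measurable_pairMass (φ ψ : L2) : Measurable (pairMass φ ψ) := by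
  refine Measurable.lintegral_prod_left' (f := fun p : R3 × ℝ => ‖φ p.1‖ₑ ^ 2 * locMass ψ p.1 p.2) ?_
  exact ((measurable_enorm_sq φ).comp measurable_fst).mul (measurable_locMass ψ)

theorem newtonE_le_lintegral_pairMass (φ ψ : L2) : newtonE φ ψ ≤
    ∫⁻ R in Ioi (0 : ℝ), ENNReal.ofReal ((R ^ 2)⁻¹) * pairMass φ ψ R := by
  have hl := measurable_locMass ψ
  have hφ := measurable_enorm_sq φ
  calc newtonE φ ψ ≤ ∫⁻ x, ‖φ x‖ₑ ^ 2 *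
        ∫⁻ R in Ioi (0 : ℝ), ENNReal.ofReal ((R ^ 2)⁻¹) * locMass ψ x R := by
        refine lintegral_mono fun x => ?_
        gcongr
        exact lintegral_inv_norm_mul_le ψ x
    _ = ∫⁻ x, ∫⁻ R in Ioi (0 : ℝ), ENNReal.ofReal ((R ^ 2)⁻¹) * (‖φ x‖ₑ ^ 2 * locMass ψ x R) := by
        refine lintegral_congr fun x => ?_
        rw [← lintegral_const_mul]
        · refine lintegral_congr fun R => ?_
          ring
        · exact Measurable.mul (by fun_prop) (measurable_locMass_radius ψ x)
    _ = ∫⁻ R in Ioi (0 : ℝ), ∫⁻ x, ENNReal.ofReal ((R ^ 2)⁻¹) * (‖φ x‖ₑ ^ 2 * locMass ψ x R) := by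
        refine lintegral_lintegral_swap (Measurable.aemeasurable ?_)
        have h1 : Measurable fun p : R3 × ℝ => ENNReal.ofReal ((p.2 ^ 2)⁻¹) := by fun_prop
        have h2 : Measurable fun p : R3 × ℝ => ‖φ p.1‖ₑ ^ 2 := hφ.comp measurable_fst
        exact h1.mul (h2.mul hl)
    _ = _ := by
        refine lintegral_congr fun R => ?_
        rw [lintegral_const_mul, pairMass]
        exact hφ.mul (measurable_locMass_center ψ R)

theorem pairMass_le_of_locMass_le (φ ψ : L2) {R : ℝ} {b : ℝ≥0∞} (h : ∀ x, locMass ψ x R ≤ b) :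
    pairMass φ ψ R ≤ b * massE φ := by
  rw [pairMass, massE, mul_comm, ← lintegral_mul_const _ (measurable_enorm_sq φ)]
  exact lintegral_mono fun x => by gcongr; exact h x

/-- A Kato-type inequality: the Newtonian potential of `|ψ|²` is bounded uniformly in space by the
kinetic energy of `ψ`. -/
theorem newtonE_le : ∃ C : ℝ≥0∞, C ≠ ⊤ ∧ ∀ φ ψ : L2, newtonE φ ψ ≤ C * kin ψ * massE φ := by
  obtain ⟨C, hC, h⟩ := lintegral_katoBound_le
  refine ⟨C, hC, fun φ ψ => (newtonE_le_lintegral_pairMass φ ψ).trans ?_⟩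
  have hm := measurable_katoBound ψ
  calc _ ≤ ∫⁻ R in Ioi (0 : ℝ), ENNReal.ofReal ((R ^ 2)⁻¹) * katoBound ψ R * massE φ := by
        refine lintegral_mono fun R => ?_
        simp only
        rw [mul_assoc]
        gcongr
        exact pairMass_le_of_locMass_le φ ψ fun x => locMass_le_katoBound ψ x R
    _ = (∫⁻ R in Ioi (0 : ℝ), ENNReal.ofReal ((R ^ 2)⁻¹) * katoBound ψ R) * massE φ := by
        rw [lintegral_mul_const _ (by fun_prop)]
    _ ≤ _ := by gcongr; exact h ψ

theorem lintegral_locMass (φ : L2) (R : ℝ) :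
    ∫⁻ x, locMass φ x R = volume (ball (0 : R3) R) * massE φ := by
  set S : Set (R3 × R3) := {p | dist p.2 p.1 < R} with hSdef
  have hS : MeasurableSet S := measurableSet_lt (by fun_prop) measurable_const
  have h1 : ∀ x, locMass φ x R = 1 * ∫⁻ y, S.indicator 1 (x, y) * ‖φ y‖ₑ ^ 2 := by
    intro x
    rw [locMass, ← lintegral_indicator measurableSet_ball, one_mul]
    refine lintegral_congr fun y => ?_
    by_cases hy : dist y x < R <;> simp [indicator, hSdef, hy]
  simp_rw [h1]
  rw [lintegral_mul_lintegral_indicator_swap measurable_const (aemeasurable_enorm_sq φ) hS,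
    massE, mul_comm, ← lintegral_mul_const _ (measurable_enorm_sq φ)]
  refine lintegral_congr fun y => ?_
  congr 1
  rw [← Measure.addHaar_ball_center volume y R, ← lintegral_indicator_one measurableSet_ball]
  refine lintegral_congr fun x => ?_
  by_cases hy : dist y x < R
  · simp [indicator, hSdef, hy, dist_comm x y]
  · simp [indicator, hSdef, hy, dist_comm x y]

/-- Only one of the two factors is split into frequencies. The low part is integrated against the
local mass, whose total is the ball volume times the mass; the high part gains the small factor `η`.
-/
theorem pairMass_self_le (φ : L2) (Λ R : ℝ) {η : ℝ≥0∞} (h : ∀ x, locMass φ x R ≤ η) :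
    pairMass φ φ R ≤ 2 * massE φ * (volume (ball (0 : R3) R) * lowAmp φ Λ ^ 2)
      + 2 * η * highMass φ Λ := by
  have hm : Measurable fun x => locMass φ x R := measurable_locMass_center φ R
  calc pairMass φ φ R
      ≤ ∫⁻ x, (2 * lowAmp φ Λ ^ 2 * locMass φ x R + 2 * η * ‖highPart φ Λ x‖ₑ ^ 2) := by
        refine lintegral_mono_ae ?_
        filter_upwards [ae_enorm_sq_le φ Λ] with x hx
        calc _ ≤ (2 * lowAmp φ Λ ^ 2 + 2 * ‖highPart φ Λ x‖ₑ ^ 2) * locMass φ x R := by gcongr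
          _ = 2 * lowAmp φ Λ ^ 2 * locMass φ x R
              + 2 * locMass φ x R * ‖highPart φ Λ x‖ₑ ^ 2 := by ring
          _ ≤ _ := by gcongr; exact h x
    _ = 2 * lowAmp φ Λ ^ 2 * (volume (ball (0 : R3) R) * massE φ) + 2 * η * highMass φ Λ := by
        rw [lintegral_add_left (hm.const_mul _), lintegral_const_mul _ hm,
          lintegral_const_mul _ (measurable_enorm_sq _), lintegral_locMass, lintegral_highPart]
    _ = _ := by ring

/-- If `φ` has little mass in all balls of radius `L`, its Newtonian energy is small. -/
theorem newtonE_self_le : ∃ C : ℝ≥0∞, C ≠ ⊤ ∧ ∀ (φ : L2) (κ L : ℝ) (η : ℝ≥0∞), 0 < κ → 0 < L →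
    (∀ x, locMass φ x L ≤ η) → newtonE φ φ ≤
      C * (ENNReal.ofReal (κ ^ 2) * massE φ + ENNReal.ofReal (1 / κ) * η) * kin φ
        + ENNReal.ofReal (1 / L) * massE φ ^ 2 := by
  obtain ⟨C, hC, h⟩ := lintegral_lowAmp_le
  refine ⟨2 * C + 2, by finiteness, fun φ κ L η hκ hL hη => ?_⟩
  have h1 := measurable_lowAmp φ κ
  have h2 := measurable_highMass φ κ
  have h3 := measurable_volume_ball
  refine (newtonE_le_lintegral_pairMass φ φ).trans ?_
  calc _ ≤ ∫⁻ R in Ioi (0 : ℝ), (2 * massE φ * (ENNReal.ofReal ((R ^ 2)⁻¹) *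
          (volume (ball (0 : R3) R) * lowAmp φ (κ / R) ^ 2))
          + 2 * η * (ENNReal.ofReal ((R ^ 2)⁻¹) * highMass φ (κ / R))
          + massE φ ^ 2 * (Ioi L).indicator (fun R => ENNReal.ofReal ((R ^ 2)⁻¹)) R) := by
        refine lintegral_mono fun R => ?_
        -- Up to radius `L` the local mass is at most `η`. Beyond `L` the crude bound by the total
        -- mass suffices, since `∫ R⁻² dR = 1 / L` there.
        rcases le_or_gt R L with hR | hR
        · refine le_trans ?_ le_self_add
          calc _ ≤ ENNReal.ofReal ((R ^ 2)⁻¹) *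
                (2 * massE φ * (volume (ball (0 : R3) R) * lowAmp φ (κ / R) ^ 2)
                  + 2 * η * highMass φ (κ / R)) := by
                gcongr
                exact pairMass_self_le φ (κ / R) R fun x => (locMass_mono φ x hR).trans (hη x)
            _ = _ := by ring
        · refine le_trans ?_ le_add_self
          rw [indicator_of_mem (by exact hR), mul_comm, pow_two (massE φ)]
          gcongr
          exact pairMass_le_of_locMass_le φ φ fun x => locMass_le_massE φ x R
    _ = 2 * massE φ * (∫⁻ R in Ioi (0 : ℝ), (ENNReal.ofReal ((R ^ 2)⁻¹) *
          (volume (ball (0 : R3) R) * lowAmp φ (κ / R) ^ 2)))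
        + 2 * η * (∫⁻ R in Ioi (0 : ℝ), (ENNReal.ofReal ((R ^ 2)⁻¹) * highMass φ (κ / R)))
        + massE φ ^ 2 *
          ∫⁻ R in Ioi (0 : ℝ), (Ioi L).indicator (fun R => ENNReal.ofReal ((R ^ 2)⁻¹)) R := by
        rw [lintegral_add_left (by fun_prop), lintegral_add_left (by fun_prop),
          lintegral_const_mul _ (by fun_prop), lintegral_const_mul _ (by fun_prop),
          lintegral_const_mul _ (Measurable.indicator (by fun_prop) measurableSet_Ioi)]
    _ ≤ 2 * massE φ * (C * ENNReal.ofReal (κ ^ 2) * kin φ)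
        + 2 * η * (ENNReal.ofReal (1 / κ) * kin φ) + massE φ ^ 2 * ENNReal.ofReal (1 / L) := by
        gcongr
        · exact h φ κ hκ
        · exact lintegral_highMass_le φ hκ
        · rw [← lintegral_Ioi_inv_sq hL, lintegral_indicator measurableSet_Ioi,
            Measure.restrict_restrict measurableSet_Ioi,
            inter_eq_self_of_subset_left (Ioi_subset_Ioi hL.le)]
    -- Nonnegative terms are added only so that the sum factors with the single constant `2 * C +
    -- 2`.
    _ ≤ 2 * massE φ * (C * ENNReal.ofReal (κ ^ 2) * kin φ)
        + 2 * η * (ENNReal.ofReal (1 / κ) * kin φ) + massE φ ^ 2 * ENNReal.ofReal (1 / L)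
        + (2 * massE φ * ENNReal.ofReal (κ ^ 2) * kin φ
        + 2 * C * η * ENNReal.ofReal (1 / κ) * kin φ) := le_self_add
    _ = _ := by ring

/-! ### Dilations and translations -/

theorem integral_comp_affine (F : R3 → ℝ) {l : ℝ} (hl : 0 < l) (a : R3) :
    ∫ x, l ^ 3 * F (l • x + a) = ∫ x, F x := by
  rw [integral_const_mul, Measure.integral_comp_smul volume (fun y => F (y + a)) l,
    integral_add_right_eq_self]
  have : Module.finrank ℝ R3 = 3 := by simp
  rw [this, abs_of_pos (by positivity), smul_eq_mul]
  field_simp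

theorem integrable_comp_affine {E : Type*} [NormedAddCommGroup E] {F : R3 → E} (hF : Integrable F)
    {l : ℝ} (hl : 0 < l) (a : R3) : Integrable fun x => F (l • x + a) :=
  Integrable.comp_smul (hF.comp_add_right a) hl.ne'

theorem quasiMeasurePreserving_affine {l : ℝ} (hl : 0 < l) (a : R3) :
    Measure.QuasiMeasurePreserving (fun x : R3 => l • x + a) := by
  refine (measurePreserving_add_right volume a).quasiMeasurePreserving.comp
    (g := fun x => x + a) (f := fun x : R3 => l • x) ⟨by fun_prop, ?_⟩
  rw [Measure.map_addHaar_smul volume hl.ne']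
  exact Measure.smul_absolutelyContinuous

/-- A weight for `transport`: a measurable function of modulus `l ^ (3 / 2)`. -/
def IsWeight (c : R3 → ℂ) (l : ℝ) : Prop := Measurable c ∧ ∀ x, ‖c x‖ ^ 2 = l ^ 3

theorem memLp_transport {c : R3 → ℂ} {l : ℝ} (hc : IsWeight c l) (hl : 0 < l) (a : R3) (φ : L2) :
    MemLp (fun x => c x * φ (l • x + a)) 2 := by
  have hm : Measurable fun x => c x * φ (l • x + a) :=
    hc.1.mul ((Lp.stronglyMeasurable φ).measurable.comp (by fun_prop))
  rw [memLp_two_iff_integrable_norm_sq hm.aestronglyMeasurable]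
  simp_rw [norm_mul, mul_pow, hc.2]
  exact (integrable_comp_affine (integrable_norm_sq φ) hl a).const_mul _

/-- The unitary operator `φ ↦ c(x) φ(l x + a)` on `L²`. -/
def transport {c : R3 → ℂ} {l : ℝ} (hc : IsWeight c l) (hl : 0 < l) (a : R3) (φ : L2) : L2 :=
  (memLp_transport hc hl a φ).toLp

theorem coeFn_transport {c : R3 → ℂ} {l : ℝ} (hc : IsWeight c l) (hl : 0 < l) (a : R3) (φ : L2) :
    transport hc hl a φ =ᵐ[volume] fun x => c x * φ (l • x + a) :=
  (memLp_transport hc hl a φ).coeFn_toLp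

theorem mass_transport {c : R3 → ℂ} {l : ℝ} (hc : IsWeight c l) (hl : 0 < l) (a : R3) (φ : L2) :
    mass (transport hc hl a φ) = mass φ := by
  unfold mass
  rw [← integral_comp_affine (fun x => ‖φ x‖ ^ 2) hl a]
  refine integral_congr_ae ?_
  filter_upwards [coeFn_transport hc hl a φ] with x hx
  rw [hx, norm_mul, mul_pow, hc.2]

theorem transport_sub {c : R3 → ℂ} {l : ℝ} (hc : IsWeight c l) (hl : 0 < l) (a : R3) (φ ψ : L2) :
    transport hc hl a (φ - ψ) = transport hc hl a φ - transport hc hl a ψ := by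
  apply Lp.ext
  filter_upwards [coeFn_transport hc hl a φ, coeFn_transport hc hl a ψ,
    coeFn_transport hc hl a (φ - ψ), Lp.coeFn_sub (transport hc hl a φ) (transport hc hl a ψ),
    (quasiMeasurePreserving_affine hl a).ae (Lp.coeFn_sub φ ψ)] with x h1 h2 h3 h4 h5
  rw [h3, h4, Pi.sub_apply, h1, h2, h5, Pi.sub_apply, mul_sub]

theorem continuous_transport {c : R3 → ℂ} {l : ℝ} (hc : IsWeight c l) (hl : 0 < l) (a : R3) :
    Continuous (transport hc hl a) := by
  refine (Isometry.of_dist_eq fun φ ψ => ?_).continuous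
  rw [dist_eq_norm, dist_eq_norm, ← transport_sub]
  have := mass_transport hc hl a (φ - ψ)
  rw [mass_eq_norm_sq, mass_eq_norm_sq] at this
  exact (pow_left_inj₀ (norm_nonneg _) (norm_nonneg _) two_ne_zero).1 this

theorem isWeight_const {l : ℝ} (hl : 0 < l) :
    IsWeight (fun _ => ((l ^ (3 / 2 : ℝ) : ℝ) : ℂ)) l := by
  refine ⟨measurable_const, fun x => ?_⟩
  rw [Complex.norm_real, Real.norm_of_nonneg (by positivity), ← Real.rpow_natCast,
    ← Real.rpow_mul hl.le, ← Real.rpow_natCast]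
  norm_num

/-- The Fourier transform turns dilation by `l` and translation into dilation by `l⁻¹` and a phase;
this weight carries the phase, so both sides are instances of `transport`. -/
theorem isWeight_char {l : ℝ} (hl : 0 < l) (a : R3) :
    IsWeight (fun ξ => ((l⁻¹ ^ (3 / 2 : ℝ) : ℝ) : ℂ) *
      (Real.fourierChar (inner ℝ a ξ / l) : ℂ)) l⁻¹ := by
  refine ⟨?_, fun x => ?_⟩
  · have : Continuous fun ξ : R3 => (Real.fourierChar (inner ℝ a ξ / l) : ℂ) :=
      continuous_subtype_val.comp (Real.continuous_fourierChar.comp (by fun_prop))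
    exact measurable_const.mul this.measurable
  · rw [norm_mul, Circle.norm_coe, mul_one]
    exact (isWeight_const (inv_pos.2 hl)).2 x

/-- The unitary scaling `l^{3/2} φ(l x + a)`. -/
def rescale {l : ℝ} (hl : 0 < l) (a : R3) (φ : L2) : L2 := transport (isWeight_const hl) hl a φ

theorem fourier_rescale {l : ℝ} (hl : 0 < l) (a : R3) (φ : L2) :
    𝓕 (rescale hl a φ) = transport (isWeight_char hl a) (inv_pos.2 hl) 0 (𝓕 φ) := by
  -- Both sides are continuous in `φ`, so it is enough to change variables in the Fourier integral
  -- of a Schwartz function.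
  refine DenseRange.induction_on (p := fun φ : L2 => 𝓕 (rescale hl a φ)
    = transport (isWeight_char hl a) (inv_pos.2 hl) 0 (𝓕 φ))
    (SchwartzMap.denseRange_toLpCLM (p := 2) ENNReal.ofNat_ne_top) φ ?_ ?_
  · refine isClosed_eq ?_ ?_
    · exact (Lp.fourierTransformₗᵢ R3 ℂ).continuous.comp
        (continuous_transport (isWeight_const hl) hl a)
    · exact (continuous_transport (isWeight_char hl a) (inv_pos.2 hl) 0).comp (Lp.fourierTransformₗᵢ R3 ℂ).continuous
  intro u
  rw [SchwartzMap.toLpCLM_apply, SchwartzMap.toLp_fourier_eq]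
  have h1 : (rescale hl a (u.toLp 2) : R3 → ℂ) =ᵐ[volume]
      fun x => ((l ^ (3 / 2 : ℝ) : ℝ) : ℂ) * u (l • x + a) := by
    filter_upwards [coeFn_transport (isWeight_const hl) hl a (u.toLp 2),
      (quasiMeasurePreserving_affine hl a).ae (u.coeFn_toLp 2 volume)] with x h1 h2
    rw [rescale, h1, h2]
  have h_int : Integrable (rescale hl a (u.toLp 2)) := by
    rw [integrable_congr h1]
    exact (integrable_comp_affine u.integrable hl a).const_mul _
  apply Lp.ext
  filter_upwards [fourier_L2_ae_eq _ h_int,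
    coeFn_transport (isWeight_char hl a) (inv_pos.2 hl) 0 ((𝓕 u).toLp 2),
    (quasiMeasurePreserving_affine (inv_pos.2 hl) 0).ae ((𝓕 u).coeFn_toLp 2 volume)]
    with ξ e1 e2 e3
  rw [e1, e2, e3, Real.fourier_congr_ae h1, SchwartzMap.fourier_coe, Real.fourier_eq,
    Real.fourier_eq, add_zero]
  have hF : ∀ x : R3, Real.fourierChar (-inner ℝ x ξ) • (((l ^ (3 / 2 : ℝ) : ℝ) : ℂ) * u (l • x + a))
      = (fun y => (((l ^ (3 / 2 : ℝ) : ℝ) : ℂ) * (Real.fourierChar (inner ℝ a ξ / l) : ℂ)) *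
        (Real.fourierChar (-inner ℝ (y + a) (l⁻¹ • ξ)) • u (y + a))) (l • x) := by
    intro x
    simp only [Circle.smul_def, smul_eq_mul]
    have : (Real.fourierChar (-inner ℝ x ξ) : ℂ) = (Real.fourierChar (inner ℝ a ξ / l) : ℂ) *
        (Real.fourierChar (-inner ℝ (l • x + a) (l⁻¹ • ξ)) : ℂ) := by
      rw [← Circle.coe_mul, ← AddChar.map_add_eq_mul]
      congr 2
      rw [inner_smul_right, inner_add_left, inner_smul_left]
      simp only [conj_trivial]
      field_simp
      ring
    rw [this]; ring
  rw [integral_congr_ae (Eventually.of_forall hF), Measure.integral_comp_smul volume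
    (fun y => (((l ^ (3 / 2 : ℝ) : ℝ) : ℂ) * (Real.fourierChar (inner ℝ a ξ / l) : ℂ)) *
        (Real.fourierChar (-inner ℝ (y + a) (l⁻¹ • ξ)) • u (y + a))) l, integral_const_mul, integral_add_right_eq_self
    (fun y => Real.fourierChar (-inner ℝ y (l⁻¹ • ξ)) • u y)]
  have : Module.finrank ℝ R3 = 3 := by simp
  rw [this, abs_of_pos (by positivity), Complex.real_smul, ← mul_assoc, ← mul_assoc,
    ← Complex.ofReal_mul]
  congr 3
  rw [← Real.rpow_natCast, ← Real.rpow_neg hl.le, ← Real.rpow_add hl, Real.inv_rpow hl.le,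
    ← Real.rpow_neg hl.le]
  norm_num

theorem integral_weight_rescale (b : R3 → ℝ) {l : ℝ} (hl : 0 < l) (a : R3) (φ : L2) :
    ∫ ξ, b ξ * ‖(𝓕 (rescale hl a φ) : L2) ξ‖ ^ 2 = ∫ ξ, b (l • ξ) * ‖(𝓕 φ : L2) ξ‖ ^ 2 := by
  rw [fourier_rescale, ← integral_comp_affine (fun ξ => b (l • ξ) * ‖(𝓕 φ : L2) ξ‖ ^ 2)
    (inv_pos.2 hl) 0]
  refine integral_congr_ae ?_
  filter_upwards [coeFn_transport (isWeight_char hl a) (inv_pos.2 hl) 0 (𝓕 φ)] with ξ h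
  rw [h, norm_mul, mul_pow, (isWeight_char hl a).2]
  simp only [add_zero, smul_inv_smul₀ hl.ne']
  ring

theorem mass_rescale {l : ℝ} (hl : 0 < l) (a : R3) (φ : L2) : mass (rescale hl a φ) = mass φ :=
  mass_transport _ _ _ _

theorem kinetic_rescale (m : ℝ) {l : ℝ} (hl : 0 < l) (a : R3) (φ : L2) :
    kinetic m (rescale hl a φ) =
      ∫ ξ : R3, Real.sqrt ((2 * Real.pi * (l * ‖ξ‖)) ^ 2 + m ^ 2) * ‖(𝓕 φ : L2) ξ‖ ^ 2 := by
  rw [kinetic, integral_weight_rescale]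
  simp_rw [norm_smul, Real.norm_of_nonneg hl.le]

theorem sqrt_zero_symbol {t : ℝ} (ht : 0 ≤ t) :
    Real.sqrt ((2 * Real.pi * t) ^ 2 + 0 ^ 2) = 2 * Real.pi * t := by
  rw [zero_pow two_ne_zero, add_zero, Real.sqrt_sq (by positivity)]

theorem kinetic_zero_eq (φ : L2) :
    kinetic 0 φ = 2 * Real.pi * ∫ ξ : R3, ‖ξ‖ * ‖(𝓕 φ : L2) ξ‖ ^ 2 := by
  rw [kinetic, ← integral_const_mul]
  refine integral_congr_ae (Eventually.of_forall fun ξ => ?_)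
  simp only [sqrt_zero_symbol (norm_nonneg ξ)]
  ring

theorem kinetic_zero_rescale {l : ℝ} (hl : 0 < l) (a : R3) (φ : L2) :
    kinetic 0 (rescale hl a φ) = l * kinetic 0 φ := by
  rw [kinetic_rescale, kinetic, ← integral_const_mul]
  refine integral_congr_ae (Eventually.of_forall fun ξ => ?_)
  simp only [sqrt_zero_symbol (norm_nonneg ξ), sqrt_zero_symbol (mul_nonneg hl.le (norm_nonneg ξ))]
  ring

theorem kinetic_translate (m : ℝ) (a : R3) (φ : L2) :
    kinetic m (rescale one_pos a φ) = kinetic m φ := by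
  rw [kinetic_rescale, kinetic]
  simp

theorem rescale_mem_HHalf {l : ℝ} (hl : 0 < l) (a : R3) {φ : L2} (hφ : φ ∈ HHalf) :
    rescale hl a φ ∈ HHalf := by
  rw [mem_HHalf_iff] at hφ ⊢
  have h := (integrable_comp_affine hφ (inv_pos.2 hl) 0).const_mul (l * l⁻¹ ^ 3)
  refine h.congr ?_
  rw [fourier_rescale]
  filter_upwards [coeFn_transport (isWeight_char hl a) (inv_pos.2 hl) 0 (𝓕 φ)] with ξ h
  rw [h, norm_mul, mul_pow, (isWeight_char hl a).2, add_zero, norm_smul,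
    Real.norm_of_nonneg (inv_pos.2 hl).le]
  field_simp

/-- `∫ (k ∗ |φ|²) |φ|²`. -/
def inter (k : R3 → ℝ) (φ : L2) : ℝ :=
  ∫ x : R3, (∫ y : R3, k (x - y) * ‖φ y‖ ^ 2) * ‖φ x‖ ^ 2

theorem inter_rescale (k : R3 → ℝ) {l : ℝ} (hl : 0 < l) (a : R3) (φ : L2) :
    inter k (rescale hl a φ) = inter (fun z => k (l⁻¹ • z)) φ := by
  have hr : ∀ᵐ x : R3, ‖rescale hl a φ x‖ ^ 2 = l ^ 3 * ‖φ (l • x + a)‖ ^ 2 := by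
    filter_upwards [coeFn_transport (isWeight_const hl) hl a φ] with x hx
    rw [rescale, hx, norm_mul, mul_pow, (isWeight_const hl).2 x]
  have h1 : ∀ x : R3, ∫ y : R3, k (x - y) * ‖rescale hl a φ y‖ ^ 2
      = ∫ z : R3, k (l⁻¹ • (l • x + a - z)) * ‖φ z‖ ^ 2 := by
    intro x
    rw [← integral_comp_affine (fun z => k (l⁻¹ • (l • x + a - z)) * ‖φ z‖ ^ 2) hl a]
    refine integral_congr_ae ?_
    filter_upwards [hr] with y hy
    rw [hy, add_sub_add_right_eq_sub, ← smul_sub, inv_smul_smul₀ hl.ne']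
    ring
  unfold inter
  simp_rw [h1]
  rw [← integral_comp_affine (fun x => (∫ z : R3, k (l⁻¹ • (x - z)) * ‖φ z‖ ^ 2) * ‖φ x‖ ^ 2) hl a]
  refine integral_congr_ae ?_
  filter_upwards [hr] with x hx
  rw [hx]
  ring

theorem inter_translate (k : R3 → ℝ) (a : R3) (φ : L2) :
    inter k (rescale one_pos a φ) = inter k φ := by
  rw [inter_rescale]; simp

theorem inter_const_mul (k : R3 → ℝ) (c : ℝ) (φ : L2) :
    inter (fun z => c * k z) φ = c * inter k φ := by
  unfold inter
  simp_rw [mul_assoc c, integral_const_mul, mul_assoc c, integral_const_mul]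

/-- The kernel `1 / |z|^γ`. -/
def riesz (γ : ℝ) (z : R3) : ℝ := 1 / ‖z‖ ^ γ

theorem newton_eq_inter (φ : L2) : newton φ = inter (riesz 1) φ := by
  simp [newton, inter, riesz]

theorem inter_riesz_rescale (γ : ℝ) {l : ℝ} (hl : 0 < l) (a : R3) (φ : L2) :
    inter (riesz γ) (rescale hl a φ) = l ^ γ * inter (riesz γ) φ := by
  rw [inter_rescale, ← inter_const_mul]
  congr 1
  ext z
  rw [riesz, riesz, norm_smul, Real.norm_of_nonneg (inv_pos.2 hl).le,
    Real.mul_rpow (by positivity) (norm_nonneg _), Real.inv_rpow hl.le]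
  field_simp

/-! ### Interaction energies of `H^{1/2}` functions -/

theorem ofReal_norm_sq (z : ℂ) : ENNReal.ofReal (‖z‖ ^ 2) = ‖z‖ₑ ^ 2 := by
  rw [ENNReal.ofReal_pow (norm_nonneg _), ofReal_norm]

theorem kinetic_zero_nonneg (φ : L2) : 0 ≤ kinetic 0 φ :=
  integral_nonneg fun ξ => by positivity

theorem kin_eq {φ : L2} (hφ : φ ∈ HHalf) :
    kin φ = ENNReal.ofReal (kinetic 0 φ / (2 * Real.pi)) := by
  rw [kinetic_zero_eq, mul_div_cancel_left₀ _ (by positivity),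
    ofReal_integral_eq_lintegral_ofReal ((mem_HHalf_iff φ).1 hφ)
      (Eventually.of_forall fun ξ => by positivity), kin]
  refine lintegral_congr fun ξ => ?_
  rw [ENNReal.ofReal_mul (norm_nonneg _), ofReal_norm_sq, ofReal_norm]

/-- The integrand of an interaction energy on `ℝ³ × ℝ³`. -/
def density (k : R3 → ℝ) (φ ψ : L2) (p : R3 × R3) : ℝ :=
  k (p.1 - p.2) * (‖φ p.1‖ ^ 2 * ‖ψ p.2‖ ^ 2)

theorem measurable_density {k : R3 → ℝ} (hk : Measurable k) (φ ψ : L2) :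
    Measurable (density k φ ψ) := by
  have h1 : Measurable fun p : R3 × R3 => ‖φ p.1‖ ^ 2 :=
    ((Lp.stronglyMeasurable φ).measurable.comp measurable_fst).norm.pow_const 2
  have h2 : Measurable fun p : R3 × R3 => ‖ψ p.2‖ ^ 2 :=
    ((Lp.stronglyMeasurable ψ).measurable.comp measurable_snd).norm.pow_const 2
  exact (hk.comp (measurable_fst.sub measurable_snd)).mul (h1.mul h2)

theorem density_nonneg {k : R3 → ℝ} (hk : ∀ z, 0 ≤ k z) (φ ψ : L2) (p : R3 × R3) :
    0 ≤ density k φ ψ p := mul_nonneg (hk _) (by positivity)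

theorem lintegral_density {k : R3 → ℝ} (hk : Measurable k) (hk0 : ∀ z, 0 ≤ k z) (φ ψ : L2) :
    ∫⁻ p, ENNReal.ofReal (density k φ ψ p)
      = ∫⁻ x, ‖φ x‖ₑ ^ 2 * ∫⁻ y, ENNReal.ofReal (k (x - y)) * ‖ψ y‖ₑ ^ 2 := by
  rw [Measure.volume_eq_prod, lintegral_prod _
    (measurable_density hk φ ψ).ennreal_ofReal.aemeasurable]
  refine lintegral_congr fun x => ?_
  rw [← lintegral_const_mul]
  · refine lintegral_congr fun y => ?_
    rw [density, ENNReal.ofReal_mul (hk0 _), ENNReal.ofReal_mul (by positivity), ofReal_norm_sq,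
      ofReal_norm_sq]
    ring
  · exact (hk.comp (measurable_const.sub measurable_id)).ennreal_ofReal.mul (measurable_enorm_sq ψ)

theorem measurable_riesz (γ : ℝ) : Measurable (riesz γ) :=
  measurable_const.div (measurable_norm.pow_const γ)

theorem riesz_nonneg (γ : ℝ) (z : R3) : 0 ≤ riesz γ z := by unfold riesz; positivity

theorem riesz_neg (γ : ℝ) (z : R3) : riesz γ (-z) = riesz γ z := by simp [riesz]

/-- Inside radius `L` the kernel is compared with the Newtonian one, outside with a constant.
Everything proved for `1 / |z|` thus passes to `1 / |z| ^ γ`, and a large `L` makes the constant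
small. -/
theorem riesz_le {γ : ℝ} (h0 : 0 < γ) (h1 : γ ≤ 1) {L : ℝ} (hL : 0 < L) (z : R3) :
    riesz γ z ≤ L ^ (1 - γ) * riesz 1 z + L ^ (-γ) := by
  rcases eq_or_ne z 0 with rfl | hz
  · simp [riesz, h0.ne']; positivity
  have hz : 0 < ‖z‖ := norm_pos_iff.2 hz
  unfold riesz
  rw [Real.rpow_one]
  rcases le_or_gt ‖z‖ L with h | h
  · have : 1 / ‖z‖ ^ γ = ‖z‖ ^ (1 - γ) * (1 / ‖z‖) := by
      rw [Real.rpow_sub hz, Real.rpow_one]; field_simp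
    rw [this]
    have : ‖z‖ ^ (1 - γ) ≤ L ^ (1 - γ) := Real.rpow_le_rpow hz.le h (by linarith)
    have h2 : 0 ≤ L ^ (-γ) := by positivity
    have h3 : 0 ≤ 1 / ‖z‖ := by positivity
    nlinarith
  · have : 1 / ‖z‖ ^ γ ≤ L ^ (-γ) := by
      rw [Real.rpow_neg hL.le, ← one_div]
      gcongr
    have h3 : 0 ≤ L ^ (1 - γ) * (1 / ‖z‖) := by positivity
    linarith

theorem newtonE_eq_lintegral_density (φ ψ : L2) :
    newtonE φ ψ = ∫⁻ p, ENNReal.ofReal (density (riesz 1) φ ψ p) := by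
  rw [lintegral_density (measurable_riesz 1) (riesz_nonneg 1), newtonE]
  simp [riesz]

theorem massE_ne_top (φ : L2) : massE φ ≠ ⊤ := by rw [massE_eq]; exact ENNReal.ofReal_ne_top

theorem kin_ne_top {φ : L2} (hφ : φ ∈ HHalf) : kin φ ≠ ⊤ := by
  rw [kin_eq hφ]; exact ENNReal.ofReal_ne_top

theorem newtonE_ne_top (φ : L2) {ψ : L2} (hψ : ψ ∈ HHalf) : newtonE φ ψ ≠ ⊤ := by
  obtain ⟨C, hC, h⟩ := newtonE_le
  exact ne_top_of_le_ne_top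
    (ENNReal.mul_ne_top (ENNReal.mul_ne_top hC (kin_ne_top hψ)) (massE_ne_top φ)) (h φ ψ)

theorem integrable_density_one (φ : L2) {ψ : L2} (hψ : ψ ∈ HHalf) :
    Integrable (density (riesz 1) φ ψ) := by
  refine ⟨(measurable_density (measurable_riesz 1) φ ψ).aestronglyMeasurable, ?_⟩
  rw [hasFiniteIntegral_iff_ofReal (Eventually.of_forall (density_nonneg (riesz_nonneg 1) φ ψ)),
    ← newtonE_eq_lintegral_density]
  exact (newtonE_ne_top φ hψ).lt_top

theorem integrable_mass_prod (φ ψ : L2) :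
    Integrable fun p : R3 × R3 => ‖φ p.1‖ ^ 2 * ‖ψ p.2‖ ^ 2 :=
  (integrable_norm_sq φ).mul_prod (integrable_norm_sq ψ)

theorem integral_mass_prod (φ ψ : L2) :
    ∫ p : R3 × R3, ‖φ p.1‖ ^ 2 * ‖ψ p.2‖ ^ 2 = mass φ * mass ψ :=
  integral_prod_mul (fun x => ‖φ x‖ ^ 2) (fun x => ‖ψ x‖ ^ 2)

theorem density_riesz_le {γ : ℝ} (h0 : 0 < γ) (h1 : γ ≤ 1) {L : ℝ} (hL : 0 < L) (φ ψ : L2)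
    (p : R3 × R3) : density (riesz γ) φ ψ p ≤
      L ^ (1 - γ) * density (riesz 1) φ ψ p + L ^ (-γ) * (‖φ p.1‖ ^ 2 * ‖ψ p.2‖ ^ 2) := by
  unfold density
  calc _ ≤ (L ^ (1 - γ) * riesz 1 (p.1 - p.2) + L ^ (-γ)) * (‖φ p.1‖ ^ 2 * ‖ψ p.2‖ ^ 2) := by
        gcongr; exact riesz_le h0 h1 hL _
    _ = _ := by ring

theorem integrable_density {γ : ℝ} (h0 : 0 < γ) (h1 : γ ≤ 1) (φ : L2) {ψ : L2} (hψ : ψ ∈ HHalf) :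
    Integrable (density (riesz γ) φ ψ) := by
  refine Integrable.mono' (((integrable_density_one φ hψ).const_mul (1 ^ (1 - γ))).add
    ((integrable_mass_prod φ ψ).const_mul (1 ^ (-γ))))
    (measurable_density (measurable_riesz γ) φ ψ).aestronglyMeasurable
    (Eventually.of_forall fun p => ?_)
  rw [Real.norm_of_nonneg (density_nonneg (riesz_nonneg γ) φ ψ p)]
  exact density_riesz_le h0 h1 one_pos φ ψ p

/-- `∬ k(x - y) |φ(x)|² |ψ(y)|²`. -/
def pairInter (k : R3 → ℝ) (φ ψ : L2) : ℝ := ∫ p, density k φ ψ p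

theorem pairInter_nonneg {k : R3 → ℝ} (hk : ∀ z, 0 ≤ k z) (φ ψ : L2) : 0 ≤ pairInter k φ ψ :=
  integral_nonneg (density_nonneg hk φ ψ)

theorem pairInter_riesz_le {γ : ℝ} (h0 : 0 < γ) (h1 : γ ≤ 1) {L : ℝ} (hL : 0 < L) (φ : L2)
    {ψ : L2} (hψ : ψ ∈ HHalf) : pairInter (riesz γ) φ ψ ≤
      L ^ (1 - γ) * pairInter (riesz 1) φ ψ + L ^ (-γ) * (mass φ * mass ψ) := by
  unfold pairInter
  rw [← integral_mass_prod, ← integral_const_mul, ← integral_const_mul, ← integral_add]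
  · exact integral_mono (integrable_density h0 h1 φ hψ)
      (((integrable_density_one φ hψ).const_mul _).add ((integrable_mass_prod φ ψ).const_mul _))
      (density_riesz_le h0 h1 hL φ ψ)
  · exact (integrable_density_one φ hψ).const_mul _
  · exact (integrable_mass_prod φ ψ).const_mul _

/-- Integrability on the product space is what permits Fubini for the iterated Bochner integral. -/
theorem inter_eq_pairInter {k : R3 → ℝ} {φ : L2} (h : Integrable (density k φ φ)) :
    inter k φ = pairInter k φ φ := by
  rw [pairInter, Measure.volume_eq_prod, integral_prod _ (by rwa [← Measure.volume_eq_prod]), inter]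
  refine integral_congr_ae (Eventually.of_forall fun x => ?_)
  simp only [density]
  rw [← integral_mul_const]
  refine integral_congr_ae (Eventually.of_forall fun y => ?_)
  simp only
  ring

theorem inter_riesz_eq {γ : ℝ} (h0 : 0 < γ) (h1 : γ ≤ 1) {φ : L2} (hφ : φ ∈ HHalf) :
    inter (riesz γ) φ = pairInter (riesz γ) φ φ :=
  inter_eq_pairInter (integrable_density h0 h1 φ hφ)

theorem ofReal_inter_riesz {γ : ℝ} (h0 : 0 < γ) (h1 : γ ≤ 1) {φ : L2} (hφ : φ ∈ HHalf) :
    ENNReal.ofReal (inter (riesz γ) φ) =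
      ∫⁻ x, ‖φ x‖ₑ ^ 2 * ∫⁻ y, ENNReal.ofReal (riesz γ (x - y)) * ‖φ y‖ₑ ^ 2 := by
  rw [inter_riesz_eq h0 h1 hφ, pairInter, ofReal_integral_eq_lintegral_ofReal
    (integrable_density h0 h1 φ hφ) (Eventually.of_forall (density_nonneg (riesz_nonneg γ) φ φ)),
    lintegral_density (measurable_riesz γ) (riesz_nonneg γ)]

theorem ofReal_newton {φ : L2} (hφ : φ ∈ HHalf) : ENNReal.ofReal (newton φ) = newtonE φ φ := by
  rw [newton_eq_inter, inter_riesz_eq one_pos le_rfl hφ, pairInter,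
    ofReal_integral_eq_lintegral_ofReal (integrable_density_one φ hφ)
    (Eventually.of_forall (density_nonneg (riesz_nonneg 1) φ φ)), newtonE_eq_lintegral_density]

theorem inter_riesz_nonneg (γ : ℝ) (φ : L2) : 0 ≤ inter (riesz γ) φ :=
  integral_nonneg fun _ => mul_nonneg (integral_nonneg fun _ =>
    mul_nonneg (riesz_nonneg γ _) (by positivity)) (by positivity)

theorem newton_nonneg (φ : L2) : 0 ≤ newton φ := by
  rw [newton_eq_inter]; exact inter_riesz_nonneg 1 φ

/-- The two kernels can be separated because each density is integrable by itself when `φ ∈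
H^{1/2}`. -/
theorem interaction_eq {α : ℝ} (h0 : 0 < α) (h1 : α < 1) (β : ℝ) {φ : L2} (hφ : φ ∈ HHalf) :
    interaction α β φ = 1 / 4 * (β * inter (riesz α) φ - newton φ) := by
  have hi1 := (integrable_density h0 h1.le φ hφ).const_mul β
  have hi2 := integrable_density_one φ hφ
  rw [interaction, newton_eq_inter, inter_riesz_eq h0 h1.le hφ, inter_riesz_eq one_pos le_rfl hφ]
  congr 1
  unfold pairInter
  rw [← integral_const_mul, ← integral_sub hi1 hi2]
  have hi : Integrable fun p => β * density (riesz α) φ φ p - density (riesz 1) φ φ p :=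
    hi1.sub hi2
  rw [Measure.volume_eq_prod] at hi ⊢
  rw [integral_prod _ hi]
  refine integral_congr_ae (Eventually.of_forall fun x => integral_congr_ae
    (Eventually.of_forall fun y => ?_))
  simp only [density, riesz, Real.rpow_one]
  ring

theorem energy_eq (m : ℝ) {α : ℝ} (h0 : 0 < α) (h1 : α < 1) (β : ℝ) {φ : L2} (hφ : φ ∈ HHalf) :
    energy m α β φ = 1 / 2 * kinetic m φ + 1 / 4 * (β * inter (riesz α) φ - newton φ) := by
  rw [energy, interaction_eq h0 h1 β hφ]

/-! ### Positivity of the critical mass -/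

theorem mass_pos {φ : L2} (h : φ ≠ 0) : 0 < mass φ := by
  rw [mass_eq_norm_sq]; have := norm_pos_iff.2 h; positivity

theorem mass_eq_zero {φ : L2} (h : mass φ = 0) : φ = 0 := by
  by_contra hne; exact (mass_pos hne).ne' h

theorem fourier_ne_zero {φ : L2} (h : φ ≠ 0) : (𝓕 φ : L2) ≠ 0 := by
  rw [← norm_pos_iff, Lp.norm_fourier_eq]; exact norm_pos_iff.2 h

/-- Weighted integrals of `|f|²` with an a.e. positive weight are positive. -/
theorem integral_weight_pos {f : L2} (hf : f ≠ 0) {b : R3 → ℝ} (hb : ∀ᵐ x, 0 < b x)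
    (hi : Integrable fun x => b x * ‖f x‖ ^ 2) : 0 < ∫ x, b x * ‖f x‖ ^ 2 := by
  have hnn : 0 ≤ᵐ[volume] fun x => b x * ‖f x‖ ^ 2 := by
    filter_upwards [hb] with x hx
    exact mul_nonneg hx.le (by positivity)
  refine lt_of_le_of_ne (integral_nonneg_of_ae hnn) fun h => hf ?_
  have h0 := (integral_eq_zero_iff_of_nonneg_ae hnn hi).1 h.symm
  rw [Lp.eq_zero_iff_ae_eq_zero]
  filter_upwards [h0, hb] with x h1 h2
  simpa [h2.ne'] using h1

theorem ae_ne (a : R3) : ∀ᵐ x : R3, x ≠ a := by simp [ae_iff]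

theorem kinetic_zero_pos {φ : L2} (hφ : φ ∈ HHalf) (h : φ ≠ 0) : 0 < kinetic 0 φ := by
  rw [kinetic_zero_eq]
  have := integral_weight_pos (fourier_ne_zero h) (b := fun ξ => ‖ξ‖)
    (by filter_upwards [ae_ne 0] with x hx using norm_pos_iff.2 hx) ((mem_HHalf_iff φ).1 hφ)
  positivity

/-- A ball carrying mass bounds the interaction energy from below. -/
theorem le_inter_riesz {γ : ℝ} (h0 : 0 < γ) (h1 : γ ≤ 1) {φ : L2} (hφ : φ ∈ HHalf) {L η : ℝ}
    (hL : 0 < L) (hη : 0 ≤ η) {x : R3} (h : ENNReal.ofReal η ≤ locMass φ x L) :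
    η ^ 2 / (2 * L) ^ γ ≤ inter (riesz γ) φ := by
  rw [← ENNReal.ofReal_le_ofReal_iff (inter_riesz_nonneg γ φ), ofReal_inter_riesz h0 h1 hφ]
  set c := ENNReal.ofReal (1 / (2 * L) ^ γ) with hc
  calc ENNReal.ofReal (η ^ 2 / (2 * L) ^ γ)
      = c * ENNReal.ofReal η * ENNReal.ofReal η := by
        rw [hc, ← ENNReal.ofReal_mul (by positivity), ← ENNReal.ofReal_mul (by positivity)]
        congr 1; ring
    _ ≤ c * locMass φ x L * locMass φ x L := by gcongr
    _ = ∫⁻ w in ball x L, ‖φ w‖ₑ ^ 2 * (c * locMass φ x L) := by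
        rw [lintegral_mul_const _ (measurable_enorm_sq φ), locMass]; ring
    _ ≤ ∫⁻ w in ball x L, ‖φ w‖ₑ ^ 2 *
          ∫⁻ y, ENNReal.ofReal (riesz γ (w - y)) * ‖φ y‖ₑ ^ 2 := by
        refine setLIntegral_mono' measurableSet_ball fun w hw => ?_
        gcongr
        rw [locMass, ← lintegral_const_mul _ (measurable_enorm_sq φ)]
        refine le_trans ?_ (setLIntegral_le_lintegral (ball x L) _)
        refine lintegral_mono_ae ?_
        filter_upwards [ae_restrict_of_ae (ae_ne w), ae_restrict_mem measurableSet_ball] with y hy hyb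
        gcongr
        rw [hc, riesz]
        have hp : 0 < ‖w - y‖ := norm_pos_iff.2 (sub_ne_zero.2 hy.symm)
        have hle : ‖w - y‖ ≤ 2 * L := by
          rw [← dist_eq_norm]
          have := dist_triangle_right w y x
          rw [mem_ball] at hw hyb
          linarith
        gcongr
    _ ≤ _ := setLIntegral_le_lintegral _ _

theorem exists_locMass_pos {φ : L2} (h : φ ≠ 0) :
    ∃ L : ℝ, 0 < L ∧ ∃ η : ℝ, 0 < η ∧ ENNReal.ofReal η ≤ locMass φ 0 L := by
  have hpos : 0 < massE φ := by rw [massE_eq]; exact ENNReal.ofReal_pos.2 (mass_pos h)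
  by_contra! hcon
  have hz : ∀ n : ℕ, locMass φ 0 (n + 1) = 0 := by
    intro n
    by_contra hne
    have hlt : locMass φ 0 (n + 1) ≠ ⊤ :=
      ne_top_of_le_ne_top (massE_ne_top φ) (locMass_le_massE φ 0 _)
    have := hcon (n + 1) (by positivity) _ (ENNReal.toReal_pos hne hlt)
    rw [ENNReal.ofReal_toReal hlt] at this
    exact lt_irrefl _ this
  have : massE φ = 0 := by
    have hu : (⋃ n : ℕ, ball (0 : R3) ((n : ℝ) + 1)) = univ := by
      refine eq_univ_of_forall fun x => mem_iUnion.2 ?_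
      obtain ⟨n, hn⟩ := exists_nat_gt ‖x‖
      exact ⟨n, by rw [mem_ball_zero_iff]; linarith⟩
    rw [massE, ← setLIntegral_univ, ← hu, ← nonpos_iff_eq_zero]
    refine (lintegral_iUnion_le _ _).trans ?_
    have : ∀ n : ℕ, ∫⁻ a in ball (0 : R3) ((n : ℝ) + 1), ‖φ a‖ₑ ^ 2 = 0 := hz
    simp [this]
  exact hpos.ne' this

theorem inter_riesz_pos {γ : ℝ} (h0 : 0 < γ) (h1 : γ ≤ 1) {φ : L2} (hφ : φ ∈ HHalf)
    (h : φ ≠ 0) : 0 < inter (riesz γ) φ := by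
  obtain ⟨L, hL, η, hη, hle⟩ := exists_locMass_pos h
  refine lt_of_lt_of_le ?_ (le_inter_riesz h0 h1 hφ hL hη.le hle)
  positivity

theorem newton_pos {φ : L2} (hφ : φ ∈ HHalf) (h : φ ≠ 0) : 0 < newton φ := by
  rw [newton_eq_inter]; exact inter_riesz_pos one_pos le_rfl hφ h

theorem newton_le_const : ∃ C : ℝ, 0 < C ∧ ∀ φ ∈ HHalf,
    newton φ ≤ C * (kinetic 0 φ * mass φ) := by
  obtain ⟨C, hC, h⟩ := newtonE_le
  refine ⟨(C.toReal + 1) / (2 * Real.pi), by positivity, fun φ hφ => ?_⟩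
  have hk := kinetic_zero_nonneg φ
  have hm := mass_nonneg φ
  rw [← ENNReal.ofReal_le_ofReal_iff (by positivity), ofReal_newton hφ]
  calc newtonE φ φ ≤ C * kin φ * massE φ := h φ φ
    _ ≤ ENNReal.ofReal (C.toReal + 1) * kin φ * massE φ := by
        gcongr
        rw [← ENNReal.ofReal_toReal hC]
        exact ENNReal.ofReal_le_ofReal (by simp)
    _ = _ := by
        rw [kin_eq hφ, massE_eq, ← ENNReal.ofReal_mul (by positivity),
          ← ENNReal.ofReal_mul (by positivity)]
        congr 1; ring

/-- Quantitative absence of vanishing. -/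
theorem newton_le_of_locMass_le : ∃ C : ℝ, 0 < C ∧ ∀ φ ∈ HHalf, ∀ κ L η : ℝ, 0 < κ → 0 < L →
    0 ≤ η → (∀ x, locMass φ x L ≤ ENNReal.ofReal η) →
    newton φ ≤ C * (κ ^ 2 * mass φ + η / κ) * kinetic 0 φ + mass φ ^ 2 / L := by
  obtain ⟨C, hC, h⟩ := newtonE_self_le
  refine ⟨(C.toReal + 1) / (2 * Real.pi), by positivity, fun φ hφ κ L η hκ hL hη hloc => ?_⟩
  have hk := kinetic_zero_nonneg φ
  have hm := mass_nonneg φ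
  rw [← ENNReal.ofReal_le_ofReal_iff (by positivity), ofReal_newton hφ]
  calc newtonE φ φ ≤ _ := h φ κ L _ hκ hL hloc
    _ ≤ ENNReal.ofReal (C.toReal + 1) * (ENNReal.ofReal (κ ^ 2) * massE φ
          + ENNReal.ofReal (1 / κ) * ENNReal.ofReal η) * kin φ
          + ENNReal.ofReal (1 / L) * massE φ ^ 2 := by
        gcongr
        rw [← ENNReal.ofReal_toReal hC]
        exact ENNReal.ofReal_le_ofReal (by simp)
    _ = _ := by
        rw [kin_eq hφ, massE_eq, ← ENNReal.ofReal_pow hm, ← ENNReal.ofReal_mul (by positivity),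
          ← ENNReal.ofReal_mul (by positivity), ← ENNReal.ofReal_mul (by positivity),
          ← ENNReal.ofReal_add (by positivity) (by positivity), ← ENNReal.ofReal_mul (by positivity),
          ← ENNReal.ofReal_mul (by positivity), ← ENNReal.ofReal_add (by positivity) (by positivity)]
        congr 1; field_simp

theorem exists_HHalf_ne_zero : ∃ φ : L2, φ ∈ HHalf ∧ φ ≠ 0 := by
  have hms : MeasurableSet (ball (0 : R3) 1) := measurableSet_ball
  set g : L2 := indicatorConstLp 2 hms measure_ball_lt_top.ne (1 : ℂ) with hg
  have hgc : (g : R3 → ℂ) =ᵐ[volume] (ball (0 : R3) 1).indicator fun _ => (1 : ℂ) :=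
    indicatorConstLp_coeFn
  refine ⟨𝓕⁻ g, ?_, ?_⟩
  · rw [mem_HHalf_iff, fourier_fourierInv_eq]
    refine (integrable_norm_sq g).mono' ?_ ?_
    · exact continuous_norm.aestronglyMeasurable.mul (integrable_norm_sq g).aestronglyMeasurable
    · filter_upwards [hgc] with x hx
      rw [Real.norm_of_nonneg (by positivity), hx]
      by_cases h : x ∈ ball (0 : R3) 1
      · rw [mem_ball_zero_iff] at h
        have : ‖x‖ * ‖(ball (0 : R3) 1).indicator (fun _ => (1 : ℂ)) x‖ ^ 2
          ≤ 1 * ‖(ball (0 : R3) 1).indicator (fun _ => (1 : ℂ)) x‖ ^ 2 := by gcongr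
        simpa using this
      · simp [h]
  · intro h
    have h0 : g = 0 := by
      have h1 : 𝓕 (𝓕⁻ g : L2) = g := fourier_fourierInv_eq g
      rw [← h1, h]
      exact (Lp.fourierTransformₗᵢ R3 ℂ).map_zero
    have h1 : ‖g‖ = 0 := by rw [h0, norm_zero]
    rw [hg, norm_indicatorConstLp (by norm_num) (by norm_num)] at h1
    have : 0 < (volume : Measure R3).real (ball 0 1) :=
      ENNReal.toReal_pos (measure_ball_pos _ _ one_pos).ne' measure_ball_lt_top.ne
    have h2 : 0 < (volume : Measure R3).real (ball 0 1) ^ (1 / (2 : ℝ≥0∞).toReal) := by positivity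
    rw [norm_one, one_mul] at h1
    exact h2.ne' h1

/-- The Kato-type bound keeps the quotients above `1 / C`; the set of quotients must also be
nonempty, since a real infimum over the empty set would be zero. -/
theorem criticalMass_pos : 0 < criticalMass := by
  obtain ⟨C, hC, h⟩ := newton_le_const
  have hlb : ∀ q ∈ (fun ψ : L2 => kinetic 0 ψ * mass ψ / newton ψ) '' {ψ | ψ ∈ HHalf ∧ ψ ≠ 0},
      1 / C ≤ q := by
    rintro _ ⟨ψ, ⟨hψ, hne⟩, rfl⟩
    have := newton_pos hψ hne
    simp only
    rw [div_le_div_iff₀ hC this]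
    linarith [h ψ hψ]
  have hne : ((fun ψ : L2 => kinetic 0 ψ * mass ψ / newton ψ) ''
      {ψ | ψ ∈ HHalf ∧ ψ ≠ 0}).Nonempty := by
    obtain ⟨φ, h1, h2⟩ := exists_HHalf_ne_zero
    exact ⟨_, φ, ⟨h1, h2⟩, rfl⟩
  have := le_csInf hne hlb
  have hC' : 0 < 1 / C := by positivity
  unfold criticalMass
  linarith

theorem criticalMass_mul_newton_le {φ : L2} (hφ : φ ∈ HHalf) :
    criticalMass * newton φ ≤ 2 * (kinetic 0 φ * mass φ) := by
  rcases eq_or_ne φ 0 with rfl | hne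
  · have : newton (0 : L2) = 0 := by
      obtain ⟨C, hC, h⟩ := newton_le_const
      refine le_antisymm ?_ (newton_nonneg _)
      have := h 0 hφ
      rwa [mass_eq_norm_sq, norm_zero, zero_pow two_ne_zero, mul_zero, mul_zero] at this
    rw [this, mass_eq_norm_sq, norm_zero]; simp
  have hb : BddBelow ((fun ψ : L2 => kinetic 0 ψ * mass ψ / newton ψ) ''
      {ψ | ψ ∈ HHalf ∧ ψ ≠ 0}) := by
    refine ⟨0, ?_⟩
    rintro _ ⟨ψ, -, rfl⟩
    exact div_nonneg (mul_nonneg (kinetic_zero_nonneg ψ) (mass_nonneg ψ)) (newton_nonneg ψ)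
  have h1 : sInf ((fun ψ : L2 => kinetic 0 ψ * mass ψ / newton ψ) ''
      {ψ | ψ ∈ HHalf ∧ ψ ≠ 0}) ≤ kinetic 0 φ * mass φ / newton φ :=
    csInf_le hb ⟨φ, ⟨hφ, hne⟩, rfl⟩
  have hp := newton_pos hφ hne
  rw [le_div_iff₀ hp] at h1
  unfold criticalMass
  linarith

/-! ### Weak compactness in `H^{1/2}` -/

/-- Sequential Banach–Alaoglu in the separable space `L²`, transported through the Riesz
isomorphism. -/
theorem exists_weak_limit_L2 (g : ℕ → L2) {C : ℝ} (hg : ∀ n, ‖g n‖ ≤ C) :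
    ∃ (g₀ : L2) (σ : ℕ → ℕ), StrictMono σ ∧
      ∀ h : L2, Tendsto (fun n => inner ℂ h (g (σ n) - g₀)) atTop (𝓝 0) := by
  have : Fact ((1 : ℝ≥0∞) ≤ 2) := ⟨by norm_num⟩
  have : Fact ((2 : ℝ≥0∞) ≠ ⊤) := ⟨by norm_num⟩
  have hsep : TopologicalSpace.SeparableSpace L2 := inferInstance
  obtain ⟨T, -, σ, hσ, hT⟩ := WeakDual.isSeqCompact_closedBall (𝕜 := ℂ) (E := L2) 0 C
    (x := fun n => StrongDual.toWeakDual (InnerProductSpace.toDual ℂ L2 (g n))) (fun n => by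
      simpa using hg n)
  set g₀ : L2 := (InnerProductSpace.toDual ℂ L2).symm (WeakDual.toStrongDual T) with hg0
  refine ⟨g₀, σ, hσ, fun h => ?_⟩
  have h1 := ((WeakDual.eval_continuous (𝕜 := ℂ) (E := L2) h).tendsto T).comp hT
  have h2 : Tendsto (fun n => inner ℂ (g (σ n)) h) atTop (𝓝 (inner ℂ g₀ h)) := by
    have : inner ℂ g₀ h = T h := by
      rw [hg0, InnerProductSpace.toDual_symm_apply]; rfl
    rw [this]
    exact h1
  have h3 : Tendsto (fun n => inner ℂ (g (σ n)) h - inner ℂ g₀ h) atTop (𝓝 0) := by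
    simpa using h2.sub_const (inner ℂ g₀ h)
  have h4 := (Complex.continuous_conj.tendsto 0).comp h3
  simp only [map_zero] at h4
  refine h4.congr fun n => ?_
  simp only [Function.comp_apply, map_sub, inner_conj_symm, inner_sub_right]

theorem memLp_mul_bounded {c : R3 → ℝ} (hc : Measurable c) {C : ℝ} (hC : ∀ x, |c x| ≤ C) (f : L2) :
    MemLp (fun x => (c x : ℂ) * f x) 2 := by
  refine ((Lp.memLp f).const_mul (C : ℂ)).mono
    ((Complex.measurable_ofReal.comp hc).aestronglyMeasurable.mul (Lp.aestronglyMeasurable f))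
    (Eventually.of_forall fun x => ?_)
  have h0 : 0 ≤ C := (abs_nonneg _).trans (hC x)
  simp only [norm_mul, Complex.norm_real, Real.norm_eq_abs, abs_of_nonneg h0]
  gcongr
  exact hC x

theorem integrable_weight {φ : L2} (hφ : φ ∈ HHalf) {b : R3 → ℝ} (hb : Measurable b) {C : ℝ}
    (hC : ∀ ξ, |b ξ| ≤ C * (1 + ‖ξ‖)) : Integrable fun ξ => b ξ * ‖(𝓕 φ : L2) ξ‖ ^ 2 := by
  refine (((integrable_norm_sq (𝓕 φ)).add ((mem_HHalf_iff φ).1 hφ)).const_mul C).mono'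
    (hb.aestronglyMeasurable.mul (integrable_norm_sq (𝓕 φ)).aestronglyMeasurable)
    (Eventually.of_forall fun ξ => ?_)
  rw [norm_mul, Real.norm_eq_abs, Real.norm_of_nonneg (by positivity)]
  calc _ ≤ (C * (1 + ‖ξ‖)) * ‖(𝓕 φ : L2) ξ‖ ^ 2 := by gcongr; exact hC ξ
    _ = _ := by simp only [Pi.add_apply]; ring

theorem norm_add_sq_complex (a c : ℂ) :
    ‖a + c‖ ^ 2 = ‖a‖ ^ 2 + ‖c‖ ^ 2 + 2 * (inner ℂ a c).re := by
  have := norm_add_sq (𝕜 := ℂ) a c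
  simp only [RCLike.re_to_complex] at this
  rw [this]; ring

theorem HHalf_sub {φ ψ : L2} (hφ : φ ∈ HHalf) (hψ : ψ ∈ HHalf) : φ - ψ ∈ HHalf := by
  unfold HHalf at *
  have h := MemSobolev.sub hφ hψ
  rw [mem_ofPred_eq]
  convert h using 1
  rw [← Lp.toTemperedDistributionCLM_apply, map_sub]
  rfl

theorem HHalf_smul (c : ℂ) {φ : L2} (hφ : φ ∈ HHalf) : c • φ ∈ HHalf := by
  unfold HHalf at *
  have h := MemSobolev.smul c hφ
  rw [mem_ofPred_eq]
  convert h using 1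
  rw [← Lp.toTemperedDistributionCLM_apply, map_smul]
  rfl

/-- A bounded sequence in `H^{1/2}` has a subsequence converging weakly, along which quadratic
forms with symbol bounded by `1 + |ξ|` split. -/
theorem exists_weak_limit (φ : ℕ → L2) (hφ : ∀ n, φ n ∈ HHalf) {A : ℝ}
    (hA : ∀ n, kinetic 0 (φ n) + mass (φ n) ≤ A) :
    ∃ (ψ : L2) (σ : ℕ → ℕ), ψ ∈ HHalf ∧ StrictMono σ ∧
      (∀ h : L2, Tendsto (fun n => inner ℂ h (𝓕 (φ (σ n) - ψ))) atTop (𝓝 0)) ∧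
      ∀ b : R3 → ℝ, Measurable b → (∃ C, ∀ ξ, |b ξ| ≤ C * (1 + ‖ξ‖)) →
        Tendsto (fun n => (∫ ξ, b ξ * ‖(𝓕 (φ (σ n)) : L2) ξ‖ ^ 2) - (∫ ξ, b ξ * ‖(𝓕 ψ : L2) ξ‖ ^ 2)
          - ∫ ξ, b ξ * ‖(𝓕 (φ (σ n) - ψ) : L2) ξ‖ ^ 2) atTop (𝓝 0) := by
  -- Multiplying `φ̂` by `√(1 + |ξ|)` turns boundedness in `H^{1/2}` into boundedness in `L²`. The
  -- weak limit is divided by the same weight to define `ψ`.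
  set s : R3 → ℝ := fun ξ => Real.sqrt (1 + ‖ξ‖) with hs
  have hs1 : ∀ ξ, 1 ≤ s ξ := fun ξ => Real.one_le_sqrt.2 (by linarith [norm_nonneg ξ])
  have hs0 : ∀ ξ, 0 < s ξ := fun ξ => one_pos.trans_le (hs1 ξ)
  have hs2 : ∀ ξ, s ξ ^ 2 = 1 + ‖ξ‖ := fun ξ => Real.sq_sqrt (by positivity)
  have hsm : Measurable s := by fun_prop
  have hmem : ∀ n, MemLp (fun ξ => (s ξ : ℂ) * (𝓕 (φ n) : L2) ξ) 2 := by
    intro n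
    have hm : AEStronglyMeasurable fun ξ => (s ξ : ℂ) * (𝓕 (φ n) : L2) ξ :=
      (Complex.measurable_ofReal.comp hsm).aestronglyMeasurable.mul (Lp.aestronglyMeasurable _)
    rw [memLp_two_iff_integrable_norm_sq hm]
    simp_rw [norm_mul, mul_pow, Complex.norm_real, Real.norm_eq_abs, sq_abs, hs2]
    exact integrable_weight (hφ n) (by fun_prop) (C := 1) fun ξ => by
      rw [abs_of_pos (by positivity), one_mul]
  set g : ℕ → L2 := fun n => (hmem n).toLp with hg
  have hgc : ∀ n, (g n : R3 → ℂ) =ᵐ[volume] fun ξ => (s ξ : ℂ) * (𝓕 (φ n) : L2) ξ := fun n =>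
    (hmem n).coeFn_toLp
  have hgn : ∀ n, ‖g n‖ ≤ Real.sqrt A := by
    intro n
    apply Real.le_sqrt_of_sq_le
    have h1 : ‖g n‖ ^ 2 = ∫ ξ, (1 + ‖ξ‖) * ‖(𝓕 (φ n) : L2) ξ‖ ^ 2 := by
      rw [← mass_eq_norm_sq, mass]
      refine integral_congr_ae ?_
      filter_upwards [hgc n] with ξ h
      rw [h, norm_mul, mul_pow, Complex.norm_real, Real.norm_eq_abs, sq_abs, hs2]
    refine le_trans ?_ (hA n)
    rw [h1]
    simp_rw [add_mul, one_mul]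
    rw [integral_add (integrable_norm_sq _) ((mem_HHalf_iff _).1 (hφ n)), mass_fourier,
      kinetic_zero_eq, add_comm]
    have : 0 ≤ ∫ ξ : R3, ‖ξ‖ * ‖(𝓕 (φ n) : L2) ξ‖ ^ 2 := integral_nonneg fun ξ => by positivity
    have hpi := Real.pi_gt_three
    nlinarith
  obtain ⟨g₀, σ, hσ, hw⟩ := exists_weak_limit_L2 g hgn
  have hinv : ∀ ξ, |(s ξ)⁻¹| ≤ 1 := fun ξ => by
    rw [abs_of_pos (inv_pos.2 (hs0 ξ))]; exact inv_le_one_of_one_le₀ (hs1 ξ)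
  set ψ : L2 := 𝓕⁻ (memLp_mul_bounded hsm.inv hinv g₀).toLp with hψ
  have hψc : (𝓕 ψ : L2) =ᵐ[volume] fun ξ => (((s ξ)⁻¹ : ℝ) : ℂ) * g₀ ξ := by
    rw [hψ, fourier_fourierInv_eq]
    exact (memLp_mul_bounded hsm.inv hinv g₀).coeFn_toLp
  have hψH : ψ ∈ HHalf := by
    rw [mem_HHalf_iff]
    refine (integrable_norm_sq g₀).mono' (continuous_norm.aestronglyMeasurable.mul
      (integrable_norm_sq _).aestronglyMeasurable) ?_
    filter_upwards [hψc] with ξ h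
    rw [Real.norm_of_nonneg (by positivity), h, norm_mul, mul_pow, Complex.norm_real,
      Real.norm_eq_abs, sq_abs, inv_pow, hs2, ← mul_assoc]
    have : ‖ξ‖ * (1 + ‖ξ‖)⁻¹ ≤ 1 := by
      rw [← div_eq_mul_inv, div_le_one (by positivity)]; linarith
    calc _ ≤ 1 * ‖g₀ ξ‖ ^ 2 := by gcongr
      _ = _ := one_mul _
  have hr : ∀ n, (𝓕 (φ (σ n) - ψ) : L2) =ᵐ[volume]
      fun ξ => (((s ξ)⁻¹ : ℝ) : ℂ) * (g (σ n) - g₀) ξ := by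
    intro n
    have e : 𝓕 (φ (σ n) - ψ) = 𝓕 (φ (σ n)) - 𝓕 ψ := (Lp.fourierTransformₗᵢ R3 ℂ).map_sub _ _
    rw [e]
    filter_upwards [Lp.coeFn_sub (𝓕 (φ (σ n)) : L2) (𝓕 ψ), Lp.coeFn_sub (g (σ n)) g₀, hgc (σ n), hψc]
      with ξ h1 h2 h3 h4
    rw [h1, h2, Pi.sub_apply, Pi.sub_apply, h3, h4, mul_sub, ← mul_assoc, ← Complex.ofReal_mul,
      inv_mul_cancel₀ (hs0 ξ).ne']
    simp
  refine ⟨ψ, σ, hψH, hσ, fun h => ?_, fun b hb ⟨C, hC⟩ => ?_⟩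
  · have hmh := memLp_mul_bounded hsm.inv hinv h
    refine (hw hmh.toLp).congr fun n => ?_
    rw [L2.inner_def, L2.inner_def]
    refine integral_congr_ae ?_
    filter_upwards [hmh.coeFn_toLp, hr n] with ξ h1 h2
    rw [h1, h2]
    simp only [RCLike.inner_apply, map_mul, Complex.conj_ofReal, Pi.inv_apply]
    ring
  · have hbs : ∀ ξ, |b ξ / s ξ ^ 2| ≤ C := fun ξ => by
      rw [abs_div, abs_of_pos (by have := hs0 ξ; positivity : 0 < s ξ ^ 2), hs2,
        div_le_iff₀ (by positivity)]
      exact hC ξ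
    -- The cross term of the quadratic form is `2 Re ⟨(b / s²) g₀, g (σ n) - g₀⟩`. As `b / s²` is
    -- bounded, `(b / s²) g₀` is a fixed `L²` function and weak convergence applies.
    have hmb := memLp_mul_bounded (hb.div (hsm.pow_const 2)) hbs g₀
    have hlim := (((Complex.continuous_re.tendsto 0).comp (hw hmb.toLp)).const_mul 2)
    rw [Complex.zero_re, mul_zero] at hlim
    refine hlim.congr fun n => ?_
    have hiφ := integrable_weight (hφ (σ n)) hb hC
    have hiψ := integrable_weight hψH hb hC
    have hir := integrable_weight (HHalf_sub (hφ (σ n)) hψH) hb hC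
    have hid : Integrable fun ξ => b ξ * ‖(𝓕 (φ (σ n)) : L2) ξ‖ ^ 2 - b ξ * ‖(𝓕 ψ : L2) ξ‖ ^ 2 :=
      hiφ.sub hiψ
    rw [← integral_sub hiφ hiψ, ← integral_sub hid hir]
    simp only [Function.comp_apply]
    have hre := integral_re (L2.integrable_inner (𝕜 := ℂ) hmb.toLp (g (σ n) - g₀))
    simp only [RCLike.re_to_complex] at hre
    rw [L2.inner_def, ← hre, ← integral_const_mul]
    refine integral_congr_ae ?_
    have e : 𝓕 (φ (σ n) - ψ) = 𝓕 (φ (σ n)) - 𝓕 ψ := (Lp.fourierTransformₗᵢ R3 ℂ).map_sub _ _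
    filter_upwards [hmb.coeFn_toLp, hr n, hψc,
      Lp.coeFn_sub (𝓕 (φ (σ n)) : L2) (𝓕 ψ)] with ξ h1 h2 h3 h4
    have h5 : (𝓕 (φ (σ n)) : L2) ξ = (𝓕 ψ : L2) ξ + (𝓕 (φ (σ n) - ψ) : L2) ξ := by
      rw [e, h4, Pi.sub_apply]; ring
    rw [h5, norm_add_sq_complex, h1, h2, h3]
    simp only [RCLike.inner_apply, map_mul, Complex.conj_ofReal, Pi.div_apply]
    have e1 : (g (σ n) - g₀ : L2) ξ * (((b ξ / s ξ ^ 2 : ℝ) : ℂ) * (starRingEnd ℂ) (g₀ ξ))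
        = ((b ξ / s ξ ^ 2 : ℝ) : ℂ) * ((g (σ n) - g₀ : L2) ξ * (starRingEnd ℂ) (g₀ ξ)) := by ring
    have e2 : (((s ξ)⁻¹ : ℝ) : ℂ) * (g (σ n) - g₀ : L2) ξ *
        ((((s ξ)⁻¹ : ℝ) : ℂ) * (starRingEnd ℂ) (g₀ ξ))
        = (((s ξ)⁻¹ * (s ξ)⁻¹ : ℝ) : ℂ) * ((g (σ n) - g₀ : L2) ξ * (starRingEnd ℂ) (g₀ ξ)) := by
      push_cast; ring
    rw [e1, e2, Complex.re_ofReal_mul, Complex.re_ofReal_mul]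
    have := (hs0 ξ).ne'
    field_simp
    ring

/-! ### Local compactness -/

theorem highMass_le (φ : L2) {Λ : ℝ} (hΛ : 0 < Λ) :
    highMass φ Λ ≤ ENNReal.ofReal (1 / Λ) * kin φ := by
  rw [highMass, kin, ← lintegral_const_mul' _ _ ENNReal.ofReal_ne_top]
  refine le_trans (setLIntegral_mono' measurableSet_ball.compl fun ξ hξ => ?_)
    (setLIntegral_le_lintegral (ball (0 : R3) Λ)ᶜ _)
  have h : Λ ≤ ‖ξ‖ := by simpa using hξ
  rw [← mul_assoc, ← ofReal_norm ξ, ← ENNReal.ofReal_mul (by positivity)]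
  have : 1 ≤ ENNReal.ofReal (1 / Λ * ‖ξ‖) := by
    rw [ENNReal.one_le_ofReal, one_div, inv_mul_eq_div, one_le_div hΛ]
    exact h
  calc _ = 1 * ‖(𝓕 φ : L2) ξ‖ₑ ^ 2 := (one_mul _).symm
    _ ≤ _ := by gcongr

/-- The plane wave at `x`, cut off to frequencies in the ball of radius `Λ`. -/
theorem memLp_cutoffWave (Λ : ℝ) (x : R3) : MemLp ((ball (0 : R3) Λ).indicator
    fun ξ => (starRingEnd ℂ) (Real.fourierChar (inner ℝ ξ x) : ℂ)) 2 := by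
  have hc : Continuous fun ξ : R3 => (starRingEnd ℂ) (Real.fourierChar (inner ℝ ξ x) : ℂ) :=
    Complex.continuous_conj.comp
      (continuous_subtype_val.comp (Real.continuous_fourierChar.comp (by fun_prop)))
  refine (memLp_indicator_const 2 measurableSet_ball (1 : ℝ)
    (Or.inr (measure_ball_lt_top (μ := (volume : Measure R3)) (x := 0) (r := Λ)).ne)).mono
    (hc.aestronglyMeasurable.indicator measurableSet_ball) (Eventually.of_forall fun ξ => ?_)
  by_cases h : ξ ∈ ball (0 : R3) Λ
  · rw [indicator_of_mem h, indicator_of_mem h, RCLike.norm_conj, Circle.norm_coe, norm_one]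
  · simp [h]

def cutoffWave (Λ : ℝ) (x : R3) : L2 := (memLp_cutoffWave Λ x).toLp

/-- Point evaluation of the low part is an `L²` pairing, so weak convergence gives pointwise
convergence. -/
theorem lowPart_eq_inner (φ : L2) (Λ : ℝ) (x : R3) :
    lowPart φ Λ x = inner ℂ (cutoffWave Λ x) (𝓕 φ : L2) := by
  rw [lowPart, Real.fourierInv_eq, L2.inner_def]
  refine integral_congr_ae ?_
  filter_upwards [(memLp_cutoffWave Λ x).coeFn_toLp] with ξ hξ
  rw [cutoffWave, hξ]
  by_cases h : ξ ∈ ball (0 : R3) Λ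
  · simp [h, Circle.smul_def, mul_comm]
  · simp [h]

theorem norm_cutoffWave (Λ : ℝ) (x : R3) :
    ‖cutoffWave Λ x‖ ^ 2 = (volume : Measure R3).real (ball 0 Λ) := by
  rw [← mass_eq_norm_sq, mass]
  have : ∀ᵐ ξ : R3, ‖cutoffWave Λ x ξ‖ ^ 2 = (ball (0 : R3) Λ).indicator (fun _ => (1 : ℝ)) ξ := by
    filter_upwards [(memLp_cutoffWave Λ x).coeFn_toLp] with ξ hξ
    rw [cutoffWave, hξ]
    by_cases h : ξ ∈ ball (0 : R3) Λ
    · rw [indicator_of_mem h, indicator_of_mem h, RCLike.norm_conj, Circle.norm_coe, one_pow]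
    · simp [h]
  rw [integral_congr_ae this, integral_indicator measurableSet_ball]
  simp

/-- A sup bound depending only on `Λ` and the mass, used as the dominating constant on balls. -/
theorem enorm_lowPart_sq_le (φ : L2) (Λ : ℝ) (x : R3) :
    ‖lowPart φ Λ x‖ₑ ^ 2 ≤ volume (ball (0 : R3) Λ) * massE φ := by
  have h := norm_inner_le_norm (𝕜 := ℂ) (cutoffWave Λ x) (𝓕 φ : L2)
  rw [← lowPart_eq_inner, Lp.norm_fourier_eq] at h
  have h2 : ‖lowPart φ Λ x‖ ^ 2 ≤ (volume : Measure R3).real (ball 0 Λ) * mass φ := by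
    rw [← norm_cutoffWave Λ x, mass_eq_norm_sq, ← mul_pow]
    gcongr
  rw [← ofReal_norm_sq, massE_eq, ← ENNReal.ofReal_toReal (measure_ball_lt_top.ne :
    volume (ball (0 : R3) Λ) ≠ ⊤), ← ENNReal.ofReal_mul ENNReal.toReal_nonneg]
  exact ENNReal.ofReal_le_ofReal h2

theorem locMass_le_low_high (φ : L2) (Λ : ℝ) (x : R3) (R : ℝ) :
    locMass φ x R ≤ 2 * (∫⁻ y in ball x R, ‖lowPart φ Λ y‖ₑ ^ 2) + 2 * highMass φ Λ := by
  have hc : Measurable fun y => ‖lowPart φ Λ y‖ₑ ^ 2 :=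
    (continuous_fourierInv_of_integrable
      (integrable_indicator_fourier φ Λ)).measurable.enorm.pow_const 2
  calc locMass φ x R
      ≤ ∫⁻ y in ball x R, (2 * ‖lowPart φ Λ y‖ₑ ^ 2 + 2 * ‖highPart φ Λ y‖ₑ ^ 2) := by
        refine lintegral_mono_ae (ae_restrict_of_ae ?_)
        filter_upwards [ae_eq_lowPart_add_highPart φ Λ] with y hy
        rw [hy]
        exact enorm_add_sq_le _ _
    _ = 2 * (∫⁻ y in ball x R, ‖lowPart φ Λ y‖ₑ ^ 2)
        + 2 * ∫⁻ y in ball x R, ‖highPart φ Λ y‖ₑ ^ 2 := by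
        rw [lintegral_add_left (hc.const_mul _), lintegral_const_mul _ hc,
          lintegral_const_mul _ (measurable_enorm_sq _)]
    _ ≤ _ := by
        gcongr
        rw [← lintegral_highPart]
        exact setLIntegral_le_lintegral _ _

/-- Local Rellich compactness: a bounded, weakly null sequence in `H^{1/2}` loses its mass on
every ball. -/
theorem tendsto_locMass {r : ℕ → L2} {A : ℝ≥0∞} (hA : A ≠ ⊤) (hm : ∀ n, massE (r n) ≤ A)
    (hk : ∀ n, kin (r n) ≤ A)
    (hw : ∀ h : L2, Tendsto (fun n => inner ℂ h (𝓕 (r n) : L2)) atTop (𝓝 0)) (x : R3) (R : ℝ) :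
    Tendsto (fun n => locMass (r n) x R) atTop (𝓝 0) := by
  have hlow : ∀ Λ : ℝ, Tendsto (fun n => ∫⁻ y in ball x R, ‖lowPart (r n) Λ y‖ₑ ^ 2)
      atTop (𝓝 0) := by
    intro Λ
    have h0 : (0 : ℝ≥0∞) = ∫⁻ y in ball x R, 0 := by simp
    rw [h0]
    refine tendsto_lintegral_of_dominated_convergence (fun _ => volume (ball (0 : R3) Λ) * A)
      (fun n => ?_) (fun n => ?_) ?_ ?_
    · exact (continuous_fourierInv_of_integrable
        (integrable_indicator_fourier (r n) Λ)).measurable.enorm.pow_const 2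
    · refine Eventually.of_forall fun y => (enorm_lowPart_sq_le (r n) Λ y).trans ?_
      exact mul_le_mul_right (hm n) _
    · rw [lintegral_const, Measure.restrict_apply_univ]
      exact ENNReal.mul_ne_top (ENNReal.mul_ne_top measure_ball_lt_top.ne hA) measure_ball_lt_top.ne
    · refine Eventually.of_forall fun y => ?_
      have h1 : Tendsto (fun n => lowPart (r n) Λ y) atTop (𝓝 0) :=
        (hw (cutoffWave Λ y)).congr fun n => (lowPart_eq_inner (r n) Λ y).symm
      have h2 := ((continuous_enorm.tendsto (0 : ℂ)).comp h1)
      have h3 := ((ENNReal.continuous_pow 2).tendsto _).comp h2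
      simpa [Function.comp_def] using h3
  rw [ENNReal.tendsto_nhds_zero]
  intro ε hε
  -- High frequencies are made small uniformly in `n` by the kinetic bound; then, with `Λ` fixed,
  -- the low part tends to zero by dominated convergence.
  obtain ⟨Λ, hΛ, hΛε⟩ : ∃ Λ : ℝ, 0 < Λ ∧ 2 * (ENNReal.ofReal (1 / Λ) * A) ≤ ε / 2 := by
    have ht : Tendsto (fun Λ : ℝ => 2 * (ENNReal.ofReal (1 / Λ) * A)) atTop (𝓝 0) := by
      have h1 : Tendsto (fun Λ : ℝ => ENNReal.ofReal (1 / Λ)) atTop (𝓝 0) := by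
        have := ENNReal.tendsto_ofReal (tendsto_const_nhds.div_atTop tendsto_id :
          Tendsto (fun Λ : ℝ => (1 : ℝ) / Λ) atTop (𝓝 0))
        simpa using this
      have h2 := ENNReal.Tendsto.const_mul (a := 2) (ENNReal.Tendsto.mul_const (b := A) h1
        (Or.inr hA)) (Or.inr (by norm_num))
      simpa using h2
    have hε2 : (0 : ℝ≥0∞) < ε / 2 := ENNReal.half_pos hε.ne'
    obtain ⟨Λ, h1, h2⟩ := ((ENNReal.tendsto_nhds_zero.1 ht (ε / 2) hε2).and
      (eventually_gt_atTop 0)).exists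
    exact ⟨Λ, h2, h1⟩
  have h2 := ENNReal.Tendsto.const_mul (a := 2) (hlow Λ) (Or.inr (by norm_num))
  rw [mul_zero] at h2
  filter_upwards [ENNReal.tendsto_nhds_zero.1 h2 (ε / 2) (ENNReal.half_pos hε.ne')] with n hn
  calc locMass (r n) x R ≤ _ := locMass_le_low_high (r n) Λ x R
    _ ≤ ε / 2 + 2 * (ENNReal.ofReal (1 / Λ) * A) := by
        gcongr
        refine (highMass_le (r n) hΛ).trans ?_
        gcongr
        exact hk n
    _ ≤ ε / 2 + ε / 2 := by gcongr
    _ = ε := ENNReal.add_halves ε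

theorem pairMass_comm (φ ψ : L2) (R : ℝ) : pairMass φ ψ R = pairMass ψ φ R := by
  set S : Set (R3 × R3) := {p | dist p.2 p.1 < R} with hSdef
  have hS : MeasurableSet S := measurableSet_lt (by fun_prop) measurable_const
  have h1 : ∀ x, locMass ψ x R = ∫⁻ y, S.indicator 1 (x, y) * ‖ψ y‖ₑ ^ 2 := by
    intro x
    rw [locMass, ← lintegral_indicator measurableSet_ball]
    refine lintegral_congr fun y => ?_
    by_cases hy : dist y x < R <;> simp [indicator, hSdef, hy]
  have h2 : ∀ y, locMass φ y R = ∫⁻ x, ‖φ x‖ₑ ^ 2 * S.indicator 1 (x, y) := by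
    intro y
    rw [locMass, ← lintegral_indicator measurableSet_ball]
    refine lintegral_congr fun x => ?_
    rw [mul_comm]
    by_cases hy : dist x y < R <;> simp [indicator, hSdef, hy, dist_comm y x]
  unfold pairMass
  simp_rw [h1, h2]
  exact lintegral_mul_lintegral_indicator_swap (measurable_enorm_sq φ) (aemeasurable_enorm_sq ψ) hS

/-- Local loss of mass makes the interaction with a fixed `ψ` vanish at each radius. Dominated
convergence is used twice, in space and then in the radius. -/
theorem tendsto_newtonE {ψ : L2} (hψ : ψ ∈ HHalf) {r : ℕ → L2} {A : ℝ≥0∞} (hA : A ≠ ⊤)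
    (hm : ∀ n, massE (r n) ≤ A)
    (hloc : ∀ x R, Tendsto (fun n => locMass (r n) x R) atTop (𝓝 0)) :
    Tendsto (fun n => newtonE ψ (r n)) atTop (𝓝 0) := by
  have hpair : ∀ R, Tendsto (fun n => pairMass ψ (r n) R) atTop (𝓝 0) := by
    intro R
    have h0 : (0 : ℝ≥0∞) = ∫⁻ _ : R3, 0 := by simp
    rw [h0]
    refine tendsto_lintegral_of_dominated_convergence (fun x => ‖ψ x‖ₑ ^ 2 * A)
      (fun n => (measurable_enorm_sq ψ).mul (measurable_locMass_center (r n) R)) (fun n => ?_) ?_ ?_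
    · refine Eventually.of_forall fun x => ?_
      simp only
      gcongr
      exact (locMass_le_massE _ _ _).trans (hm n)
    · rw [lintegral_mul_const _ (measurable_enorm_sq ψ)]
      exact ENNReal.mul_ne_top (massE_ne_top ψ) hA
    · refine Eventually.of_forall fun x => ?_
      have := ENNReal.Tendsto.const_mul (a := ‖ψ x‖ₑ ^ 2) (hloc x R)
        (Or.inr (ENNReal.pow_ne_top enorm_ne_top))
      simpa using this
  have hmain : Tendsto (fun n => ∫⁻ R in Ioi (0 : ℝ),
      ENNReal.ofReal ((R ^ 2)⁻¹) * pairMass ψ (r n) R) atTop (𝓝 0) := by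
    have h0 : (0 : ℝ≥0∞) = ∫⁻ _ in Ioi (0 : ℝ), 0 := by simp
    rw [h0]
    have hkm := measurable_katoBound ψ
    refine tendsto_lintegral_of_dominated_convergence
      (fun R => ENNReal.ofReal ((R ^ 2)⁻¹) * katoBound ψ R * A) (fun n => ?_) (fun n => ?_) ?_ ?_
    · have := measurable_pairMass ψ (r n)
      fun_prop
    · refine Eventually.of_forall fun R => ?_
      simp only
      -- Exchanging the roles puts the Kato bound on the fixed `ψ`, giving a majorant independent of
      -- `n`.
      rw [mul_assoc, pairMass_comm]
      gcongr
      refine (pairMass_le_of_locMass_le (r n) ψ fun x => locMass_le_katoBound ψ x R).trans ?_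
      gcongr
      exact hm n
    · obtain ⟨C, hC, h⟩ := lintegral_katoBound_le
      rw [lintegral_mul_const _ (by fun_prop)]
      exact ENNReal.mul_ne_top (ne_top_of_le_ne_top (ENNReal.mul_ne_top hC (kin_ne_top hψ)) (h ψ)) hA
    · refine Eventually.of_forall fun R => ?_
      have := ENNReal.Tendsto.const_mul (a := ENNReal.ofReal ((R ^ 2)⁻¹)) (hpair R)
        (Or.inr ENNReal.ofReal_ne_top)
      simpa using this
  exact tendsto_of_tendsto_of_tendsto_of_le_of_le tendsto_const_nhds hmain
    (fun _ => zero_le) (fun n => newtonE_le_lintegral_pairMass ψ (r n))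

/-! ### Splitting of the interaction energy -/

theorem density_swap (γ : ℝ) (φ ψ : L2) (p : R3 × R3) :
    density (riesz γ) φ ψ p.swap = density (riesz γ) ψ φ p := by
  unfold density
  rw [Prod.fst_swap, Prod.snd_swap, ← riesz_neg, neg_sub, mul_comm (‖φ p.2‖ ^ 2)]

theorem pairInter_comm (γ : ℝ) (φ ψ : L2) :
    pairInter (riesz γ) φ ψ = pairInter (riesz γ) ψ φ := by
  unfold pairInter
  rw [Measure.volume_eq_prod, ← integral_prod_swap]
  simp_rw [density_swap]

theorem ofReal_pairInter_one (φ : L2) {ψ : L2} (hψ : ψ ∈ HHalf) :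
    ENNReal.ofReal (pairInter (riesz 1) φ ψ) = newtonE φ ψ := by
  rw [pairInter, ofReal_integral_eq_lintegral_ofReal (integrable_density_one φ hψ)
    (Eventually.of_forall (density_nonneg (riesz_nonneg 1) φ ψ)), newtonE_eq_lintegral_density]

theorem tendsto_pairInter {γ : ℝ} (h0 : 0 < γ) (h1 : γ ≤ 1) {ψ : L2} {r : ℕ → L2}
    (hr : ∀ n, r n ∈ HHalf) {A : ℝ} (hA : ∀ n, mass (r n) ≤ A)
    (hN : Tendsto (fun n => newtonE ψ (r n)) atTop (𝓝 0)) :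
    Tendsto (fun n => pairInter (riesz γ) ψ (r n)) atTop (𝓝 0) := by
  have hone : Tendsto (fun n => pairInter (riesz 1) ψ (r n)) atTop (𝓝 0) := by
    have := (ENNReal.tendsto_toReal ENNReal.zero_ne_top).comp hN
    refine this.congr fun n => ?_
    rw [Function.comp_apply, ← ofReal_pairInter_one ψ (hr n),
      ENNReal.toReal_ofReal (pairInter_nonneg (riesz_nonneg 1) _ _)]
  have hA0 : 0 ≤ A := (mass_nonneg _).trans (hA 0)
  rw [Metric.tendsto_atTop]
  intro ε hε
  obtain ⟨L, hL, hLε⟩ : ∃ L : ℝ, 0 < L ∧ L ^ (-γ) * (mass ψ * A) < ε / 2 := by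
    have h2 := (tendsto_rpow_neg_atTop h0).mul_const (mass ψ * A)
    rw [zero_mul] at h2
    obtain ⟨L, h3, h4⟩ := ((h2.eventually (gt_mem_nhds (half_pos hε))).and
      (eventually_gt_atTop 0)).exists
    exact ⟨L, h4, h3⟩
  have h3 := hone.const_mul (L ^ (1 - γ))
  rw [mul_zero] at h3
  obtain ⟨N, hN⟩ := eventually_atTop.1 (h3.eventually (gt_mem_nhds (half_pos hε)))
  refine ⟨N, fun n hn => ?_⟩
  rw [Real.dist_eq, sub_zero, abs_of_nonneg (pairInter_nonneg (riesz_nonneg γ) _ _)]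
  have h4 := pairInter_riesz_le h0 h1 hL ψ (hr n)
  have h5 : L ^ (-γ) * (mass ψ * mass (r n)) ≤ L ^ (-γ) * (mass ψ * A) := by
    have := mass_nonneg ψ
    gcongr
    exact hA n
  linarith [hN n hn]

/-- Expand `(a + c)(b + d) = X + Y + Z` with `X = ab`, `Y = cd`, `Z = ad + cb`. The product `|X|
|Y|` equals `|ad| |cb|`, hence is already controlled by the mixed terms `S`. In the constant, `3` is
one `S` from `X, Y` and two from `|Z|²`; `4 / ε` comes from two uses of Young's inequality against
`Z`. -/
theorem abs_norm_sq_split_le {ε : ℝ} (hε : 0 < ε) (a b c d : ℂ) :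
    |‖a + c‖ ^ 2 * ‖b + d‖ ^ 2 - ‖a‖ ^ 2 * ‖b‖ ^ 2 - ‖c‖ ^ 2 * ‖d‖ ^ 2| ≤
      ε * (‖a‖ ^ 2 * ‖b‖ ^ 2 + ‖c‖ ^ 2 * ‖d‖ ^ 2)
        + (3 + 4 / ε) * (‖a‖ ^ 2 * ‖d‖ ^ 2 + ‖c‖ ^ 2 * ‖b‖ ^ 2) := by
  set X := a * b with hX
  set Y := c * d with hY
  set Z := a * d + c * b with hZ
  set S := ‖a‖ ^ 2 * ‖d‖ ^ 2 + ‖c‖ ^ 2 * ‖b‖ ^ 2 with hS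
  have e1 : ‖a + c‖ ^ 2 * ‖b + d‖ ^ 2 = ‖X + Y + Z‖ ^ 2 := by
    rw [← mul_pow, ← norm_mul]; congr 2; rw [hX, hY, hZ]; ring
  have e2 : ‖a‖ ^ 2 * ‖b‖ ^ 2 = ‖X‖ ^ 2 := by rw [hX, norm_mul, mul_pow]
  have e3 : ‖c‖ ^ 2 * ‖d‖ ^ 2 = ‖Y‖ ^ 2 := by rw [hY, norm_mul, mul_pow]
  have e4 : ‖X + Y + Z‖ ^ 2 = ‖X‖ ^ 2 + ‖Y‖ ^ 2 + 2 * (inner ℂ X Y).re + ‖Z‖ ^ 2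
      + 2 * (inner ℂ (X + Y) Z).re := by
    rw [norm_add_sq_complex, norm_add_sq_complex]
  have i1 : |(inner ℂ X Y).re| ≤ ‖X‖ * ‖Y‖ :=
    (Complex.abs_re_le_norm _).trans (norm_inner_le_norm _ _)
  have i2 : |(inner ℂ (X + Y) Z).re| ≤ (‖X‖ + ‖Y‖) * ‖Z‖ :=
    ((Complex.abs_re_le_norm _).trans (norm_inner_le_norm _ _)).trans
      (by gcongr; exact norm_add_le X Y)
  have hZ2 : ‖Z‖ ^ 2 ≤ 2 * S := by
    have h : ‖Z‖ ≤ ‖a‖ * ‖d‖ + ‖c‖ * ‖b‖ := by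
      rw [hZ, ← norm_mul, ← norm_mul]; exact norm_add_le _ _
    have h' : ‖Z‖ ^ 2 ≤ (‖a‖ * ‖d‖ + ‖c‖ * ‖b‖) ^ 2 := by gcongr
    nlinarith [sq_nonneg (‖a‖ * ‖d‖ - ‖c‖ * ‖b‖)]
  have hXY : 2 * (‖X‖ * ‖Y‖) ≤ S := by
    rw [hX, hY, norm_mul, norm_mul, hS]
    nlinarith [sq_nonneg (‖a‖ * ‖d‖ - ‖c‖ * ‖b‖)]
  have young : ∀ u : ℝ, 2 * (u * ‖Z‖) ≤ ε * u ^ 2 + ‖Z‖ ^ 2 / ε := by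
    intro u
    have h : ε * u ^ 2 + ‖Z‖ ^ 2 / ε - 2 * (u * ‖Z‖) = (ε * u - ‖Z‖) ^ 2 / ε := by
      field_simp; ring
    have : 0 ≤ (ε * u - ‖Z‖) ^ 2 / ε := by positivity
    linarith
  have hZe : ‖Z‖ ^ 2 / ε ≤ 2 / ε * S := by
    rw [div_mul_eq_mul_div]; gcongr
  have hs : (3 + 4 / ε) * S = S + 2 * S + 2 / ε * S + 2 / ε * S := by ring
  rw [e1, e2, e3, e4, hs]
  have y1 := young ‖X‖
  have y2 := young ‖Y‖
  rw [abs_le] at i1 i2 ⊢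
  have hz0 : 0 ≤ ‖Z‖ ^ 2 := by positivity
  constructor <;> nlinarith

theorem abs_inter_split_le {γ : ℝ} (h0 : 0 < γ) (h1 : γ ≤ 1) {φ ψ : L2} (hφ : φ ∈ HHalf)
    (hψ : ψ ∈ HHalf) {ε : ℝ} (hε : 0 < ε) :
    |inter (riesz γ) φ - inter (riesz γ) ψ - inter (riesz γ) (φ - ψ)| ≤
      ε * (inter (riesz γ) ψ + inter (riesz γ) (φ - ψ))
        + (3 + 4 / ε) * (2 * pairInter (riesz γ) ψ (φ - ψ)) := by
  have hr := HHalf_sub hφ hψ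
  have hsymm := pairInter_comm γ ψ (φ - ψ)
  have hae : ∀ᵐ x : R3, φ x = ψ x + (φ - ψ : L2) x := by
    filter_upwards [Lp.coeFn_sub φ ψ] with x hx
    rw [hx, Pi.sub_apply]; ring
  have hae1 : ∀ᵐ p : R3 × R3, φ p.1 = ψ p.1 + (φ - ψ : L2) p.1 :=
    Measure.quasiMeasurePreserving_fst.ae hae
  have hae2 : ∀ᵐ p : R3 × R3, φ p.2 = ψ p.2 + (φ - ψ : L2) p.2 :=
    Measure.quasiMeasurePreserving_snd.ae hae
  have i1 := integrable_density h0 h1 φ hφ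
  have i2 := integrable_density h0 h1 ψ hψ
  have i3 := integrable_density h0 h1 (φ - ψ) hr
  have i4 := integrable_density h0 h1 ψ hr
  have i5 := integrable_density h0 h1 (φ - ψ) hψ
  have i12 : Integrable fun p => density (riesz γ) φ φ p - density (riesz γ) ψ ψ p := i1.sub i2
  have i23 : Integrable fun p => density (riesz γ) ψ ψ p
      + density (riesz γ) (φ - ψ) (φ - ψ) p := i2.add i3
  have i45 : Integrable fun p => density (riesz γ) ψ (φ - ψ) p
      + density (riesz γ) (φ - ψ) ψ p := i4.add i5
  rw [inter_riesz_eq h0 h1 hφ, inter_riesz_eq h0 h1 hψ, inter_riesz_eq h0 h1 hr, two_mul]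
  nth_rw 2 [hsymm]
  unfold pairInter
  rw [← integral_sub i1 i2, ← integral_sub i12 i3, ← integral_add i2 i3, ← integral_add i4 i5,
    ← integral_const_mul, ← integral_const_mul, ← integral_add (i23.const_mul _) (i45.const_mul _)]
  refine abs_integral_le_integral_abs.trans (integral_mono_ae (i12.sub i3).abs
    ((i23.const_mul _).add (i45.const_mul _)) ?_)
  filter_upwards [hae1, hae2] with p hp1 hp2
  simp only [density]
  have hk := riesz_nonneg γ (p.1 - p.2)
  have key := mul_le_mul_of_nonneg_left (abs_norm_sq_split_le hε (ψ p.1) (ψ p.2)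
    ((φ - ψ : L2) p.1) ((φ - ψ : L2) p.2)) hk
  rw [← hp1, ← hp2] at key
  calc _ = riesz γ (p.1 - p.2) * |‖φ p.1‖ ^ 2 * ‖φ p.2‖ ^ 2 - ‖ψ p.1‖ ^ 2 * ‖ψ p.2‖ ^ 2 -
        ‖(φ - ψ : L2) p.1‖ ^ 2 * ‖(φ - ψ : L2) p.2‖ ^ 2| := by
        rw [← abs_of_nonneg hk, ← abs_mul, abs_of_nonneg hk]; congr 1; ring
    _ ≤ _ := key
    _ = _ := by ring

theorem tendsto_inter_split {γ : ℝ} (h0 : 0 < γ) (h1 : γ ≤ 1) {φ : ℕ → L2} {ψ : L2}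
    (hφ : ∀ n, φ n ∈ HHalf) (hψ : ψ ∈ HHalf) {B : ℝ}
    (hB : ∀ n, inter (riesz γ) (φ n - ψ) ≤ B)
    (hX : Tendsto (fun n => pairInter (riesz γ) ψ (φ n - ψ)) atTop (𝓝 0)) :
    Tendsto (fun n => inter (riesz γ) (φ n) - inter (riesz γ) ψ - inter (riesz γ) (φ n - ψ))
      atTop (𝓝 0) := by
  rw [Metric.tendsto_atTop]
  intro δ hδ
  set B' := inter (riesz γ) ψ + B + 1 with hB'
  have hB0 : 0 ≤ B := (inter_riesz_nonneg γ _).trans (hB 0)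
  have hB'0 : 0 < B' := by have := inter_riesz_nonneg γ ψ; positivity
  set ε := δ / (2 * B') with hε
  have hε0 : 0 < ε := by positivity
  have h2 := (hX.const_mul 2).const_mul (3 + 4 / ε)
  rw [mul_zero, mul_zero] at h2
  obtain ⟨N, hN⟩ := eventually_atTop.1 (h2.eventually (gt_mem_nhds (half_pos hδ)))
  refine ⟨N, fun n hn => ?_⟩
  rw [Real.dist_eq, sub_zero]
  have h3 := abs_inter_split_le h0 h1 (hφ n) hψ hε0
  have h4 : ε * (inter (riesz γ) ψ + inter (riesz γ) (φ n - ψ)) ≤ ε * B' := by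
    gcongr; linarith [hB n]
  have h5 : ε * B' = δ / 2 := by rw [hε]; field_simp
  linarith [hN n hn]

/-! ### Compactness modulo translations -/

theorem locMass_translate (a : R3) (φ : L2) (L : ℝ) :
    locMass (rescale one_pos a φ) 0 L = locMass φ a L := by
  have h : ∀ᵐ x : R3, ‖rescale one_pos a φ x‖ₑ ^ 2 = ‖φ (x + a)‖ₑ ^ 2 := by
    filter_upwards [coeFn_transport (isWeight_const one_pos) one_pos a φ] with x hx
    rw [rescale, hx]; simp
  rw [locMass, locMass, lintegral_congr_ae (ae_restrict_of_ae h),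
    ← lintegral_indicator measurableSet_ball, ← lintegral_indicator measurableSet_ball,
    ← lintegral_add_right_eq_self ((ball a L).indicator fun y => ‖φ y‖ₑ ^ 2) a]
  refine lintegral_congr fun x => ?_
  have : x ∈ ball (0 : R3) L ↔ x + a ∈ ball a L := by
    simp [mem_ball, dist_eq_norm]
  by_cases hx : x ∈ ball (0 : R3) L
  · rw [indicator_of_mem hx, indicator_of_mem (this.1 hx)]
  · rw [indicator_of_notMem hx, indicator_of_notMem (fun h' => hx (this.2 h'))]

theorem exists_locMass_of_le_newton {A c : ℝ} (hc : 0 < c) : ∃ L η : ℝ, 0 < L ∧ 0 < η ∧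
    ∀ φ ∈ HHalf, kinetic 0 φ ≤ A → mass φ ≤ A → c ≤ newton φ →
      ∃ x, ENNReal.ofReal η ≤ locMass φ x L := by
  obtain ⟨C, hC, h⟩ := newton_le_of_locMass_le
  set B := |A| + 1 with hB
  have hBp : 0 < B := by positivity
  have hAB : A ≤ B := by have := le_abs_self A; linarith
  -- With these choices the `κ`, `η` and `L` terms of the nonvanishing estimate are each at most `c
  -- / 4`, so together they stay below `c`.
  set κ := Real.sqrt (c / (4 * C * B ^ 2)) with hκ
  have hκp : 0 < κ := Real.sqrt_pos.2 (by positivity)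
  have hκ2 : κ ^ 2 = c / (4 * C * B ^ 2) := Real.sq_sqrt (by positivity)
  set η := c * κ / (4 * C * B) with hη
  set L := 4 * B ^ 2 / c with hL
  refine ⟨L, η, by positivity, by positivity, fun φ hφ hk hm hn => ?_⟩
  by_contra! hcon
  have hmain := h φ hφ κ L η hκp (by positivity) (by positivity) fun x => (hcon x).le
  have hm0 := mass_nonneg φ
  have hk0 := kinetic_zero_nonneg φ
  have h1 : C * (κ ^ 2 * mass φ + η / κ) * kinetic 0 φ ≤ C * (κ ^ 2 * B + η / κ) * B := by
    gcongr <;> linarith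
  have h2 : mass φ ^ 2 / L ≤ B ^ 2 / L := by gcongr; linarith
  have h3 : C * (κ ^ 2 * B + η / κ) * B = c / 2 := by
    rw [hκ2, hη]; field_simp; ring
  have h4 : B ^ 2 / L = c / 4 := by rw [hL]; field_simp
  linarith

theorem measurable_symbol (m : ℝ) :
    Measurable fun ξ : R3 => Real.sqrt ((2 * Real.pi * ‖ξ‖) ^ 2 + m ^ 2) := by fun_prop

theorem symbol_le (m t : ℝ) (ht : 0 ≤ t) :
    Real.sqrt ((2 * Real.pi * t) ^ 2 + m ^ 2) ≤ 2 * Real.pi * t + |m| := by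
  rw [Real.sqrt_le_iff]
  have := abs_nonneg m
  have hp := Real.pi_pos
  refine ⟨by positivity, ?_⟩
  rw [← sq_abs m]
  have : 0 ≤ 2 * Real.pi * t * |m| := by positivity
  nlinarith

theorem abs_symbol_le (m : ℝ) (ξ : R3) :
    |Real.sqrt ((2 * Real.pi * ‖ξ‖) ^ 2 + m ^ 2)| ≤ (2 * Real.pi + |m|) * (1 + ‖ξ‖) := by
  rw [abs_of_nonneg (Real.sqrt_nonneg _)]
  refine (symbol_le m ‖ξ‖ (norm_nonneg ξ)).trans ?_
  have h1 := mul_nonneg (abs_nonneg m) (norm_nonneg ξ)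
  have hp := Real.pi_pos
  nlinarith

theorem mass_eq_integral_symbol (φ : L2) : mass φ = ∫ ξ, (1 : ℝ) * ‖(𝓕 φ : L2) ξ‖ ^ 2 := by
  simp_rw [one_mul]; exact (mass_fourier φ).symm

/-- Bounded sequences in `H^{1/2}` with Newtonian energy bounded below split, along a subsequence
and up to translations, into a nonzero profile and a remainder. -/
theorem exists_profile (m : ℝ) {α : ℝ} (h0 : 0 < α) (h1 : α < 1) (φ : ℕ → L2)
    (hφ : ∀ n, φ n ∈ HHalf) {A c : ℝ} (hA : ∀ n, kinetic 0 (φ n) ≤ A) (hM : ∀ n, mass (φ n) ≤ A)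
    (hc : 0 < c) (hN : ∀ n, c ≤ newton (φ n)) :
    ∃ (ψ : L2) (r : ℕ → L2) (σ : ℕ → ℕ), ψ ∈ HHalf ∧ ψ ≠ 0 ∧ (∀ n, r n ∈ HHalf) ∧ StrictMono σ ∧
      Tendsto (fun n => mass (φ (σ n)) - mass ψ - mass (r n)) atTop (𝓝 0) ∧
      Tendsto (fun n => kinetic m (φ (σ n)) - kinetic m ψ - kinetic m (r n)) atTop (𝓝 0) ∧
      Tendsto (fun n => kinetic 0 (φ (σ n)) - kinetic 0 ψ - kinetic 0 (r n)) atTop (𝓝 0) ∧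
      Tendsto (fun n => newton (φ (σ n)) - newton ψ - newton (r n)) atTop (𝓝 0) ∧
      Tendsto (fun n => inter (riesz α) (φ (σ n)) - inter (riesz α) ψ - inter (riesz α) (r n))
        atTop (𝓝 0) := by
  obtain ⟨L, η, hL, hη, hloc⟩ := exists_locMass_of_le_newton (A := A) hc
  choose x hx using fun n => hloc (φ n) (hφ n) (hA n) (hM n) (hN n)
  set χ : ℕ → L2 := fun n => rescale one_pos (x n) (φ n) with hχ
  have hχH : ∀ n, χ n ∈ HHalf := fun n => rescale_mem_HHalf one_pos (x n) (hφ n)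
  have hχM : ∀ n, mass (χ n) = mass (φ n) := fun n => mass_rescale _ _ _
  have hχK : ∀ μ n, kinetic μ (χ n) = kinetic μ (φ n) := fun μ n => kinetic_translate _ _ _
  have hχI : ∀ γ n, inter (riesz γ) (χ n) = inter (riesz γ) (φ n) := fun γ n =>
    inter_translate _ _ _
  obtain ⟨ψ, σ, hψ, hσ, hweak, hsplit⟩ := exists_weak_limit χ hχH (A := A + A) fun n => by
    rw [hχM, hχK]; exact add_le_add (hA n) (hM n)
  have hrH : ∀ n, χ (σ n) - ψ ∈ HHalf := fun n => HHalf_sub (hχH _) hψ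
  have hmass : Tendsto (fun n => mass (φ (σ n)) - mass ψ - mass (χ (σ n) - ψ)) atTop (𝓝 0) := by
    have := hsplit (fun _ => 1) measurable_const ⟨1, fun ξ => by simp⟩
    refine this.congr fun n => ?_
    rw [← hχM, mass_eq_integral_symbol, mass_eq_integral_symbol ψ, mass_eq_integral_symbol (χ (σ n) - ψ)]
  have hkin : ∀ μ, Tendsto (fun n => kinetic μ (φ (σ n)) - kinetic μ ψ - kinetic μ (χ (σ n) - ψ))
      atTop (𝓝 0) := fun μ => by
    have := hsplit _ (measurable_symbol μ) ⟨_, abs_symbol_le μ⟩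
    refine this.congr fun n => ?_
    rw [← hχK]; rfl
  -- The remainder is bounded because a convergent sequence of splitting errors is bounded below.
  obtain ⟨A₁, hA₁⟩ : ∃ A₁ : ℝ, ∀ n, mass (χ (σ n) - ψ) ≤ A₁ := by
    obtain ⟨b, hb⟩ := hmass.bddBelow_range
    refine ⟨A - mass ψ - b, fun n => ?_⟩
    have h2 := hb ⟨n, rfl⟩
    simp only at h2
    linarith [hM (σ n)]
  obtain ⟨A₂, hA₂⟩ : ∃ A₂ : ℝ, ∀ n, kinetic 0 (χ (σ n) - ψ) ≤ A₂ := by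
    obtain ⟨b, hb⟩ := (hkin 0).bddBelow_range
    refine ⟨A - kinetic 0 ψ - b, fun n => ?_⟩
    have h2 := hb ⟨n, rfl⟩
    simp only at h2
    linarith [hA (σ n)]
  have hA₁0 : 0 ≤ A₁ := (mass_nonneg _).trans (hA₁ 0)
  have hA₂0 : 0 ≤ A₂ := (kinetic_zero_nonneg _).trans (hA₂ 0)
  have hmE : ∀ n, massE (χ (σ n) - ψ) ≤ ENNReal.ofReal (A₁ + A₂) := fun n => by
    rw [massE_eq]; exact ENNReal.ofReal_le_ofReal (by linarith [hA₁ n])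
  have hkE : ∀ n, kin (χ (σ n) - ψ) ≤ ENNReal.ofReal (A₁ + A₂) := fun n => by
    rw [kin_eq (hrH n)]
    refine ENNReal.ofReal_le_ofReal ?_
    have hp := Real.pi_gt_three
    have := div_le_self (kinetic_zero_nonneg (χ (σ n) - ψ)) (by linarith : 1 ≤ 2 * Real.pi)
    linarith [hA₂ n]
  have hlocr := tendsto_locMass ENNReal.ofReal_ne_top hmE hkE hweak
  have hNE := tendsto_newtonE hψ ENNReal.ofReal_ne_top hmE hlocr
  obtain ⟨C, hC, hCN⟩ := newton_le_const
  have hB1 : ∀ n, inter (riesz 1) (χ (σ n) - ψ) ≤ C * (A₂ * A₁) := fun n => by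
    rw [← newton_eq_inter]
    refine (hCN _ (hrH n)).trans ?_
    have := mass_nonneg (χ (σ n) - ψ)
    gcongr
    · exact hA₂ n
    · exact hA₁ n
  have hinter : ∀ γ, 0 < γ → γ ≤ 1 → Tendsto (fun n => inter (riesz γ) (φ (σ n))
      - inter (riesz γ) ψ - inter (riesz γ) (χ (σ n) - ψ)) atTop (𝓝 0) := by
    intro γ hγ0 hγ1
    have hB : ∀ n, inter (riesz γ) (χ (σ n) - ψ) ≤ C * (A₂ * A₁) + A₁ * A₁ := fun n => by
      have h2 := pairInter_riesz_le hγ0 hγ1 one_pos (χ (σ n) - ψ) (hrH n)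
      rw [← inter_riesz_eq hγ0 hγ1 (hrH n), ← inter_riesz_eq one_pos le_rfl (hrH n)] at h2
      simp only [Real.one_rpow, one_mul] at h2
      have h3 : mass (χ (σ n) - ψ) * mass (χ (σ n) - ψ) ≤ A₁ * A₁ :=
        mul_self_le_mul_self (mass_nonneg _) (hA₁ n)
      linarith [hB1 n]
    have := tendsto_inter_split hγ0 hγ1 (fun n => hχH (σ n)) hψ hB
      (tendsto_pairInter hγ0 hγ1 hrH hA₁ hNE)
    refine this.congr fun n => ?_
    rw [hχI]
  refine ⟨ψ, fun n => χ (σ n) - ψ, σ, hψ, ?_, hrH, hσ, hmass, hkin m, hkin 0, ?_, hinter α h0 h1.le⟩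
  -- If the profile vanished, the remainder would be the recentred sequence itself, which keeps mass
  -- `η` in the ball of radius `L` at the origin.
  · rintro rfl
    have h2 := hlocr 0 L
    simp only [sub_zero] at h2
    have h3 : ∀ n, ENNReal.ofReal η ≤ locMass (χ (σ n)) 0 L := fun n => by
      rw [hχ]; simp only; rw [locMass_translate]; exact hx (σ n)
    have h4 := ge_of_tendsto' h2 h3
    rw [nonpos_iff_eq_zero, ENNReal.ofReal_eq_zero] at h4
    linarith
  · simp_rw [newton_eq_inter]
    exact hinter 1 one_pos le_rfl

/-! ### Multiplication by constants -/

theorem mass_smul (c : ℂ) (φ : L2) : mass (c • φ) = ‖c‖ ^ 2 * mass φ := by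
  rw [mass_eq_norm_sq, mass_eq_norm_sq, norm_smul, mul_pow]

theorem kinetic_smul (m : ℝ) (c : ℂ) (φ : L2) : kinetic m (c • φ) = ‖c‖ ^ 2 * kinetic m φ := by
  have e : 𝓕 (c • φ) = c • 𝓕 φ := (Lp.fourierTransformₗᵢ R3 ℂ).map_smul c φ
  rw [kinetic, kinetic, e, ← integral_const_mul]
  refine integral_congr_ae ?_
  filter_upwards [Lp.coeFn_smul c (𝓕 φ : L2)] with ξ h
  rw [h, Pi.smul_apply, norm_smul]
  ring

theorem inter_smul (k : R3 → ℝ) (c : ℂ) (φ : L2) : inter k (c • φ) = ‖c‖ ^ 4 * inter k φ := by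
  have h : ∀ᵐ x : R3, ‖(c • φ : L2) x‖ ^ 2 = ‖c‖ ^ 2 * ‖φ x‖ ^ 2 := by
    filter_upwards [Lp.coeFn_smul c φ] with x h
    rw [h, Pi.smul_apply, norm_smul, mul_pow]
  have h1 : ∀ x : R3, ∫ y : R3, k (x - y) * ‖(c • φ : L2) y‖ ^ 2
      = ‖c‖ ^ 2 * ∫ y : R3, k (x - y) * ‖φ y‖ ^ 2 := by
    intro x
    rw [← integral_const_mul]
    refine integral_congr_ae ?_
    filter_upwards [h] with y hy
    rw [hy]; ring
  unfold inter
  simp_rw [h1]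
  rw [← integral_const_mul]
  refine integral_congr_ae ?_
  filter_upwards [h] with x hx
  rw [hx]; ring

theorem newton_smul (c : ℂ) (φ : L2) : newton (c • φ) = ‖c‖ ^ 4 * newton φ := by
  rw [newton_eq_inter, newton_eq_inter, inter_smul]

theorem norm_sqrt_sq {s : ℝ} (hs : 0 ≤ s) : ‖((Real.sqrt s : ℝ) : ℂ)‖ ^ 2 = s := by
  rw [Complex.norm_real, Real.norm_eq_abs, sq_abs, Real.sq_sqrt hs]

theorem norm_sqrt_pow_four {s : ℝ} (hs : 0 ≤ s) : ‖((Real.sqrt s : ℝ) : ℂ)‖ ^ 4 = s ^ 2 := by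
  rw [show (4 : ℕ) = 2 * 2 from rfl, pow_mul, norm_sqrt_sq hs]

theorem newton_rescale {l : ℝ} (hl : 0 < l) (a : R3) (φ : L2) :
    newton (rescale hl a φ) = l * newton φ := by
  rw [newton_eq_inter, newton_eq_inter, inter_riesz_rescale, Real.rpow_one]

/-! ### Comparison of kinetic energies -/

theorem integrable_kinetic (m : ℝ) {φ : L2} (hφ : φ ∈ HHalf) : Integrable fun ξ : R3 =>
    Real.sqrt ((2 * Real.pi * ‖ξ‖) ^ 2 + m ^ 2) * ‖(𝓕 φ : L2) ξ‖ ^ 2 :=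
  integrable_weight hφ (measurable_symbol m) (abs_symbol_le m)

theorem le_symbol (m t : ℝ) : m ≤ Real.sqrt ((2 * Real.pi * t) ^ 2 + m ^ 2) :=
  Real.le_sqrt_of_sq_le (by nlinarith [sq_nonneg (2 * Real.pi * t)])

theorem lt_symbol {m : ℝ} (hm : 0 < m) (t : ℝ) :
    2 * Real.pi * t < Real.sqrt ((2 * Real.pi * t) ^ 2 + m ^ 2) :=
  Real.lt_sqrt_of_sq_lt (by nlinarith [sq_nonneg (2 * Real.pi * t)])

theorem mul_mass_le_kinetic (m : ℝ) {φ : L2} (hφ : φ ∈ HHalf) : m * mass φ ≤ kinetic m φ := by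
  rw [← mass_fourier, ← integral_const_mul]
  refine integral_mono ((integrable_norm_sq _).const_mul m) (integrable_kinetic m hφ) fun ξ => ?_
  simp only
  gcongr
  exact le_symbol m ‖ξ‖

theorem kinetic_sub_kinetic_zero (m : ℝ) {φ : L2} (hφ : φ ∈ HHalf) : kinetic m φ - kinetic 0 φ =
    ∫ ξ : R3, (Real.sqrt ((2 * Real.pi * ‖ξ‖) ^ 2 + m ^ 2) - 2 * Real.pi * ‖ξ‖) *
      ‖(𝓕 φ : L2) ξ‖ ^ 2 := by
  rw [kinetic, kinetic, ← integral_sub (integrable_kinetic m hφ) (integrable_kinetic 0 hφ)]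
  refine integral_congr_ae (Eventually.of_forall fun ξ => ?_)
  simp only [sqrt_zero_symbol (norm_nonneg ξ)]
  ring

theorem kinetic_zero_lt {m : ℝ} (hm : 0 < m) {φ : L2} (hφ : φ ∈ HHalf) (hne : φ ≠ 0) :
    kinetic 0 φ < kinetic m φ := by
  rw [← sub_pos, kinetic_sub_kinetic_zero m hφ]
  refine integral_weight_pos (fourier_ne_zero hne)
    (Eventually.of_forall fun ξ => sub_pos.2 (lt_symbol hm ‖ξ‖)) ?_
  refine ((integrable_kinetic m hφ).sub (integrable_kinetic 0 hφ)).congr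
    (Eventually.of_forall fun ξ => ?_)
  simp only [Pi.sub_apply, sqrt_zero_symbol (norm_nonneg ξ)]
  ring

theorem kinetic_zero_le {m : ℝ} (hm : 0 < m) {φ : L2} (hφ : φ ∈ HHalf) :
    kinetic 0 φ ≤ kinetic m φ := by
  refine integral_mono (integrable_kinetic 0 hφ) (integrable_kinetic m hφ) fun ξ => ?_
  simp only [sqrt_zero_symbol (norm_nonneg ξ)]
  gcongr
  exact (lt_symbol hm ‖ξ‖).le

theorem kinetic_le {m : ℝ} (hm : 0 < m) {φ : L2} (hφ : φ ∈ HHalf) :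
    kinetic m φ ≤ kinetic 0 φ + m * mass φ := by
  rw [← sub_le_iff_le_add', kinetic_sub_kinetic_zero m hφ, ← mass_fourier, ← integral_const_mul]
  have hi := (integrable_kinetic m hφ).sub (integrable_kinetic 0 hφ)
  refine integral_mono (hi.congr (Eventually.of_forall fun ξ => ?_))
    ((integrable_norm_sq _).const_mul m) fun ξ => ?_
  · simp only [Pi.sub_apply, sqrt_zero_symbol (norm_nonneg ξ)]
    ring
  · simp only
    gcongr
    have := symbol_le m ‖ξ‖ (norm_nonneg ξ)
    rw [abs_of_pos hm] at this
    linarith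

/-- Under concentration the mass term becomes negligible. -/
theorem tendsto_kinetic_rescale {m : ℝ} (hm : 0 < m) {φ : L2} (hφ : φ ∈ HHalf) :
    Tendsto (fun n : ℕ => kinetic m (rescale (Nat.cast_add_one_pos (α := ℝ) n) 0 φ)
      - kinetic 0 (rescale (Nat.cast_add_one_pos (α := ℝ) n) 0 φ)) atTop (𝓝 0) := by
  have h1 : ∀ n : ℕ, kinetic m (rescale (Nat.cast_add_one_pos (α := ℝ) n) 0 φ)
      - kinetic 0 (rescale (Nat.cast_add_one_pos (α := ℝ) n) 0 φ)
      = ∫ ξ : R3, (Real.sqrt ((2 * Real.pi * (((n : ℝ) + 1) * ‖ξ‖)) ^ 2 + m ^ 2)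
        - 2 * Real.pi * (((n : ℝ) + 1) * ‖ξ‖)) * ‖(𝓕 φ : L2) ξ‖ ^ 2 := by
    intro n
    rw [kinetic_sub_kinetic_zero m (rescale_mem_HHalf _ _ hφ), integral_weight_rescale
      (fun ξ => Real.sqrt ((2 * Real.pi * ‖ξ‖) ^ 2 + m ^ 2) - 2 * Real.pi * ‖ξ‖)]
    simp_rw [norm_smul, Real.norm_of_nonneg (Nat.cast_add_one_pos (α := ℝ) n).le]
  simp_rw [h1]
  have h0 : (0 : ℝ) = ∫ _ : R3, (0 : ℝ) := by simp
  rw [h0]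
  -- The symbol difference `√(x² + m²) - x` is at most `m`, which gives the majorant, and at most
  -- `m² / x`, which gives the pointwise limit as `x → ∞`.
  refine tendsto_integral_of_dominated_convergence (fun ξ => m * ‖(𝓕 φ : L2) ξ‖ ^ 2)
    (fun n => ?_) ((integrable_norm_sq _).const_mul m) (fun n => Eventually.of_forall fun ξ => ?_) ?_
  · exact (by fun_prop : Continuous fun ξ : R3 =>
      Real.sqrt ((2 * Real.pi * (((n : ℝ) + 1) * ‖ξ‖)) ^ 2 + m ^ 2)
        - 2 * Real.pi * (((n : ℝ) + 1) * ‖ξ‖)).aestronglyMeasurable.mul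
      (integrable_norm_sq _).aestronglyMeasurable
  · have hpos : 0 ≤ ((n : ℝ) + 1) * ‖ξ‖ := by positivity
    have h2 := (lt_symbol hm (((n : ℝ) + 1) * ‖ξ‖)).le
    have h3 := symbol_le m _ hpos
    rw [abs_of_pos hm] at h3
    rw [Real.norm_of_nonneg (mul_nonneg (by linarith) (by positivity))]
    gcongr
    linarith
  · filter_upwards [ae_ne 0] with ξ hξ
    have hξ : 0 < ‖ξ‖ := norm_pos_iff.2 hξ
    have hp := Real.pi_pos
    have hx : Tendsto (fun n : ℕ => 2 * Real.pi * (((n : ℝ) + 1) * ‖ξ‖)) atTop atTop :=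
      ((tendsto_atTop_add_const_right _ 1 tendsto_natCast_atTop_atTop).atTop_mul_const
        hξ).const_mul_atTop (by positivity)
    have h4 : Tendsto (fun x : ℝ => Real.sqrt (x ^ 2 + m ^ 2) - x) atTop (𝓝 0) := by
      refine tendsto_of_tendsto_of_tendsto_of_le_of_le' tendsto_const_nhds
        ((tendsto_const_nhds (x := m ^ 2)).div_atTop tendsto_id) ?_ ?_
      · filter_upwards [eventually_gt_atTop 0] with x hx
        exact sub_nonneg.2 (Real.le_sqrt_of_sq_le (by nlinarith))
      · filter_upwards [eventually_gt_atTop 0] with x hx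
        rw [id, sub_le_iff_le_add, Real.sqrt_le_iff]
        refine ⟨by positivity, ?_⟩
        have h5 : (m ^ 2 / x + x) ^ 2 = (m ^ 2 / x) ^ 2 + 2 * m ^ 2 + x ^ 2 := by
          field_simp; ring
        rw [h5]
        nlinarith [sq_nonneg (m ^ 2 / x), sq_nonneg m]
    have h6 := (h4.comp hx).mul_const (‖(𝓕 φ : L2) ξ‖ ^ 2)
    rw [zero_mul] at h6
    exact h6

/-! ### Existence of an optimizer for the critical mass -/

/-- The quotient is invariant under multiplication by constants and dilations, so these two freedoms
fix the mass and the kinetic energy. -/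
theorem exists_near_optimizer {ε : ℝ} (hε : 0 < ε) : ∃ φ ∈ HHalf, mass φ = criticalMass ∧
    kinetic 0 φ = 1 ∧ 1 - newton φ / 2 ≤ ε := by
  have hN := criticalMass_pos
  have hne : ((fun ψ : L2 => kinetic 0 ψ * mass ψ / newton ψ) ''
      {ψ | ψ ∈ HHalf ∧ ψ ≠ 0}).Nonempty := by
    obtain ⟨φ, h1, h2⟩ := exists_HHalf_ne_zero
    exact ⟨_, φ, ⟨h1, h2⟩, rfl⟩
  obtain ⟨_, ⟨ψ, ⟨hψ, hψ0⟩, rfl⟩, hlt⟩ := exists_lt_of_csInf_lt hne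
    (b := criticalMass / 2 * (1 + ε)) (by
      have : sInf ((fun ψ : L2 => kinetic 0 ψ * mass ψ / newton ψ) ''
        {ψ | ψ ∈ HHalf ∧ ψ ≠ 0}) = criticalMass / 2 := by unfold criticalMass; ring
      rw [this]; nlinarith)
  have hT := kinetic_zero_pos hψ hψ0
  have hM := mass_pos hψ0
  have hD := newton_pos hψ hψ0
  set s := criticalMass / mass ψ with hs
  have hs0 : 0 < s := by positivity
  set l := (s * kinetic 0 ψ)⁻¹ with hl
  have hl0 : 0 < l := by positivity
  refine ⟨rescale hl0 0 (((Real.sqrt s : ℝ) : ℂ) • ψ), rescale_mem_HHalf _ _ (HHalf_smul _ hψ),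
    ?_, ?_, ?_⟩
  · rw [mass_rescale, mass_smul, norm_sqrt_sq hs0.le, hs]; field_simp
  · rw [kinetic_zero_rescale, kinetic_smul, norm_sqrt_sq hs0.le, hl]; field_simp
  · rw [newton_rescale, newton_smul, norm_sqrt_pow_four hs0.le]
    have e : l * (s ^ 2 * newton ψ) = criticalMass * newton ψ / (kinetic 0 ψ * mass ψ) := by
      rw [hl, hs]; field_simp
    rw [e]
    simp only at hlt
    rw [div_lt_iff₀ hD] at hlt
    have h1 : 2 * (1 - ε) ≤ criticalMass * newton ψ / (kinetic 0 ψ * mass ψ) := by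
      rw [le_div_iff₀ (by positivity)]
      have h2 : 0 < kinetic 0 ψ * mass ψ := by positivity
      have h3 : 0 < criticalMass * newton ψ := by positivity
      rcases le_or_gt 1 ε with h | h
      · nlinarith
      · nlinarith [mul_pos hε h3, mul_pos h3 (mul_pos hε hε)]
    linarith

/-- Gives strict positivity of `T - D/2` for a nonzero function of mass below critical; this
excludes splitting of an optimizing sequence. -/
theorem kinetic_mul_le {φ : L2} (hφ : φ ∈ HHalf) :
    kinetic 0 φ * (1 - mass φ / criticalMass) ≤ kinetic 0 φ - newton φ / 2 := by
  have hN := criticalMass_pos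
  have h := criticalMass_mul_newton_le hφ
  have h1 : newton φ / 2 ≤ kinetic 0 φ * mass φ / criticalMass := by
    rw [div_le_div_iff₀ two_pos hN]; linarith
  have h2 : kinetic 0 φ * (1 - mass φ / criticalMass)
      = kinetic 0 φ - kinetic 0 φ * mass φ / criticalMass := by ring
  linarith

theorem newton_le_of_mass {φ : L2} (hφ : φ ∈ HHalf) (hm : mass φ = criticalMass) :
    newton φ / 2 ≤ kinetic 0 φ := by
  have h := kinetic_mul_le hφ
  rw [hm, div_self criticalMass_pos.ne', sub_self, mul_zero] at h
  linarith

theorem exists_optimizer : ∃ Q ∈ HHalf, mass Q = criticalMass ∧ newton Q = 2 * kinetic 0 Q := by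
  have hN := criticalMass_pos
  -- The shift by `2` makes the error at most `1 / 2`, so every term has Newtonian energy at least
  -- `1`.
  choose φ hφ hφm hφk hφn using fun n : ℕ => exists_near_optimizer
    (ε := 1 / ((n : ℝ) + 2)) (by positivity)
  have hhalf : ∀ n : ℕ, 1 / ((n : ℝ) + 2) ≤ 1 / 2 := fun n => by
    gcongr; linarith [(Nat.cast_nonneg n : (0 : ℝ) ≤ n)]
  obtain ⟨ψ, r, σ, hψ, hψ0, hr, hσ, tM, -, tT, tD, -⟩ := exists_profile 0 (α := 1 / 2)
    (by norm_num) (by norm_num) φ hφ (A := criticalMass + 1) (c := 1)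
    (fun n => by rw [hφk]; linarith) (fun n => by rw [hφm]; linarith) one_pos
    (fun n => by have := hφn n; have := hhalf n; linarith)
  have hψM := mass_pos hψ0
  have hψT := kinetic_zero_pos hψ hψ0
  have tMr : Tendsto (fun n => mass (r n)) atTop (𝓝 (criticalMass - mass ψ)) := by
    have := (tendsto_const_nhds (x := criticalMass - mass ψ)).sub tM
    rw [sub_zero] at this
    refine this.congr fun n => ?_
    rw [hφm]; ring
  have hle : mass ψ ≤ criticalMass := by
    have := ge_of_tendsto' tMr fun n => mass_nonneg (r n)
    linarith
  -- The nonzero profile leaves the remainder strictly below the critical mass, where `T - D/2` is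
  -- nonnegative. The profile then inherits `T - D/2 ≤ 0`, which forces it to carry the full mass.
  have hev : ∀ᶠ n in atTop, 0 ≤ kinetic 0 (r n) - newton (r n) / 2 := by
    filter_upwards [tMr.eventually (gt_mem_nhds (by linarith : criticalMass - mass ψ < criticalMass))]
      with n hn
    refine le_trans (mul_nonneg (kinetic_zero_nonneg _) ?_) (kinetic_mul_le (hr n))
    rw [sub_nonneg, div_le_one hN]
    exact hn.le
  have tε : Tendsto (fun n => 1 / (((σ n : ℕ) : ℝ) + 2)) atTop (𝓝 0) := by
    refine (tendsto_const_nhds (x := (1 : ℝ))).div_atTop ?_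
    exact tendsto_atTop_add_const_right _ 2 (tendsto_natCast_atTop_atTop.comp hσ.tendsto_atTop)
  have hψH : kinetic 0 ψ - newton ψ / 2 ≤ 0 := by
    have t1 := tε.sub (tT.sub (tD.div_const 2))
    simp only [zero_div, sub_zero] at t1
    refine ge_of_tendsto t1 ?_
    filter_upwards [hev] with n hn
    have h2 := hφn (σ n)
    rw [hφk]
    linarith
  have h3 := kinetic_mul_le hψ
  have hge : criticalMass ≤ mass ψ := by
    by_contra! hlt
    have : 0 < kinetic 0 ψ * (1 - mass ψ / criticalMass) :=
      mul_pos hψT (sub_pos.2 ((div_lt_one hN).2 hlt))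
    linarith
  have hmass := le_antisymm hle hge
  refine ⟨ψ, hψ, hmass, ?_⟩
  have := newton_le_of_mass hψ hmass
  linarith

/-! ### The critical energy -/

theorem ne_zero_of_mem_admissible {φ : L2} (hφ : φ ∈ admissible criticalMass) : φ ≠ 0 := by
  rintro rfl
  have h := hφ.2
  rw [mass_eq_norm_sq, norm_zero, zero_pow two_ne_zero] at h
  exact criticalMass_pos.ne h

theorem energy_pos {m α : ℝ} (hm : 0 < m) (h0 : 0 < α) (h1 : α < 1) {β : ℝ} (hβ : 0 ≤ β) {φ : L2}
    (hφ : φ ∈ admissible criticalMass) : 0 < energy m α β φ := by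
  rw [energy_eq m h0 h1 β hφ.1]
  have h2 := newton_le_of_mass hφ.1 hφ.2
  have h3 := kinetic_zero_lt hm hφ.1 (ne_zero_of_mem_admissible hφ)
  have h4 := mul_nonneg hβ (inter_riesz_nonneg α φ)
  linarith

theorem groundEnergy_le {m α β N : ℝ} {φ : L2} (hφ : φ ∈ admissible N) :
    groundEnergy m α β N ≤ (energy m α β φ : EReal) := iInf₂_le φ hφ

theorem groundEnergy_nonneg {m α : ℝ} (hm : 0 < m) (h0 : 0 < α) (h1 : α < 1) {β : ℝ}
    (hβ : 0 ≤ β) : 0 ≤ groundEnergy m α β criticalMass :=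
  le_iInf₂ fun _ hφ => EReal.coe_nonneg.2 (energy_pos hm h0 h1 hβ hφ).le

theorem exists_energy_zero_lt {m α : ℝ} (hm : 0 < m) (h0 : 0 < α) (h1 : α < 1) {ε : ℝ}
    (hε : 0 < ε) : ∃ φ ∈ admissible criticalMass, energy m α 0 φ < ε := by
  obtain ⟨Q, hQ, hQm, hQn⟩ := exists_optimizer
  obtain ⟨n, hn⟩ := ((tendsto_kinetic_rescale hm hQ).eventually (gt_mem_nhds hε)).exists
  set χ := rescale (Nat.cast_add_one_pos (α := ℝ) n) 0 Q with hχ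
  have hχH : χ ∈ HHalf := rescale_mem_HHalf _ _ hQ
  refine ⟨χ, ⟨hχH, by rw [hχ, mass_rescale, hQm]⟩, ?_⟩
  have h2 : newton χ = 2 * kinetic 0 χ := by
    rw [hχ, newton_rescale, kinetic_zero_rescale, hQn]; ring
  rw [energy_eq m h0 h1 0 hχH, h2]
  linarith

theorem groundEnergy_zero {m α : ℝ} (hm : 0 < m) (h0 : 0 < α) (h1 : α < 1) :
    groundEnergy m α 0 criticalMass = 0 := by
  refine le_antisymm ?_ (groundEnergy_nonneg hm h0 h1 le_rfl)
  refine le_of_forall_gt fun y hy => ?_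
  obtain ⟨z, hz0, hzy⟩ := EReal.lt_iff_exists_real_btwn.1 hy
  obtain ⟨φ, hφ, hlt⟩ := exists_energy_zero_lt hm h0 h1 (EReal.coe_pos.1 hz0)
  exact ((groundEnergy_le hφ).trans_lt (EReal.coe_lt_coe_iff.2 hlt)).trans hzy

/-- An exact optimizer is needed: any positive excess of `T - D/2` would grow like `l` under
dilation and defeat the gain of order `l ^ α`. -/
theorem groundEnergy_neg {m α : ℝ} (hm : 0 < m) (h0 : 0 < α) (h1 : α < 1) {β : ℝ} (hβ : β < 0) :
    groundEnergy m α β criticalMass = ⊥ := by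
  obtain ⟨Q, hQ, hQm, hQn⟩ := exists_optimizer
  have hQ0 : Q ≠ 0 := ne_zero_of_mem_admissible ⟨hQ, hQm⟩
  have hW := inter_riesz_pos h0 h1.le hQ hQ0
  rw [EReal.eq_bot_iff_forall_lt]
  intro y
  have ht : Tendsto (fun l : ℝ => 1 / 4 * -β * inter (riesz α) Q * l ^ α) atTop atTop :=
    (tendsto_rpow_atTop h0).const_mul_atTop (mul_pos (by linarith) hW)
  obtain ⟨l, hl, hl0⟩ := ((ht.eventually_gt_atTop (1 / 2 * (m * criticalMass) - y)).and
    (eventually_gt_atTop 0)).exists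
  set χ := rescale hl0 0 Q with hχ
  have hχH : χ ∈ HHalf := rescale_mem_HHalf _ _ hQ
  have hχm : mass χ = criticalMass := by rw [hχ, mass_rescale, hQm]
  refine (groundEnergy_le (φ := χ) ⟨hχH, hχm⟩).trans_lt (EReal.coe_lt_coe_iff.2 ?_)
  have h2 : newton χ = 2 * kinetic 0 χ := by
    rw [hχ, newton_rescale, kinetic_zero_rescale, hQn]; ring
  have h3 : inter (riesz α) χ = l ^ α * inter (riesz α) Q := inter_riesz_rescale α hl0 0 Q
  have h4 := kinetic_le hm hχH
  rw [hχm] at h4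
  rw [energy_eq m h0 h1 β hχH, h2, h3]
  linarith

/-! ### Existence of maximal ground states -/

/-- With a repulsive term, the energy controls the kinetic energy at the critical mass. -/
theorem exists_kinetic_bound {m α : ℝ} (hm : 0 < m) (h0 : 0 < α) (h1 : α < 1) {β : ℝ} (hβ : 0 < β)
    (B : ℝ) : ∃ A : ℝ, ∀ φ ∈ admissible criticalMass, energy m α β φ ≤ B → kinetic 0 φ ≤ A := by
  have hN := criticalMass_pos
  set N := criticalMass with hNdef
  obtain ⟨C, hC, hvan⟩ := newton_le_of_locMass_le
  -- These constants, with `L` of order `1 / T` below, turn the nonvanishing estimate into `D ≤ T /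
  -- 4 + T / 2` for a spread-out function, contradicting `D ≥ T`.
  set κ := Real.sqrt (1 / (8 * C * N)) with hκ
  have hκp : 0 < κ := Real.sqrt_pos.2 (by positivity)
  have hκ2 : κ ^ 2 = 1 / (8 * C * N) := Real.sq_sqrt (by positivity)
  set η := κ / (8 * C) with hη
  have hηp : 0 < η := by positivity
  have ht : Tendsto (fun T : ℝ => η ^ 2 * (T / (4 * N ^ 2)) ^ α) atTop atTop :=
    ((tendsto_rpow_atTop h0).comp (tendsto_id.atTop_div_const (by positivity))).const_mul_atTop
      (by positivity)
  obtain ⟨A, hA⟩ := eventually_atTop.1 ((ht.eventually_gt_atTop (4 * B / β)).and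
    (eventually_gt_atTop (max (4 * B) 0)))
  refine ⟨A, fun φ hφ hE => ?_⟩
  by_contra! hlt
  obtain ⟨hbig, hmax⟩ := hA _ hlt.le
  have hT4 : 4 * B < kinetic 0 φ := (le_max_left _ _).trans_lt hmax
  have hT0 : 0 < kinetic 0 φ := (le_max_right _ _).trans_lt hmax
  rw [energy_eq m h0 h1 β hφ.1] at hE
  have hK := kinetic_zero_le hm hφ.1
  have hD := newton_le_of_mass hφ.1 hφ.2
  have hW0 := mul_nonneg hβ.le (inter_riesz_nonneg α φ)
  -- The energy bound gives `D ≥ 2 T - 4 B`, and `T > 4 B`. Conversely `D ≤ 2 T` leaves at most `4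
  -- B` for `β W`.
  have hDT : kinetic 0 φ ≤ newton φ := by linarith
  have hWB : inter (riesz α) φ ≤ 4 * B / β := by
    rw [le_div_iff₀ hβ]; linarith
  set L := 2 * N ^ 2 / kinetic 0 φ with hL
  have hLp : 0 < L := by positivity
  obtain ⟨x, hx⟩ : ∃ x, ENNReal.ofReal η ≤ locMass φ x L := by
    by_contra! hcon
    have h2 := hvan φ hφ.1 κ L η hκp hLp hηp.le fun x => (hcon x).le
    have hM : mass φ = N := hφ.2
    have h3 : C * (κ ^ 2 * mass φ + η / κ) = 1 / 4 := by
      rw [hM, hκ2, hη]; field_simp; norm_num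
    have h4 : mass φ ^ 2 / L = kinetic 0 φ / 2 := by
      rw [hM, hL]; field_simp
    rw [h3, h4] at h2
    linarith
  have h5 := le_inter_riesz h0 h1.le hφ.1 hLp hηp.le hx
  have h6 : η ^ 2 / (2 * L) ^ α = η ^ 2 * (kinetic 0 φ / (4 * N ^ 2)) ^ α := by
    have : 2 * L = (kinetic 0 φ / (4 * N ^ 2))⁻¹ := by rw [hL]; field_simp; norm_num
    rw [this, Real.inv_rpow (by positivity), div_inv_eq_mul]
  rw [h6] at h5
  linarith

/-- Rescale `u` by `t^(-1/2)` to critical mass, obtaining `v`. The quartic terms of `t² E(v)` match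
those of `E(u)`, and the kinetic surplus `(1 - t) K(u) / 2` is at least `(1 - t) t m N / 2`. -/
theorem le_energy_of_mass_le {m α : ℝ} (h0 : 0 < α) (h1 : α < 1) {β e : ℝ}
    (he : ∀ φ ∈ admissible criticalMass, e ≤ energy m α β φ) {u : L2} (hu : u ∈ HHalf) {t : ℝ}
    (ht : mass u = t * criticalMass) (ht1 : t ≤ 1) :
    t ^ 2 * e + t * (1 - t) * (m * criticalMass / 2) ≤ energy m α β u := by
  have hN := criticalMass_pos
  have ht0 : 0 ≤ t := by
    have := mass_nonneg u
    rw [ht] at this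
    exact nonneg_of_mul_nonneg_left this hN
  rcases ht0.eq_or_lt with rfl | htp
  · have hu0 : u = 0 := mass_eq_zero (by rw [ht, zero_mul])
    have hk : kinetic m (0 : L2) = 0 := by
      have := kinetic_smul m 0 (0 : L2)
      simpa using this
    have hi : ∀ k, inter k (0 : L2) = 0 := fun k => by
      have := inter_smul k 0 (0 : L2)
      simpa using this
    rw [energy_eq m h0 h1 β hu, hu0, newton_eq_inter, hk, hi, hi]
    simp
  · set v := ((Real.sqrt t⁻¹ : ℝ) : ℂ) • u with hv
    have hti : 0 ≤ t⁻¹ := by positivity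
    have hvH : v ∈ HHalf := HHalf_smul _ hu
    have hvm : mass v = criticalMass := by
      rw [hv, mass_smul, norm_sqrt_sq hti, ht]; field_simp
    have h2 := he v ⟨hvH, hvm⟩
    rw [energy_eq m h0 h1 β hvH, hv, kinetic_smul, newton_smul, inter_smul, norm_sqrt_sq hti,
      norm_sqrt_pow_four hti] at h2
    have h3 := mul_mass_le_kinetic m hu
    rw [ht] at h3
    rw [energy_eq m h0 h1 β hu]
    have h4 := mul_le_mul_of_nonneg_left h2 (by positivity : 0 ≤ t ^ 2)
    have h5 : t ^ 2 * (1 / 2 * (t⁻¹ * kinetic m u) + 1 / 4 *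
        (β * (t⁻¹ ^ 2 * inter (riesz α) u) - t⁻¹ ^ 2 * newton u))
        = t * (1 / 2 * kinetic m u) + 1 / 4 * (β * inter (riesz α) u - newton u) := by
      field_simp
    rw [h5] at h4
    have h6 := mul_le_mul_of_nonneg_left h3 (by linarith : 0 ≤ 1 - t)
    linarith

theorem exists_minimizer_of_lt {m α : ℝ} (hm : 0 < m) (h0 : 0 < α) (h1 : α < 1) {β : ℝ}
    (hβ : 0 < β) {e : ℝ} (he : groundEnergy m α β criticalMass = (e : EReal))
    (hlt : e < m * criticalMass / 2) : ∃ φ : L2, IsMinimizer m α β criticalMass φ := by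
  have hN := criticalMass_pos
  have hle : ∀ φ ∈ admissible criticalMass, e ≤ energy m α β φ := fun φ hφ => by
    have := groundEnergy_le (m := m) (α := α) (β := β) hφ
    rwa [he, EReal.coe_le_coe_iff] at this
  set δ := (m * criticalMass / 2 - e) / 2 with hδ
  have hδ0 : 0 < δ := by rw [hδ]; linarith
  have hseq : ∀ n : ℕ, ∃ φ ∈ admissible criticalMass, energy m α β φ < e + δ / ((n : ℝ) + 1) := by
    intro n
    have hlt' : groundEnergy m α β criticalMass < ((e + δ / ((n : ℝ) + 1) : ℝ) : EReal) := by
      rw [he, EReal.coe_lt_coe_iff]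
      have : 0 < δ / ((n : ℝ) + 1) := by positivity
      linarith
    obtain ⟨φ, hφ⟩ := iInf_lt_iff.1 hlt'
    obtain ⟨hadm, hφ⟩ := iInf_lt_iff.1 hφ
    exact ⟨φ, hadm, EReal.coe_lt_coe_iff.1 hφ⟩
  choose φ hφ hφe using hseq
  have hδn : ∀ n : ℕ, δ / ((n : ℝ) + 1) ≤ δ := fun n =>
    div_le_self hδ0.le (by linarith [(Nat.cast_nonneg n : (0 : ℝ) ≤ n)])
  obtain ⟨A, hA⟩ := exists_kinetic_bound hm h0 h1 hβ (e + δ)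
  -- The kinetic part alone costs at least `m N / 2 = e + 2 δ`, so an energy at most `e + δ`
  -- requires Newtonian energy at least `4 δ`.
  have hD : ∀ n, 4 * δ ≤ newton (φ n) := fun n => by
    have h2 := hφe n
    rw [energy_eq m h0 h1 β (hφ n).1] at h2
    have h3 := mul_mass_le_kinetic m (hφ n).1
    rw [(hφ n).2] at h3
    have h4 := mul_nonneg hβ.le (inter_riesz_nonneg α (φ n))
    have h5 := hδn n
    have h6 : e = m * criticalMass / 2 - 2 * δ := by rw [hδ]; ring
    linarith
  obtain ⟨ψ, r, σ, hψ, hψ0, hr, hσ, tM, tK, -, tD, tW⟩ := exists_profile m h0 h1 φ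
    (fun n => (hφ n).1) (A := max A criticalMass) (c := 4 * δ)
    (fun n => (hA _ (hφ n) ((hφe n).le.trans (by linarith [hδn n]))).trans (le_max_left _ _))
    (fun n => by rw [(hφ n).2]; exact le_max_right _ _) (by positivity) hD
  set t := mass ψ / criticalMass with ht
  have htψ : mass ψ = t * criticalMass := by rw [ht]; field_simp
  have ht0 : 0 < t := div_pos (mass_pos hψ0) hN
  set s : ℕ → ℝ := fun n => mass (r n) / criticalMass with hs
  have hsr : ∀ n, mass (r n) = s n * criticalMass := fun n => by simp only [hs]; field_simp
  have ts : Tendsto s atTop (𝓝 (1 - t)) := by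
    have h2 := ((tendsto_const_nhds (x := criticalMass - mass ψ)).sub tM).div_const criticalMass
    have h3 : (criticalMass - mass ψ - 0) / criticalMass = 1 - t := by rw [ht]; field_simp; ring
    rw [h3] at h2
    refine h2.congr fun n => ?_
    rw [(hφ (σ n)).2]
    simp only [hs]
    congr 1; ring
  have ht1 : t ≤ 1 := by
    have := ge_of_tendsto' ts fun n => div_nonneg (mass_nonneg (r n)) hN.le
    linarith
  have tE : Tendsto (fun n => energy m α β (φ (σ n))) atTop (𝓝 e) := by
    have h2 : Tendsto (fun n => e + δ / (((σ n : ℕ) : ℝ) + 1)) atTop (𝓝 e) := by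
      have h3 : Tendsto (fun n => ((σ n : ℕ) : ℝ) + 1) atTop atTop :=
        tendsto_atTop_add_const_right _ 1 (tendsto_natCast_atTop_atTop.comp hσ.tendsto_atTop)
      simpa using tendsto_const_nhds.add ((tendsto_const_nhds (x := δ)).div_atTop h3)
    exact tendsto_of_tendsto_of_tendsto_of_le_of_le tendsto_const_nhds h2
      (fun n => hle _ (hφ (σ n))) (fun n => (hφe (σ n)).le)
  have tr : Tendsto (fun n => energy m α β (r n)) atTop (𝓝 (e - energy m α β ψ)) := by
    have h2 := (tE.sub_const (energy m α β ψ)).sub ((tK.const_mul (1 / 2)).add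
      (((tW.const_mul β).sub tD).const_mul (1 / 4)))
    simp only [mul_zero, sub_zero, add_zero] at h2
    refine h2.congr fun n => ?_
    rw [energy_eq m h0 h1 β (hφ (σ n)).1, energy_eq m h0 h1 β hψ, energy_eq m h0 h1 β (hr n)]
    ring
  have hrlow : (1 - t) ^ 2 * e + (1 - t) * (1 - (1 - t)) * (m * criticalMass / 2)
      ≤ e - energy m α β ψ := by
    refine le_of_tendsto_of_tendsto (((ts.pow 2).mul_const e).add
      ((ts.mul (ts.const_sub 1)).mul_const (m * criticalMass / 2))) tr ?_
    filter_upwards [ts.eventually (gt_mem_nhds (by linarith : 1 - t < 1))] with n hn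
    exact le_energy_of_mass_le h0 h1 hle (hr n) (hsr n) hn.le
  have hψlow := le_energy_of_mass_le h0 h1 hle hψ htψ ht1
  -- Adding the lower bounds for profile and remainder gives `2 t (1 - t) (m N / 2 - e) ≤ 0`, while
  -- `t > 0` and `e < m N / 2`.
  have ht1' : t = 1 := by
    by_contra hne
    have h2 : 0 < t * (1 - t) := mul_pos ht0 (sub_pos.2 (lt_of_le_of_ne ht1 hne))
    nlinarith [mul_pos h2 (sub_pos.2 hlt)]
  have hadm : ψ ∈ admissible criticalMass := ⟨hψ, by rw [htψ, ht1', one_mul]⟩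
  refine ⟨ψ, hadm, ?_⟩
  rw [he, EReal.coe_eq_coe_iff]
  rw [ht1'] at hrlow
  refine le_antisymm ?_ (hle ψ hadm)
  linarith

theorem exists_minimizer {m α : ℝ} (hm : 0 < m) (h0 : 0 < α) (h1 : α < 1) :
    ∃ β₀ : ℝ, 0 < β₀ ∧ ∀ β : ℝ, 0 < β → β < β₀ →
      ∃ φ : L2, IsMinimizer m α β criticalMass φ := by
  have hN := criticalMass_pos
  obtain ⟨φ, hφ, hE⟩ := exists_energy_zero_lt hm h0 h1
    (ε := m * criticalMass / 4) (by positivity)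
  have hW := inter_riesz_pos h0 h1.le hφ.1 (ne_zero_of_mem_admissible hφ)
  -- The trial function is fixed before `β`, with energy below `m N / 4` at `β = 0`. The threshold
  -- makes `β W / 4 < m N / 4`, for a total below `m N / 2`.
  refine ⟨m * criticalMass / inter (riesz α) φ, by positivity, fun β hβ hlt => ?_⟩
  rw [lt_div_iff₀ hW] at hlt
  have hEβ : energy m α β φ < m * criticalMass / 2 := by
    rw [energy_eq m h0 h1 _ hφ.1] at hE ⊢
    linarith
  have hle := groundEnergy_le (m := m) (α := α) (β := β) hφ
  have hnn := groundEnergy_nonneg hm h0 h1 hβ.le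
  have htop : groundEnergy m α β criticalMass ≠ ⊤ := (hle.trans_lt (EReal.coe_lt_top _)).ne
  have hbot : groundEnergy m α β criticalMass ≠ ⊥ := (EReal.bot_lt_zero.trans_le hnn).ne'
  refine exists_minimizer_of_lt hm h0 h1 hβ (EReal.coe_toReal htop hbot).symm ?_
  refine lt_of_le_of_lt ?_ hEβ
  rwa [← EReal.coe_le_coe_iff, EReal.coe_toReal htop hbot]

theorem not_exists_minimizer {m α : ℝ} (hm : 0 < m) (h0 : 0 < α) (h1 : α < 1) {β : ℝ}
    (hβ : β ≤ 0) : ¬ ∃ φ : L2, IsMinimizer m α β criticalMass φ := by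
  rintro ⟨φ, hφ, hE⟩
  rcases hβ.eq_or_lt with rfl | hβ
  · rw [groundEnergy_zero hm h0 h1, EReal.coe_eq_zero] at hE
    exact (energy_pos hm h0 h1 le_rfl hφ).ne' hE
  · rw [groundEnergy_neg hm h0 h1 hβ] at hE
    exact EReal.coe_ne_bot _ hE

end BosonStar

end

theorem theorem1p2 (m α : ℝ) (hm : 0 < m) (hα0 : 0 < α) (hα1 : α < 1) :
    ((∀ β : ℝ, β ≤ 0 →
        ¬ ∃ φ : BosonStar.L2, BosonStar.IsMinimizer m α β BosonStar.criticalMass φ) ∧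
      BosonStar.groundEnergy m α 0 BosonStar.criticalMass = 0 ∧
      (∀ β : ℝ, β < 0 → BosonStar.groundEnergy m α β BosonStar.criticalMass = ⊥)) ∧
    (∃ β₀ : ℝ, 0 < β₀ ∧ ∀ β : ℝ, 0 < β → β < β₀ →
      ∃ φ : BosonStar.L2, BosonStar.IsMinimizer m α β BosonStar.criticalMass φ) :=
  ⟨⟨fun _ hβ => BosonStar.not_exists_minimizer hm hα0 hα1 hβ,
    BosonStar.groundEnergy_zero hm hα0 hα1,
    fun _ hβ => BosonStar.groundEnergy_neg hm hα0 hα1 hβ⟩,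
    BosonStar.exists_minimizer hm hα0 hα1⟩
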